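/- Theorem 6.1. Let $d\ge 0$ and $k$ be fixed integers such that there are positive integers $k_1,k_2,k_3$ with $$k_1+k_2+k_3=k,\qquad 16d(d-1)^3(d+1)<2^{k_1},\qquad 16d(d-1)^3(d+1)<2^{k_2},\qquad 2e(d+1)<2^{k_3}.$$ Then there is a $(\mathrm{polylog}\,N,\,O(N),\,1/N)$-local computation algorithm for two-colouring $k$-uniform hypergraphs in which each hyperedge intersects at most $d$ other hyperedges, where $N\ge 1$ is the number of hyperedges and the number $m$ of vertices is at most $kN$. In detail: there are a word-RAM program $A$ and constants $b,C,a$, depending only on $d,k,k_1,k_2,k_3$, such that the following holds for every such hypergraph $H$, a family of $N$ hyperedges on $m$ numbered vertices, given in $O(N)$ words by the linked lists of the rows and of the columns of its vertex-hyperedge incidence matrix, for every word length $w\ge b(\lfloor\log_2 N\rfloor+1)$, and for every finite sequence of vertices $x_1,\dots,x_s$. The program receives the queries $x_1,\dots,x_s$ one after the other, outputs a word after each of them, and keeps its local memory, which is zero at the beginning, from one query to the next; it reads a word of the input or of a random tape in one step. * For all contents of the random tape, each query is answered in at most $C(\lfloor\log_2 N\rfloor+1)^a$ steps, and only $CN$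 words of local memory are used. * If the cells of the random tape are independent uniformly random words, then with probability at least $1-1/N$ there is one colouring $c$ of the vertices of $H$ with two colours and with no monochromatic hyperedge such that the output on $x_j$ is $c(x_j)$ for all $j=1,\dots,s$. -/

import Mathlib

/-! ## The word RAM

The machine has finitely many registers that are mentioned by its program, a local memory of `s`
words, and one-step word access to a read-only input and to a read-only random tape.
All words have `w` bits, and one instruction costs one unit of time. -/

namespace WordRAM

/-- The arithmetic, Boolean and comparison operations on words. -/
inductive BinOp where
  | add | sub | mul | div | mod | land | lor | xor | shl | shr | eq | lt

/-- The result of an operation on `w`-bit unsigned words: arithmetic is modulo `2 ^ w`, division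
by zero gives `0`, and comparisons give `1` (true) or `0` (false). -/
def BinOp.eval {w : ℕ} (o : BinOp) (x y : BitVec w) : BitVec w :=
  match o with
  | .add => x + y
  | .sub => x - y
  | .mul => x * y
  | .div => x / y
  | .mod => x % y
  | .land => x &&& y
  | .lor => x ||| y
  | .xor => x ^^^ y
  | .shl => x <<< y.toNat
  | .shr => x >>> y.toNat
  | .eq => if x = y then 1#w else 0#w
  | .lt => if x.toNat < y.toNat then 1#w else 0#w

/-- Instructions. Registers and program positions are natural numbers. -/
inductive Instr where
  /-- `const r n`: put the number `n` into register `r`. -/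
  | const (r n : ℕ)
  /-- `op o r a b`: apply `o` to registers `a` and `b`, put the result into register `r`. -/
  | op (o : BinOp) (r a b : ℕ)
  /-- `load r a`: put the local memory word whose address is in register `a` into register `r`. -/
  | load (r a : ℕ)
  /-- `store a r`: put register `r` into the local memory word whose address is in register `a`. -/
  | store (a r : ℕ)
  /-- `input r a`: put the input word whose address is in register `a` into register `r`. -/
  | input (r a : ℕ)
  /-- `rand r a`: put the random tape word whose address is in register `a` into register `r`. -/
  | rand (r a : ℕ)
  /-- `jump p`: continue at position `p` of the program. -/
  | jump (p : ℕ)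
  /-- `jzero r p`: if register `r` is zero, continue at position `p` of the program. -/
  | jzero (r p : ℕ)
  /-- `halt`: stop; the output is register `0`. -/
  | halt

/-- A program is a finite list of instructions. It does not depend on the word length. -/
abbrev Program := List Instr

/-- The contents of the random tape; addresses and cells are words. -/
abbrev RandomTape (w : ℕ) := BitVec w → BitVec w

/-- The contents of the local memory. -/
abbrev Memory (w : ℕ) := BitVec w → BitVec w

/-- What a run does not change: the input, the random tape, and the size of the local memory. -/
structure Env (w : ℕ) where
  input : List ℕ
  tape : RandomTape w
  space : ℕ

/-- A configuration: program counter, registers, local memory. -/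
structure Config (w : ℕ) where
  pc : ℕ
  reg : ℕ → BitVec w
  mem : Memory w

/-- The configuration that follows on setting register `r` to `v`. -/
def Config.setReg {w : ℕ} (c : Config w) (r : ℕ) (v : BitVec w) : Config w :=
  { c with pc := c.pc + 1, reg := Function.update c.reg r v }

/-- One step. The value `none` means that the machine is stuck; in particular it is stuck when it
touches a local memory address outside its `space` words, or leaves the program. -/
def step {w : ℕ} (A : Program) (E : Env w) (c : Config w) : Option (Config w) :=
  match A[c.pc]? with
  | none => none
  | some (.const r n) => some (c.setReg r (BitVec.ofNat w n))
  | some (.op o r a b) => some (c.setReg r (o.eval (c.reg a) (c.reg b)))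
  | some (.load r a) =>
      if (c.reg a).toNat < E.space then some (c.setReg r (c.mem (c.reg a))) else none
  | some (.store a r) =>
      if (c.reg a).toNat < E.space then
        some { c with pc := c.pc + 1, mem := Function.update c.mem (c.reg a) (c.reg r) }
      else none
  | some (.input r a) =>
      some (c.setReg r (BitVec.ofNat w (E.input.getD (c.reg a).toNat 0)))
  | some (.rand r a) => some (c.setReg r (E.tape (c.reg a)))
  | some (.jump p) => some { c with pc := p }
  | some (.jzero r p) => some { c with pc := if c.reg r = 0#w then p else c.pc + 1 }
  | some .halt => none

/-- The machine is at a `halt` instruction. -/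
def halted {w : ℕ} (A : Program) (c : Config w) : Bool :=
  match A[c.pc]? with
  | some .halt => true
  | _ => false

/-- `run A E t c` is the halting configuration if the machine, started in `c`, halts after at most
`t` steps, and `none` otherwise. -/
def run {w : ℕ} (A : Program) (E : Env w) : ℕ → Config w → Option (Config w)
  | 0, c => if halted A c then some c else none
  | t + 1, c => if halted A c then some c else (step A E c).bind (run A E t)

/-- The configuration in which a query is answered: the query is in register `0`, all other
registers are zero, and the local memory is as the previous queries left it. -/
def start {w : ℕ} (q : ℕ) (M : Memory w) : Config w :=
  { pc := 0, reg := Function.update (fun _ => 0#w) 0 (BitVec.ofNat w q), mem := M }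

/-- The outputs on a sequence of queries that are answered one after the other, the local memory
being kept from each query to the next; `none` if some query is not answered within `t` steps and
inside the given local memory. -/
def answers {w : ℕ} (A : Program) (E : Env w) (t : ℕ) : Memory w → List ℕ → Option (List ℕ)
  | _, [] => some []
  | M, q :: qs =>
      (run A E t (start q M)).bind fun c =>
        (answers A E t c.mem qs).map fun ys => (c.reg 0).toNat :: ys

end WordRAM

/-! ## Local computation algorithms -/

/-- A search problem: its inputs with their size parameter, the words in which an input is
presented to an algorithm, the number of positions of a solution (these can be queried), and the
valid solutions, which have a symbol at each position. -/
structure SearchProblem where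
  Input : Type
  size : Input → ℕ
  words : Input → List ℕ
  positions : Input → ℕ
  solutions : (x : Input) → Set (Fin (positions x) → ℕ)

open WordRAM in
/-- `IsLCA A P t s δ`: the program `A` is a `(t, s, δ)`-local computation algorithm for `P`.

On all inputs `x`, of size `n`, all word lengths `w` of at least a constant times `log n`, and all
finite sequences of queries, the local memory being zero at the beginning:
* for all contents of the random tape, every query is answered after at most `t n` steps, with
  a local memory of `s n` words;
* for uniformly random contents of the random tape, with probability at least `1 - δ n` all the
  outputs agree with one valid solution of `x`. -/
def IsLCA (A : Program) (P : SearchProblem) (t s : ℕ → ℕ) (δ : ℕ → ℝ) : Prop :=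
  ∃ b : ℕ, ∀ (x : P.Input) (w : ℕ), b * (Nat.log 2 (P.size x) + 1) ≤ w →
    ∀ q : List (Fin (P.positions x)),
      let out (R : RandomTape w) : Option (List ℕ) :=
        answers A ⟨P.words x, R, s (P.size x)⟩ (t (P.size x)) (fun _ => 0#w) (q.map Fin.val)
      (∀ R : RandomTape w, (out R).isSome) ∧
      1 - δ (P.size x) ≤
        (Nat.card {R : RandomTape w // ∃ y ∈ P.solutions x, out R = some (q.map y)} : ℝ) /
          Nat.card (RandomTape w)

/-! ## Hypergraphs and their two-colourings -/

/-- A hypergraph with vertices `0, …, m - 1` and a family of `N` non-empty hyperedges, numbered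
`0, …, N - 1`; hyperedges may be repeated in the family. -/
structure NumberedHypergraph (m N : ℕ) where
  edge : Fin N → Finset (Fin m)
  edge_nonempty : ∀ e, (edge e).Nonempty

namespace NumberedHypergraph

variable {m N : ℕ}

/-- Every hyperedge has exactly `k` vertices. -/
def IsUniform (H : NumberedHypergraph m N) (k : ℕ) : Prop := ∀ e, (H.edge e).card = k

/-- Every hyperedge meets at most `d` other hyperedges. -/
def MeetsAtMost (H : NumberedHypergraph m N) (d : ℕ) : Prop :=
  ∀ e, (Finset.univ.filter fun f => f ≠ e ∧ (H.edge e ∩ H.edge f).Nonempty).card ≤ d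

/-- A two-colouring: colours are `0` and `1`, and no hyperedge is monochromatic. -/
def IsTwoColoring (H : NumberedHypergraph m N) (c : Fin m → ℕ) : Prop :=
  (∀ x, c x = 0 ∨ c x = 1) ∧ ∀ e, ∃ x ∈ H.edge e, ∃ y ∈ H.edge e, c x ≠ c y

/-- The linked list that starts at address `p` of the array `a` has the entries `l`. A node of
the list is a pair of adjacent words, an entry and the address of the next node; the address `0`
ends the list. -/
def IsLinkedList (a : List ℕ) : ℕ → List ℕ → Prop
  | p, [] => p = 0
  | p, v :: l =>
      p ≠ 0 ∧ p + 1 < a.length ∧ a.getD p 0 = v ∧ IsLinkedList a (a.getD (p + 1) 0) l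

/-- The array `a` presents `H` through its sparse vertex-hyperedge incidence matrix: it begins with
the words `m` and `N`, then come the `m` addresses of the linked lists of the rows (the hyperedges
that contain a given vertex), then the `N` addresses of the linked lists of the columns (the
vertices of a given hyperedge). The nodes of the lists may be placed anywhere, in any order. The
array has room for the header and for one node in a row and one in a column for each incidence,
and its words are bounded by its length. -/
structure IsIncidenceArray (H : NumberedHypergraph m N) (a : List ℕ) : Prop where
  length_le : a.length ≤ 2 + m + N + 4 * ∑ e, (H.edge e).card
  word_le : ∀ v ∈ a, v ≤ a.length
  vertices : a.getD 0 0 = m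
  hyperedges : a.getD 1 0 = N
  row : ∀ x : Fin m, ∃ l : List (Fin N), l.Nodup ∧ (∀ e, e ∈ l ↔ x ∈ H.edge e) ∧
    IsLinkedList a (a.getD (2 + x) 0) (l.map Fin.val)
  column : ∀ e : Fin N, ∃ l : List (Fin m), l.Nodup ∧ (∀ x, x ∈ l ↔ x ∈ H.edge e) ∧
    IsLinkedList a (a.getD (2 + m + e) 0) (l.map Fin.val)

/-- An input: a `k`-uniform hypergraph with `N ≥ 1` hyperedges and at most `k * N` vertices, each
of whose hyperedges meets at most `d` others, with an incidence array of it. -/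
structure Instance (d k : ℕ) where
  (m N : ℕ)
  graph : NumberedHypergraph m N
  array : List ℕ
  N_pos : 0 < N
  m_le : m ≤ k * N
  uniform : graph.IsUniform k
  meets : graph.MeetsAtMost d
  isArray : graph.IsIncidenceArray array

/-- The problem of finding a two-colouring. The size parameter is the number of hyperedges, and
the queries are the vertices. -/
def twoColoringProblem (d k : ℕ) : SearchProblem where
  Input := Instance d k
  size x := x.N
  words x := x.array
  positions x := x.m
  solutions x := {c | x.graph.IsTwoColoring c}

end NumberedHypergraph

/-!
The two-colouring is obtained from a uniformly random one by local repairs. The bit `w (v, j)` of a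
vertex `v` at time `j` is the last bit of cell `v + m * j` of the random tape, and `c` is the
colouring by the bits at time `0`. A hyperedge is *bad* if some colour of `c` occurs fewer than `t`
times in it. The vertices of the bad hyperedges are *loose*, and the hyperedges with a loose vertex
are *affected*. The loose vertices get new colours. A hyperedge that is not affected keeps its two
colours. An affected one has either at least `t` loose vertices, which are unlikely to get all the
same new colour, or fewer than `t`; in the latter case it is not bad, so it keeps a vertex of each
colour. Hence new random colours make it monochromatic with probability at most `2 / 2 ^ t`
(`card_isMono_le`).

The affected hyperedges fall into connected components, which are repaired independently of each
other: the loose vertices start with the bits at time `1`, and in step `j` the vertices of the first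
hyperedge of the component that is not yet known to have two colours get the bits at time `j + 2` if
it is monochromatic (`repairStep`). When nothing is left to be checked, the component has no
monochromatic hyperedge (`repair_invariant`, `not_isMono_finalColor`).

Two branching processes have to die out. One is the repair, where a task is a hyperedge that has to
be checked: it is replaced by at most `d + 1` tasks with probability at most `2 / 2 ^ t`
(`sum_repair_le`). The other bounds the size of a component (`card_search_le`,
`card_large_component_le`): starting from a hyperedge, one looks for pairwise disjoint bad
hyperedges, each at distance at most `4` from an earlier one. These are bad independently of each
other, with probability `badProb k t` at most, and each gives rise to at most
`d (d - 1) + d (d - 1) ^ 2 + d (d - 1) ^ 3` new candidates (`card_nearby_le`). A process in which a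
task is replaced by `D` tasks with probability `p` dies out exponentially fast if `e p D < 1`
(`exists_decay_lt_one`), and the hypotheses on `d`, `k₁`, `k₂`, `k₃` yield a threshold `t` for which
both do (`exists_threshold`). So with probability at least `1 - 1 / N` all components have
logarithmic size and are repaired in logarithmically many steps (`exists_card_not_succeeds_le`).

The colour of a vertex is a function of the tape and of the component at the vertex only. The
program therefore needs no information from earlier queries, and its answers do not depend on their
order. It is compiled from a small language whose loops run as many times as the number of
hyperedges has binary digits. The compiled program therefore halts within polylogarithmic time
for every tape and every content of the memory (`Stmt.run_program`). Four arrays serve as local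
memory; their indices are reduced modulo a multiple of `N`, so that no access leaves it.
`Presents.colorQuery_correct` says that the program computes the colour, whatever the memory held
before, and `card_tapeColors` turns the counts of colourings into counts of tapes.
-/

/-! ### A structured language for the word RAM -/

namespace WordRAM

/-- Side-effect free expressions: program variables, literals, operations on words, input words,
random words, and reads `get t a` of entry `a` of the `t`-th of four arrays in local memory. -/
inductive Expr where
  | var (i : ℕ)
  | lit (n : ℕ)
  | op (o : BinOp) (a b : Expr)
  | inp (a : Expr)
  | rnd (a : Expr)
  | get (t : Fin 4) (a : Expr)

/-- Statements. The only loop is `loop s`, which runs `s` once for each binary digit of the input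
word at address `1`; every statement therefore terminates in polylogarithmic time. -/
inductive Stmt where
  | skip
  | assign (i : ℕ) (e : Expr)
  | put (t : Fin 4) (a e : Expr)
  | seq (s₁ s₂ : Stmt)
  | ite (e : Expr) (s₁ s₂ : Stmt)
  | loop (s : Stmt)

/-- The values of the program variables, and the local memory. -/
@[ext] structure Store (w : ℕ) where
  var : ℕ → BitVec w
  mem : Memory w

/-- The local memory address of entry `a` of array `t`. The four arrays are interleaved and have
`K * n` entries each, where `n` is the input word at address `1`; indices are reduced modulo the
length, so that no access leaves the local memory. -/
def cell {w : ℕ} (K : ℕ) (E : Env w) (t : Fin 4) (a : BitVec w) : BitVec w :=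
  a % (BitVec.ofNat w (E.input.getD 1 0) * BitVec.ofNat w K) * BitVec.ofNat w 4 + BitVec.ofNat w t

/-- The value of an expression. -/
def Expr.eval {w : ℕ} (K : ℕ) (E : Env w) (σ : Store w) : Expr → BitVec w
  | .var i => σ.var i
  | .lit n => BitVec.ofNat w n
  | .op o a b => o.eval (a.eval K E σ) (b.eval K E σ)
  | .inp a => BitVec.ofNat w (E.input.getD (a.eval K E σ).toNat 0)
  | .rnd a => E.tape (a.eval K E σ)
  | .get t a => σ.mem (cell K E t (a.eval K E σ))

/-- The number of iterations of a loop. -/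
def Env.iterations {w : ℕ} (E : Env w) : ℕ := Nat.size (E.input.getD 1 0)

/-- The effect of a statement on the store. -/
def Stmt.exec {w : ℕ} (K : ℕ) (E : Env w) : Stmt → Store w → Store w
  | .skip, σ => σ
  | .assign i e, σ => { σ with var := Function.update σ.var i (e.eval K E σ) }
  | .put t a e, σ =>
      { σ with mem := Function.update σ.mem (cell K E t (a.eval K E σ)) (e.eval K E σ) }
  | .seq s₁ s₂, σ => s₂.exec K E (s₁.exec K E σ)
  | .ite e s₁ s₂, σ => if e.eval K E σ = 0#w then s₂.exec K E σ else s₁.exec K E σ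
  | .loop s, σ => (s.exec K E)^[E.iterations] σ

/-! ### Compilation -/

/-- The `i`-th scratch register; program variable `i` is kept in register `2 * i`. -/
def tmp (i : ℕ) : ℕ := 2 * i + 1

/-- Code that turns the array index in scratch register `r` into a memory address. -/
def addressCode (K : ℕ) (t : Fin 4) (r : ℕ) : List Instr :=
  [.const (tmp (r + 1)) 1, .input (tmp (r + 1)) (tmp (r + 1)), .const (tmp (r + 2)) K,
    .op .mul (tmp (r + 1)) (tmp (r + 1)) (tmp (r + 2)), .op .mod (tmp r) (tmp r) (tmp (r + 1)),
    .const (tmp (r + 1)) 4, .op .mul (tmp r) (tmp r) (tmp (r + 1)),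
    .const (tmp (r + 1)) t, .op .add (tmp r) (tmp r) (tmp (r + 1))]

/-- Code that puts the value of an expression into scratch register `r`, leaving the variables and
the scratch registers below `r` alone. -/
def Expr.code (K : ℕ) : Expr → ℕ → List Instr
  | .var i, r => [.const (tmp r) 0, .op .add (tmp r) (2 * i) (tmp r)]
  | .lit n, r => [.const (tmp r) n]
  | .op o a b, r => a.code K r ++ (b.code K (r + 1) ++ [.op o (tmp r) (tmp r) (tmp (r + 1))])
  | .inp a, r => a.code K r ++ [.input (tmp r) (tmp r)]
  | .rnd a, r => a.code K r ++ [.rand (tmp r) (tmp r)]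
  | .get t a, r => a.code K r ++ (addressCode K t r ++ [.load (tmp r) (tmp r)])

/-- Code at program position `p` for a statement, using scratch registers from `r` on. -/
def Stmt.code (K : ℕ) : Stmt → ℕ → ℕ → List Instr
  | .skip, _, _ => []
  | .assign i e, r, _ =>
      e.code K r ++ [.const (tmp (r + 1)) 0, .op .add (2 * i) (tmp r) (tmp (r + 1))]
  | .put t a e, r, _ =>
      a.code K r ++ (addressCode K t r ++ (e.code K (r + 1) ++ [.store (tmp r) (tmp (r + 1))]))
  | .seq s₁ s₂, r, p => s₁.code K r p ++ s₂.code K r (p + (s₁.code K r p).length)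
  | .ite e s₁ s₂, r, p =>
      let p₁ := p + (e.code K r).length + 1
      let c₁ := s₁.code K r p₁
      let p₂ := p₁ + c₁.length + 1
      let c₂ := s₂.code K r p₂
      e.code K r ++ (.jzero (tmp r) p₂ :: (c₁ ++ (.jump (p₂ + c₂.length) :: c₂)))
  | .loop s, r, p =>
      let c := s.code K (r + 1) (p + 5)
      .const (tmp r) 1 :: .input (tmp r) (tmp r) :: .jzero (tmp r) (p + 5 + c.length + 1) ::
        .const (tmp (r + 1)) 1 :: .op .shr (tmp r) (tmp r) (tmp (r + 1)) :: (c ++ [.jump (p + 2)])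

/-- The program that executes a statement and halts. -/
def Stmt.program (K : ℕ) (s : Stmt) : Program := s.code K 0 0 ++ [.halt]

/-- The coefficient in the time bound `s.cost K * n ^ s.depth` for `s`, where `n` is the number of
iterations of a loop. -/
def Stmt.cost (K : ℕ) : Stmt → ℕ → ℕ
  | .skip, _ => 0
  | .assign _ e, r => (e.code K r).length + 2
  | .put _ a e, r => (a.code K r).length + 9 + (e.code K (r + 1)).length + 1
  | .seq s₁ s₂, r => s₁.cost K r + s₂.cost K r
  | .ite e s₁ s₂, r => (e.code K r).length + 2 + s₁.cost K r + s₂.cost K r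
  | .loop s, r => 7 + s.cost K (r + 1)

/-- The nesting depth of loops. -/
def Stmt.depth : Stmt → ℕ
  | .skip => 0
  | .assign _ _ => 0
  | .put _ _ _ => 0
  | .seq s₁ s₂ => max s₁.depth s₂.depth
  | .ite _ s₁ s₂ => max s₁.depth s₂.depth
  | .loop s => s.depth + 1

/-- The list `l` stands in the program `A` from position `p` on. -/
def CodeAt (A : Program) : ℕ → List Instr → Prop
  | _, [] => True
  | p, i :: l => A[p]? = some i ∧ CodeAt A (p + 1) l

theorem codeAt_append {A : Program} {p : ℕ} {l₁ l₂ : List Instr} :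
    CodeAt A p (l₁ ++ l₂) ↔ CodeAt A p l₁ ∧ CodeAt A (p + l₁.length) l₂ := by
  induction l₁ generalizing p with
  | nil => simp [CodeAt]
  | cons i l ih =>
      simp only [List.cons_append, CodeAt, ih, List.length_cons, and_assoc]
      rw [show p + 1 + l.length = p + (l.length + 1) by omega]

theorem codeAt_of_eq_append {A l₁ l₂ l₃ : List Instr} (h : A = l₁ ++ (l₂ ++ l₃)) :
    CodeAt A l₁.length l₂ := by
  induction l₂ generalizing l₁ with
  | nil => trivial
  | cons i l ih =>
      refine ⟨by simp [h], ?_⟩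
      have := ih (l₁ := l₁ ++ [i]) (by simp [h])
      simpa using this

/-- The configuration after exactly `n` steps. -/
def steps {w : ℕ} (A : Program) (E : Env w) : ℕ → Config w → Option (Config w)
  | 0, c => some c
  | n + 1, c => (step A E c).bind (steps A E n)

theorem steps_add {w : ℕ} {A : Program} {E : Env w} {n n' : ℕ} {c c' c'' : Config w}
    (h : steps A E n c = some c') (h' : steps A E n' c' = some c'') :
    steps A E (n + n') c = some c'' := by
  induction n generalizing c with
  | zero => simp only [steps, Option.some.injEq] at h; subst h; simpa using h'
  | succ n ih =>
      rw [Nat.add_right_comm]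
      simp only [steps] at h ⊢
      obtain ⟨c₁, h₁, h₂⟩ := Option.bind_eq_some_iff.1 h
      rw [h₁]
      exact ih h₂

theorem not_halted_of_step {w : ℕ} {A : Program} {E : Env w} {c c' : Config w}
    (h : step A E c = some c') : halted A c = false := by
  unfold step at h
  unfold halted
  split <;> simp_all

theorem run_of_steps {w : ℕ} {A : Program} {E : Env w} {n T : ℕ} {c c' : Config w}
    (h : steps A E n c = some c') (hc' : halted A c' = true) (hT : n ≤ T) :
    run A E T c = some c' := by
  induction n generalizing c T with
  | zero =>
      simp only [steps, Option.some.injEq] at h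
      subst h
      cases T <;> simp [run, hc']
  | succ n ih =>
      obtain ⟨T, rfl⟩ : ∃ T', T = T' + 1 := ⟨T - 1, by omega⟩
      simp only [steps] at h
      obtain ⟨c₁, h₁, h₂⟩ := Option.bind_eq_some_iff.1 h
      simp only [run, not_halted_of_step h₁, Bool.false_eq_true, if_false, h₁, Option.bind_some]
      exact ih h₂ (by omega)

/-- The store that a configuration represents. -/
def Config.store {w : ℕ} (c : Config w) : Store w := ⟨fun i => c.reg (2 * i), c.mem⟩

/-- What the environment must satisfy for compiled code to be correct: the input word at address
`1` is positive and the four arrays fit into the local memory and into the address space. -/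
structure Env.Fits {w : ℕ} (K : ℕ) (E : Env w) : Prop where
  pos : 0 < E.input.getD 1 0
  pos_length : 0 < K
  lt : 4 * (E.input.getD 1 0 * K) < 2 ^ w
  le : 4 * (E.input.getD 1 0 * K) ≤ E.space

section

variable {w K : ℕ} {E : Env w} {A : Program}

theorem Env.Fits.four_lt (h : E.Fits K) : 4 < 2 ^ w := by
  have := h.lt
  have := Nat.mul_pos h.pos h.pos_length
  omega

theorem cell_toNat (h : E.Fits K) (t : Fin 4) (a : BitVec w) :
    (cell K E t a).toNat = a.toNat % (E.input.getD 1 0 * K) * 4 + t := by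
  have h1 := h.lt
  have h2 := Nat.mul_pos h.pos h.pos_length
  have h3 := h.four_lt
  have h4 : E.input.getD 1 0 ≤ E.input.getD 1 0 * K := Nat.le_mul_of_pos_right _ h.pos_length
  have h5 : K ≤ E.input.getD 1 0 * K := Nat.le_mul_of_pos_left _ h.pos
  have h6 := Nat.mod_lt a.toNat h2
  have h7 := t.2
  simp only [cell, BitVec.toNat_add, BitVec.toNat_mul, BitVec.toNat_umod, BitVec.toNat_ofNat]
  rw [Nat.mod_eq_of_lt (a := 4) h3, Nat.mod_eq_of_lt (a := (t : ℕ)) (by omega),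
    Nat.mod_eq_of_lt (a := E.input.getD 1 0) (by omega), Nat.mod_eq_of_lt (a := K) (by omega),
    Nat.mod_eq_of_lt (a := E.input.getD 1 0 * K) (by omega),
    Nat.mod_eq_of_lt (a := a.toNat % _ * 4) (by omega), Nat.mod_eq_of_lt (by omega)]

theorem cell_lt_space (h : E.Fits K) (t : Fin 4) (a : BitVec w) :
    (cell K E t a).toNat < E.space := by
  rw [cell_toNat h]
  have := Nat.mod_lt a.toNat (Nat.mul_pos h.pos h.pos_length)
  have := h.le
  have := t.2
  omega

@[simp] theorem tmp_inj {i j : ℕ} : tmp i = tmp j ↔ i = j := by unfold tmp; omega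

@[simp] theorem tmp_ne_var {i j : ℕ} : tmp i ≠ 2 * j := by unfold tmp; omega

@[simp] theorem var_ne_tmp {i j : ℕ} : 2 * j ≠ tmp i := by unfold tmp; omega

/-- The configuration `c'` agrees with `c` in the variables, in the local memory, and in the scratch
registers below `r`. -/
structure SameBelow (r : ℕ) (c c' : Config w) : Prop where
  mem : c'.mem = c.mem
  var : ∀ i, c'.reg (2 * i) = c.reg (2 * i)
  tmp : ∀ i < r, c'.reg (tmp i) = c.reg (tmp i)

theorem SameBelow.store {r : ℕ} {c c' : Config w} (h : SameBelow r c c') : c'.store = c.store := by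
  ext
  · simp [Config.store, h.var]
  · simp [Config.store, h.mem]

theorem SameBelow.trans {r r' : ℕ} {c c' c'' : Config w} (h : SameBelow r c c')
    (h' : SameBelow r' c' c'') (hr : r ≤ r') : SameBelow r c c'' :=
  ⟨h'.mem.trans h.mem, fun i => (h'.var i).trans (h.var i),
    fun i hi => (h'.tmp i (by omega)).trans (h.tmp i hi)⟩

/-- Reduction of the index and addition of the offset of the array take nine steps. -/
theorem addressCode_correct (h : E.Fits K) (t : Fin 4) (r p : ℕ) (c : Config w)
    (hp : c.pc = p) (hA : CodeAt A p (addressCode K t r)) :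
    ∃ c', steps A E 9 c = some c' ∧ c'.pc = p + 9 ∧ SameBelow r c c' ∧
      c'.reg (tmp r) = cell K E t (c.reg (tmp r)) := by
  have h4 := h.four_lt
  have h1 : 1 % 2 ^ w = 1 := Nat.mod_eq_of_lt (by omega)
  simp only [addressCode, CodeAt] at hA
  obtain ⟨a0, a1, a2, a3, a4, a5, a6, a7, a8, -⟩ := hA
  subst hp
  have e1 : ∀ i : ℕ, i + 1 ≠ i := by omega
  have e2 : ∀ i : ℕ, i ≠ i + 1 := by omega
  have e3 : ∀ i : ℕ, i ≠ i + 2 := by omega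
  apply Exists.intro
  refine ⟨?_, ?_, ?_, ?_⟩
  · simp only [steps, step, a0, a1, a2, a3, a4, a5, a6, a7, a8, Config.setReg,
      Option.bind_some, Function.update_apply, tmp_inj, e1, e2, e3, if_true, if_false, BinOp.eval,
      BitVec.toNat_ofNat, h1]
    rfl
  · rfl
  · refine ⟨rfl, fun i => ?_, fun i hi => ?_⟩
    · simp
    · have e1 : i ≠ r := by omega
      have e2 : i ≠ r + 1 := by omega
      have e3 : i ≠ r + 2 := by omega
      simp [e1, e2, e3]
  · simp [cell]

/-- The code of an expression has no jumps, so that it takes as many steps as it has instructions.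
The induction uses that it leaves the scratch registers below `r`, which hold intermediate
results, alone. -/
theorem Expr.code_correct (h : E.Fits K) (e : Expr) (r p : ℕ) (c : Config w)
    (hp : c.pc = p) (hA : CodeAt A p (e.code K r)) :
    ∃ c', steps A E (e.code K r).length c = some c' ∧ c'.pc = p + (e.code K r).length ∧
      SameBelow r c c' ∧ c'.reg (tmp r) = e.eval K E c.store := by
  induction e generalizing r p c with
  | var i =>
      obtain ⟨a0, a1, -⟩ := hA
      subst hp
      apply Exists.intro
      refine ⟨?_, ?_, ?_, ?_⟩
      · simp only [Expr.code, List.length_cons, List.length_nil, steps, step, a0, a1,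
          Config.setReg, Option.bind_some, zero_add]
        rfl
      · rfl
      · refine ⟨rfl, fun i => ?_, fun i hi => ?_⟩
        · simp
        · have e1 : i ≠ r := by omega
          simp [e1]
      · simp [BinOp.eval, Expr.eval, Config.store]
  | lit n =>
      obtain ⟨a0, -⟩ := hA
      subst hp
      apply Exists.intro
      refine ⟨?_, ?_, ?_, ?_⟩
      · simp only [Expr.code, List.length_cons, List.length_nil, steps, step, a0,
          Config.setReg, Option.bind_some, zero_add]
        rfl
      · rfl
      · refine ⟨rfl, fun i => ?_, fun i hi => ?_⟩
        · simp
        · have e1 : i ≠ r := by omega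
          simp [e1]
      · simp [Expr.eval]
  | op o a b iha ihb =>
      simp only [Expr.code, codeAt_append] at hA
      obtain ⟨ha, hb, h3, -⟩ := hA
      obtain ⟨c₁, s₁, p₁, k₁, v₁⟩ := iha r p c hp ha
      obtain ⟨c₂, s₂, p₂, k₂, v₂⟩ := ihb (r + 1) _ c₁ p₁ hb
      rw [← p₂] at h3
      refine ⟨c₂.setReg (tmp r) (o.eval (c₂.reg (tmp r)) (c₂.reg (tmp (r + 1)))), ?_, ?_, ?_, ?_⟩
      · rw [Expr.code, List.length_append, List.length_append]
        exact steps_add s₁ (steps_add s₂ (by simp [steps, step, h3]))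
      · simp [Config.setReg, p₂, Expr.code]; omega
      · refine k₁.trans (r' := r) ⟨k₂.mem, fun i => ?_, fun i hi => ?_⟩ le_rfl
        · simp [Config.setReg, k₂.var]
        · have e1 : i ≠ r := by omega
          simp [Config.setReg, e1, k₂.tmp i (by omega)]
      · simp [Config.setReg, Expr.eval, v₂, k₂.tmp r (by omega), v₁, k₁.store]
  | inp a iha =>
      simp only [Expr.code, codeAt_append] at hA
      obtain ⟨ha, h3, -⟩ := hA
      obtain ⟨c₁, s₁, p₁, k₁, v₁⟩ := iha r p c hp ha
      rw [← p₁] at h3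
      refine ⟨_, by rw [Expr.code, List.length_append]
                    exact steps_add s₁ (by simp only [List.length_cons, List.length_nil, steps,
                      step, h3, Option.bind_some, zero_add]; rfl), ?_, ?_, ?_⟩
      · simp [Config.setReg, p₁, Expr.code]; omega
      · refine ⟨k₁.mem, fun i => ?_, fun i hi => ?_⟩
        · simp [Config.setReg, k₁.var]
        · have e1 : i ≠ r := by omega
          simp [Config.setReg, e1, k₁.tmp i (by omega)]
      · simp [Config.setReg, Expr.eval, v₁]
  | rnd a iha =>
      simp only [Expr.code, codeAt_append] at hA
      obtain ⟨ha, h3, -⟩ := hA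
      obtain ⟨c₁, s₁, p₁, k₁, v₁⟩ := iha r p c hp ha
      rw [← p₁] at h3
      refine ⟨_, by rw [Expr.code, List.length_append]
                    exact steps_add s₁ (by simp only [List.length_cons, List.length_nil, steps,
                      step, h3, Option.bind_some, zero_add]; rfl), ?_, ?_, ?_⟩
      · simp [Config.setReg, p₁, Expr.code]; omega
      · refine ⟨k₁.mem, fun i => ?_, fun i hi => ?_⟩
        · simp [Config.setReg, k₁.var]
        · have e1 : i ≠ r := by omega
          simp [Config.setReg, e1, k₁.tmp i (by omega)]
      · simp [Config.setReg, Expr.eval, v₁]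
  | get t a iha =>
      simp only [Expr.code, codeAt_append] at hA
      obtain ⟨ha, h2, h3, -⟩ := hA
      obtain ⟨c₁, s₁, p₁, k₁, v₁⟩ := iha r p c hp ha
      obtain ⟨c₂, s₂, p₂, k₂, v₂⟩ := addressCode_correct h t r _ c₁ p₁ h2
      replace h3 : A[c₂.pc]? = some (.load (tmp r) (tmp r)) := by rw [p₂]; exact h3
      have h4 : (c₂.reg (tmp r)).toNat < E.space := by rw [v₂]; exact cell_lt_space h _ _
      refine ⟨c₂.setReg (tmp r) (c₂.mem (c₂.reg (tmp r))), ?_, ?_, ?_, ?_⟩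
      · rw [Expr.code, List.length_append, List.length_append]
        exact steps_add s₁ (steps_add s₂ (by simp [steps, step, h3, h4]))
      · simp [Config.setReg, p₂, Expr.code, addressCode]; omega
      · refine k₁.trans (r' := r) ⟨k₂.mem, fun i => ?_, fun i hi => ?_⟩ le_rfl
        · simp [Config.setReg, k₂.var]
        · have e1 : i ≠ r := by omega
          simp [Config.setReg, e1, k₂.tmp i hi]
      · simp [Config.setReg, Expr.eval, v₂, v₁, k₂.mem, k₁.mem, Config.store]

/-- The loop of compiled code, entered with counter `n`, runs its body `Nat.size n` times. -/
theorem loop_correct {s : Stmt} {r p B : ℕ} (c : Config w)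
    (hbody : ∀ c : Config w, c.pc = p + 5 → ∃ n c', n ≤ B ∧ steps A E n c = some c' ∧
      c'.pc = p + 5 + (s.code K (r + 1) (p + 5)).length ∧ c'.store = s.exec K E c.store ∧
      ∀ i < r + 1, c'.reg (tmp i) = c.reg (tmp i))
    (h1w : 1 < 2 ^ w)
    (h2 : A[p + 2]? = some (.jzero (tmp r) (p + 5 + (s.code K (r + 1) (p + 5)).length + 1)))
    (h3 : A[p + 3]? = some (.const (tmp (r + 1)) 1))
    (h4 : A[p + 4]? = some (.op .shr (tmp r) (tmp r) (tmp (r + 1))))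
    (h5 : A[p + 5 + (s.code K (r + 1) (p + 5)).length]? = some (.jump (p + 2)))
    (hp : c.pc = p + 2) (v : ℕ) (hv : (c.reg (tmp r)).toNat = v) :
    ∃ n c', n ≤ v.size * (4 + B) + 1 ∧ steps A E n c = some c' ∧
      c'.pc = p + 5 + (s.code K (r + 1) (p + 5)).length + 1 ∧
      c'.store = (s.exec K E)^[v.size] c.store ∧ ∀ i < r, c'.reg (tmp i) = c.reg (tmp i) := by
  induction v using Nat.strong_induction_on generalizing c with
  | _ v ih =>
  rw [← hp] at h2
  by_cases h0 : v = 0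
  · subst h0
    have hz : c.reg (tmp r) = 0#w := BitVec.eq_of_toNat_eq (by simpa using hv)
    exact ⟨1, { c with pc := p + 5 + (s.code K (r + 1) (p + 5)).length + 1 }, by simp,
      by simp [steps, step, h2, hz], rfl, by simp; rfl, fun _ _ => rfl⟩
  · have hz : c.reg (tmp r) ≠ 0#w := by
      intro hz; rw [hz] at hv; simp at hv; omega
    have hsize : v.size = (v / 2).size + 1 := by
      have := Nat.size_bit (b := v.bodd) (n := v / 2) (by
        rw [← Nat.div2_val, Nat.bit_bodd_div2]; exact h0)
      rwa [← Nat.div2_val, Nat.bit_bodd_div2, Nat.div2_val] at this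
    -- the three instructions before the body
    obtain ⟨c₁, hs₁, hc₁⟩ : ∃ c₁, steps A E 3 c = some c₁ ∧ c₁ = (⟨p + 5, Function.update
        (Function.update c.reg (tmp (r + 1)) (BitVec.ofNat w 1)) (tmp r)
          (c.reg (tmp r) >>> 1), c.mem⟩ : Config w) := by
      refine ⟨_, ?_, rfl⟩
      rw [hp] at h2
      simp [steps, step, hp, h2, h3, h4, hz, Config.setReg, BinOp.eval, Nat.mod_eq_of_lt h1w]
    obtain ⟨n₂, c₂, hn₂, hs₂, hp₂, hst₂, hk₂⟩ := hbody c₁ (by rw [hc₁])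
    have hr₂ : (c₂.reg (tmp r)).toNat = v / 2 := by
      rw [hk₂ r (by omega), hc₁]
      simp [hv, Nat.shiftRight_one]
    rw [← hp₂] at h5
    have hs₃ : steps A E 1 c₂ = some { c₂ with pc := p + 2 } := by simp [steps, step, h5]
    obtain ⟨n₄, c₄, hn₄, hs₄, hp₄, hst₄, hk₄⟩ :=
      ih (v / 2) (by omega) { c₂ with pc := p + 2 } rfl hr₂
    refine ⟨3 + (n₂ + (1 + n₄)), c₄, ?_, steps_add hs₁ (steps_add hs₂ (steps_add hs₃ hs₄)), hp₄, ?_,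
      fun i hi => ?_⟩
    · rw [hsize, add_mul, one_mul]; omega
    · rw [hst₄, hsize, Function.iterate_succ_apply]
      congr 1
      change c₂.store = _
      rw [hst₂, hc₁]
      congr 1
      ext : 1
      · ext1 i; simp [Config.store]
      · rfl
    · rw [hk₄ i hi]
      change c₂.reg (tmp i) = _
      have e1 : i ≠ r := by omega
      have e2 : i ≠ r + 1 := by omega
      rw [hk₂ i (by omega), hc₁]
      simp [e1, e2]

/-- The compiled statement halts with the store that `Stmt.exec` describes, whatever the store was.
The number of steps is bounded by a constant times a power of the number of iterations of a loop,
the exponent being the nesting depth of the loops. -/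
theorem Stmt.code_correct (h : E.Fits K) (s : Stmt) (r p : ℕ) (c : Config w)
    (hp : c.pc = p) (hA : CodeAt A p (s.code K r p)) :
    ∃ n c', n ≤ s.cost K r * E.iterations ^ s.depth ∧ steps A E n c = some c' ∧
      c'.pc = p + (s.code K r p).length ∧ c'.store = s.exec K E c.store ∧
      ∀ i < r, c'.reg (tmp i) = c.reg (tmp i) := by
  have h1 : 1 ≤ E.iterations := Nat.size_pos.2 h.pos
  induction s generalizing r p c with
  | skip => exact ⟨0, c, by simp, rfl, by simp [Stmt.code, hp], rfl, fun _ _ => rfl⟩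
  | assign i e =>
      simp only [Stmt.code, codeAt_append] at hA
      obtain ⟨ha, h2, h3, -⟩ := hA
      obtain ⟨c₁, s₁, p₁, k₁, v₁⟩ := e.code_correct h r p c hp ha
      rw [← p₁] at h2 h3
      refine ⟨(e.code K r).length + 2, _, by simp [Stmt.cost, Stmt.depth], steps_add s₁ (by
        simp only [steps, step, h2, h3, Config.setReg, Option.bind_some]; rfl), ?_, ?_, ?_⟩
      · simp [Stmt.code, p₁]; omega
      · ext : 1
        · ext1 j
          have := k₁.var j
          simp [Config.store, Stmt.exec, Function.update_apply, BinOp.eval, v₁, this]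
        · simp [Config.store, Stmt.exec, k₁.mem]
      · intro j hj
        have e1 : j ≠ r + 1 := by omega
        simp [e1, k₁.tmp j hj]
  | put t a e =>
      simp only [Stmt.code, codeAt_append] at hA
      obtain ⟨ha, h2, hb, h3, -⟩ := hA
      obtain ⟨c₁, s₁, p₁, k₁, v₁⟩ := a.code_correct h r p c hp ha
      obtain ⟨c₂, s₂, p₂, k₂, v₂⟩ := addressCode_correct h t r _ c₁ p₁ h2
      obtain ⟨c₃, s₃, p₃, k₃, v₃⟩ := e.code_correct h (r + 1) _ c₂ p₂ hb
      replace h3 : A[c₃.pc]? = some (.store (tmp r) (tmp (r + 1))) := by rw [p₃]; exact h3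
      have hr : c₃.reg (tmp r) = cell K E t (a.eval K E c.store) := by
        rw [k₃.tmp r (by omega), v₂, v₁]
      have k := (k₁.trans k₂ le_rfl).trans k₃ (by omega)
      have h4 : (c₃.reg (tmp r)).toNat < E.space := by rw [hr]; exact cell_lt_space h _ _
      refine ⟨(a.code K r).length + (9 + ((e.code K (r + 1)).length + 1)),
        ⟨c₃.pc + 1, c₃.reg, Function.update c₃.mem (c₃.reg (tmp r)) (c₃.reg (tmp (r + 1)))⟩, ?_,
        steps_add s₁ (steps_add s₂ (steps_add s₃ (by simp [steps, step, h3, h4]))), ?_, ?_, k.tmp⟩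
      · simp [Stmt.cost, Stmt.depth]; omega
      · simp [Stmt.code, p₃, addressCode]; omega
      · ext : 1
        · ext1 j
          exact k.var j
        · change Function.update c₃.mem _ _ = Function.update c.mem _ _
          rw [hr, v₃, k.mem, (k₁.trans k₂ le_rfl).store]
  | seq s₁ s₂ ih₁ ih₂ =>
      simp only [Stmt.code, codeAt_append] at hA
      obtain ⟨n₁, c₁, b₁, t₁, p₁, v₁, k₁⟩ := ih₁ r p c hp hA.1
      obtain ⟨n₂, c₂, b₂, t₂, p₂, v₂, k₂⟩ := ih₂ r _ c₁ p₁ hA.2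
      refine ⟨n₁ + n₂, c₂, ?_, steps_add t₁ t₂, ?_, ?_, fun i hi => (k₂ i hi).trans (k₁ i hi)⟩
      · simp only [Stmt.cost, Stmt.depth, add_mul]
        refine add_le_add (b₁.trans ?_) (b₂.trans ?_)
        · gcongr; exact le_max_left _ _
        · gcongr; exact le_max_right _ _
      · simp [Stmt.code, p₂]; omega
      · rw [v₂, v₁]; rfl
  | ite e s₁ s₂ ih₁ ih₂ =>
      simp only [Stmt.code, codeAt_append, CodeAt] at hA
      obtain ⟨ha, hj, hb₁, hj', hb₂⟩ := hA
      obtain ⟨c₀, t₀, p₀, k₀, v₀⟩ := e.code_correct h r p c hp ha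
      replace hj : A[c₀.pc]? = some (.jzero (tmp r) (p + (e.code K r).length + 1 +
          (s₁.code K r (p + (e.code K r).length + 1)).length + 1)) := by rw [p₀]; exact hj
      have hd : 1 ≤ E.iterations ^ max s₁.depth s₂.depth := Nat.one_le_pow _ _ h1
      by_cases hz : e.eval K E c.store = 0#w
      · rw [← v₀] at hz
        have hs : steps A E 1 c₀ = some { c₀ with pc := p + (e.code K r).length + 1 +
            (s₁.code K r (p + (e.code K r).length + 1)).length + 1 } := by
          simp [steps, step, hj, hz]
        obtain ⟨n₂, c₂, b₂, t₂, p₂, v₂, k₂⟩ := ih₂ r _ { c₀ with pc := _ } rfl hb₂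
        refine ⟨_, c₂, ?_, steps_add t₀ (steps_add hs t₂), ?_, ?_, fun i hi =>
          (k₂ i hi).trans (k₀.tmp i hi)⟩
        · simp only [Stmt.cost, Stmt.depth, add_mul]
          have : s₂.cost K r * E.iterations ^ s₂.depth ≤
              s₂.cost K r * E.iterations ^ max s₁.depth s₂.depth := by
            gcongr; exact le_max_right _ _
          have := Nat.le_mul_of_pos_right ((e.code K r).length + 2) hd
          rw [add_mul] at this
          omega
        · simp [Stmt.code, p₂]; omega
        · rw [v₂, Stmt.exec, if_pos (by rw [← v₀]; exact hz)]
          congr 1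
          exact k₀.store
      · rw [← v₀] at hz
        have hs : steps A E 1 c₀ = some { c₀ with pc := p + (e.code K r).length + 1 } := by
          simp only [steps, step, hj, hz, if_false, Option.bind_some]
          rw [p₀]
        obtain ⟨n₂, c₂, b₂, t₂, p₂, v₂, k₂⟩ := ih₁ r _ { c₀ with pc := _ } rfl hb₁
        generalize hp₃ : p + (e.code K r).length + 1 +
          (s₁.code K r (p + (e.code K r).length + 1)).length + 1 = p₃ at hj'
        generalize hp₄ : p₃ + (s₂.code K r p₃).length = p₄ at hj'
        replace hj' : A[c₂.pc]? = some (.jump p₄) := by rw [p₂]; exact hj'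
        have hs' : steps A E 1 c₂ = some { c₂ with pc := p₄ } := by simp [steps, step, hj']
        refine ⟨_, _, ?_, steps_add t₀ (steps_add hs (steps_add t₂ hs')), ?_, ?_, fun i hi =>
          (k₂ i hi).trans (k₀.tmp i hi)⟩
        · simp only [Stmt.cost, Stmt.depth, add_mul]
          have : s₁.cost K r * E.iterations ^ s₁.depth ≤
              s₁.cost K r * E.iterations ^ max s₁.depth s₂.depth := by
            gcongr; exact le_max_left _ _
          have := Nat.le_mul_of_pos_right ((e.code K r).length + 2) hd
          rw [add_mul] at this
          omega
        · simp [Stmt.code, ← hp₄, ← hp₃]; omega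
        · rw [Stmt.exec, if_neg (by rw [← v₀]; exact hz)]
          change c₂.store = _
          rw [v₂]
          congr 1
          exact k₀.store
  | loop s ih =>
      simp only [Stmt.code, codeAt_append, CodeAt] at hA
      obtain ⟨a0, a1, a2, a3, a4, hb, a5, -⟩ := hA
      have h4 := h.four_lt
      have h1w : 1 % 2 ^ w = 1 := Nat.mod_eq_of_lt (by omega)
      have hN : E.input.getD 1 0 < 2 ^ w := by
        have := h.lt
        have := Nat.le_mul_of_pos_right (E.input.getD 1 0) h.pos_length
        omega
      obtain ⟨c₁, hs₁, hc₁⟩ : ∃ c₁, steps A E 2 c = some c₁ ∧ c₁ = (⟨p + 2, Function.update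
          c.reg (tmp r) (BitVec.ofNat w (E.input.getD 1 0)), c.mem⟩ : Config w) := by
        refine ⟨_, ?_, rfl⟩
        simp [steps, step, hp, a0, a1, Config.setReg, h1w]
      obtain ⟨n, c₂, b₂, t₂, p₂, v₂, k₂⟩ := loop_correct (s := s) (r := r) (p := p)
        (B := s.cost K (r + 1) * E.iterations ^ s.depth) c₁ (fun c hc => ih (r + 1) _ c hc hb)
        (by omega) a2 a3 a4 a5 (by rw [hc₁]) (E.input.getD 1 0)
        (by rw [hc₁]; simp only [Function.update_self, BitVec.toNat_ofNat];
            exact Nat.mod_eq_of_lt hN)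
      refine ⟨2 + n, c₂, ?_, steps_add hs₁ t₂, ?_, ?_, fun i hi => ?_⟩
      · change n ≤ E.iterations * _ + 1 at b₂
        simp only [Stmt.cost, Stmt.depth, pow_succ]
        have := Nat.one_le_pow s.depth _ h1
        have h7 : 1 ≤ E.iterations ^ s.depth * E.iterations := Nat.mul_pos this h1
        have h8 : E.iterations * 4 ≤ 4 * (E.iterations ^ s.depth * E.iterations) := by
          nlinarith
        calc 2 + n ≤ 3 + E.iterations * 4 + s.cost K (r + 1) *
              (E.iterations ^ s.depth * E.iterations) := by nlinarith
          _ ≤ _ := by nlinarith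
      · simp [Stmt.code, p₂]; omega
      · rw [v₂, Stmt.exec]
        congr 1
        rw [hc₁]
        ext : 1
        · ext1 j; simp [Config.store]
        · rfl
      · have e1 : i ≠ r := by omega
        rw [k₂ i hi, hc₁]
        simp [e1]

/-- A compiled statement halts in polylogarithmic time, whatever the input, the random tape and the
local memory are. -/
theorem Stmt.run_program (h : E.Fits K) (s : Stmt) {T : ℕ}
    (hT : s.cost K 0 * E.iterations ^ s.depth ≤ T) (c : Config w) (hp : c.pc = 0) :
    ∃ c', run (s.program K) E T c = some c' ∧ c'.store = s.exec K E c.store := by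
  have hA : CodeAt (s.program K) 0 (s.code K 0 0) :=
    codeAt_of_eq_append (l₁ := []) (l₃ := [.halt]) (by simp [Stmt.program])
  obtain ⟨n, c', hn, hs, hp', hst, -⟩ := s.code_correct h 0 0 c hp hA
  refine ⟨c', run_of_steps hs ?_ (hn.trans hT), hst⟩
  simp [halted, hp', Stmt.program]

end

end WordRAM

/-! ### Random colourings -/

namespace NumberedHypergraph

open Finset
open scoped Classical

/-- The function that equals `r` on `A` and `s` elsewhere. -/
def splice {α β : Type*} [DecidableEq α] (A : Finset α) (s r : α → β) : α → β :=
  fun v => if v ∈ A then r v else s v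

/-- Exchanging the values on `A` of two independent random functions does not change their joint
distribution. -/
theorem sum_splice {α : Type*} [Fintype α] [DecidableEq α] (A : Finset α) (f g : (α → Bool) → ℝ) :
    ∑ s, ∑ r, f s * g (splice A s r) = ∑ s, ∑ r, f (splice A s r) * g s := by
  rw [← Fintype.sum_prod_type', ← Fintype.sum_prod_type']
  have hinv : Function.Involutive
      (fun x : (α → Bool) × (α → Bool) => (splice A x.1 x.2, splice A x.2 x.1)) := by
    rintro ⟨s, r⟩
    simp only [Prod.mk.injEq]
    constructor <;> funext v <;> by_cases hv : v ∈ A <;> simp [splice, hv]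
  refine Fintype.sum_equiv hinv.toPerm _ _ ?_
  rintro ⟨s, r⟩
  have : splice A (splice A s r) (splice A r s) = s := congrArg Prod.fst (hinv (s, r))
  simp [Function.Involutive.toPerm, this]

/-- The fraction of functions with prescribed values on `A` is `2 ^ (-#A)`. -/
theorem card_agree {α : Type*} [Fintype α] [DecidableEq α] (A : Finset α) (b : α → Bool) :
    (#{r : α → Bool | ∀ v ∈ A, r v = b v} : ℝ) = 2 ^ Fintype.card α / 2 ^ #A := by
  have h : ({r : α → Bool | ∀ v ∈ A, r v = b v} : Finset _) =
      Fintype.piFinset (fun v => if v ∈ A then {b v} else univ) := by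
    ext r
    simp only [mem_filter, mem_univ, true_and, Fintype.mem_piFinset]
    refine forall_congr' fun v => ?_
    by_cases hv : v ∈ A <;> simp [hv]
  have h2 : ∀ v, #(if v ∈ A then {b v} else (univ : Finset Bool)) = if v ∈ A then 1 else 2 := by
    intro v; split_ifs <;> simp
  rw [h, Fintype.card_piFinset, eq_div_iff (by positivity)]
  simp only [h2, prod_ite, prod_const, one_pow, one_mul]
  norm_cast
  rw [← pow_add]
  congr 1
  have := card_filter_add_card_filter_not (s := (univ : Finset α)) (fun v => v ∈ A)
  simp only [filter_mem_eq_inter, univ_inter, card_univ] at this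
  omega

/-- Few vertices of one colour: the fraction of functions that take the value `b` fewer than `t`
times on `A`. -/
theorem card_few {α : Type*} [Fintype α] [DecidableEq α] (A : Finset α) (b : Bool) (t : ℕ) :
    (#{r : α → Bool | #{v ∈ A | r v = b} < t} : ℝ) ≤
      (∑ i ∈ range t, (#A).choose i : ℕ) * (2 ^ Fintype.card α / 2 ^ #A) := by
  have hsub : ({r : α → Bool | #{v ∈ A | r v = b} < t} : Finset _) ⊆
      ((range t).biUnion fun i => powersetCard i A).biUnion fun B =>
        {r : α → Bool | ∀ v ∈ A, r v = if v ∈ B then b else !b} := by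
    intro r hr
    simp only [mem_filter, mem_univ, true_and] at hr
    simp only [mem_biUnion, mem_range, mem_powersetCard, mem_filter, mem_univ, true_and]
    refine ⟨{v ∈ A | r v = b}, ⟨_, hr, filter_subset _ _, rfl⟩, fun v hv => ?_⟩
    by_cases h : r v = b
    · simp [hv, h]
    · simp [Bool.eq_not_of_ne h]
  calc (#{r : α → Bool | #{v ∈ A | r v = b} < t} : ℝ)
      ≤ (∑ B ∈ (range t).biUnion fun i => powersetCard i A,
          #{r : α → Bool | ∀ v ∈ A, r v = if v ∈ B then b else !b} : ℕ) := by
        exact_mod_cast (card_le_card hsub).trans card_biUnion_le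
    _ = #((range t).biUnion fun i => powersetCard i A) * (2 ^ Fintype.card α / 2 ^ #A) := by
        push_cast
        rw [sum_congr rfl fun B _ => card_agree A fun v => if v ∈ B then b else !b]
        simp
    _ ≤ _ := by
        gcongr
        refine card_biUnion_le.trans ?_
        simp

variable {m N : ℕ} (H : NumberedHypergraph m N)

/-- Two hyperedges meet; every hyperedge meets itself. -/
def Meets (e f : Fin N) : Prop := (H.edge e ∩ H.edge f).Nonempty

theorem Meets.refl (e : Fin N) : H.Meets e e := by simpa [Meets] using H.edge_nonempty e

variable {H} in
theorem Meets.symm {e f : Fin N} (h : H.Meets e f) : H.Meets f e := by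
  unfold Meets at *; rwa [inter_comm]

theorem meets_of_mem {e f : Fin N} {v : Fin m} (he : v ∈ H.edge e) (hf : v ∈ H.edge f) :
    H.Meets e f := ⟨v, mem_inter.2 ⟨he, hf⟩⟩

variable {H} in
theorem MeetsAtMost.card_le {d : ℕ} (h : H.MeetsAtMost d) (e : Fin N) :
    #{f | H.Meets e f} ≤ d + 1 := by
  have : ({f | H.Meets e f} : Finset (Fin N)) ⊆
      insert e (univ.filter fun f => f ≠ e ∧ (H.edge e ∩ H.edge f).Nonempty) := by
    intro f hf
    simp only [mem_filter, mem_univ, true_and, mem_insert] at hf ⊢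
    by_cases hfe : f = e
    · exact Or.inl hfe
    · exact Or.inr ⟨hfe, hf⟩
  refine (card_le_card this).trans ((card_insert_le _ _).trans ?_)
  have := h e
  convert Nat.add_le_add_right this 1

/-- A hyperedge is bad for a colouring if one of the colours occurs fewer than `t` times in it. -/
def IsBad (t : ℕ) (c : Fin m → Bool) (e : Fin N) : Prop :=
  ∃ b, #{v ∈ H.edge e | c v = b} < t

/-- A hyperedge is monochromatic. -/
def IsMono (c : Fin m → Bool) (e : Fin N) : Prop := ∃ b, ∀ v ∈ H.edge e, c v = b

/-- The vertices of the bad hyperedges. They are the vertices that are coloured anew. -/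
noncomputable def loose (t : ℕ) (c : Fin m → Bool) : Finset (Fin m) :=
  {v | ∃ e, v ∈ H.edge e ∧ H.IsBad t c e}

/-- The hyperedges that meet a bad hyperedge. -/
noncomputable def affected (t : ℕ) (c : Fin m → Bool) : Finset (Fin N) :=
  {e | ∃ v ∈ H.edge e, v ∈ H.loose t c}

theorem mem_affected {t : ℕ} {c : Fin m → Bool} {e : Fin N} :
    e ∈ H.affected t c ↔ ∃ b, H.Meets e b ∧ H.IsBad t c b := by
  simp only [affected, loose, mem_filter, mem_univ, true_and]
  constructor
  · rintro ⟨v, hv, b, hb, h⟩; exact ⟨b, H.meets_of_mem hv hb, h⟩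
  · rintro ⟨b, ⟨v, hv⟩, h⟩
    rw [mem_inter] at hv
    exact ⟨v, hv.1, b, hv.2, h⟩

variable {H}

theorem IsBad.congr {t : ℕ} {c c' : Fin m → Bool} {e : Fin N} (h : ∀ v ∈ H.edge e, c v = c' v) :
    H.IsBad t c e ↔ H.IsBad t c' e := by
  unfold IsBad
  refine exists_congr fun b => ?_
  rw [filter_congr fun v hv => by rw [h v hv]]

/-- An upper bound for the fraction of colourings of `k` vertices in which one of the two colours
occurs fewer than `t` times. -/
noncomputable def badProb (k t : ℕ) : ℝ := 2 * (∑ i ∈ range t, k.choose i : ℕ) / 2 ^ k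

theorem card_isBad_le {k t : ℕ} {e : Fin N} (he : #(H.edge e) = k) :
    (#{c | H.IsBad t c e} : ℝ) ≤ badProb k t * 2 ^ m := by
  have hsub : ({c | H.IsBad t c e} : Finset (Fin m → Bool)) ⊆
      ({c | #{v ∈ H.edge e | c v = true} < t} : Finset _) ∪
        ({c | #{v ∈ H.edge e | c v = false} < t} : Finset _) := by
    intro c hc
    simp only [mem_filter, mem_univ, true_and, mem_union] at hc ⊢
    obtain ⟨b, hb⟩ := hc
    cases b
    · exact Or.inr hb
    · exact Or.inl hb
  have h1 := card_few (H.edge e) true t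
  have h2 := card_few (H.edge e) false t
  have h3 : (#{c | H.IsBad t c e} : ℝ) ≤ #{c : Fin m → Bool | #{v ∈ H.edge e | c v = true} < t} +
      #{c : Fin m → Bool | #{v ∈ H.edge e | c v = false} < t} := by
    exact_mod_cast (card_le_card hsub).trans (card_union_le _ _)
  rw [he, Fintype.card_fin] at h1 h2
  calc _ ≤ _ := h3
    _ ≤ _ := add_le_add h1 h2
    _ = _ := by unfold badProb; ring

/-- Colours are independent on disjoint hyperedges. -/
theorem card_forall_isBad_le {k t : ℕ} (hk : H.IsUniform k) (T : Finset (Fin N))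
    (hT : (T : Set (Fin N)).PairwiseDisjoint H.edge) :
    (#{c | ∀ e ∈ T, H.IsBad t c e} : ℝ) ≤ badProb k t ^ #T * 2 ^ m := by
  induction T using Finset.induction_on with
  | empty => simp
  | insert e T he ih =>
      have hT' := hT.subset (by simp : (T : Set (Fin N)) ⊆ ↑(insert e T))
      set f : (Fin m → Bool) → ℝ := fun c => if H.IsBad t c e then 1 else 0
      set g : (Fin m → Bool) → ℝ := fun c => if ∀ e ∈ T, H.IsBad t c e then 1 else 0
      have hg : ∀ s r, g (splice (H.edge e) s r) = g s := by
        intro s r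
        refine if_congr (forall₂_congr fun e' he' => IsBad.congr fun v hv => ?_) rfl rfl
        have hne : e' ≠ e := fun h => he (h ▸ he')
        have := hT (by simp [he'] : e' ∈ _) (by simp : e ∈ _) hne
        simp [splice, disjoint_left.1 this hv]
      have hf : ∀ s r, f (splice (H.edge e) s r) = f r := fun s r =>
        if_congr (IsBad.congr fun v hv => by simp [splice, hv]) rfl rfl
      have hsum := sum_splice (H.edge e) f g
      simp only [hf, hg] at hsum
      rw [sum_comm (f := fun s r => f r * g s), ← sum_mul_sum] at hsum
      have h1 : (#{c | ∀ e' ∈ insert e T, H.IsBad t c e'} : ℝ) = ∑ s, f s * g s := by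
        simp only [f, g, ite_mul, one_mul, zero_mul, ← ite_and, sum_boole, forall_mem_insert]
      have h2 : (#{c | H.IsBad t c e} : ℝ) = ∑ s, f s := by simp [f]
      have h3 : (#{c | ∀ e' ∈ T, H.IsBad t c e'} : ℝ) = ∑ s, g s := by simp [g]
      have h4 : (2 : ℝ) ^ m * ∑ s, f s * g s = (∑ s, f s) * ∑ s, g s := by
        rw [← hsum, mul_sum]
        simp
      have hp : 0 ≤ badProb k t := by unfold badProb; positivity
      have h5 := card_isBad_le (t := t) (hk e)
      have h6 := ih hT'
      rw [h2] at h5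
      rw [h3] at h6
      rw [h1, card_insert_of_notMem he]
      have hg0 : 0 ≤ ∑ s, g s := sum_nonneg fun s _ => by simp only [g]; positivity
      have h7 : (2 : ℝ) ^ m * ∑ s, f s * g s ≤ 2 ^ m * (badProb k t ^ (#T + 1) * 2 ^ m) := by
        rw [h4]
        calc _ ≤ (badProb k t * 2 ^ m) * (badProb k t ^ #T * 2 ^ m) := by gcongr
          _ = _ := by ring
      exact le_of_mul_le_mul_left h7 (by positivity)

/-- Resampling the colours of the loose vertices makes a hyperedge monochromatic with probability
at most `2 ^ (1 - t)`: either it has at least `t` loose vertices, or it is not bad and keeps a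
vertex of each colour. -/
theorem card_isMono_le {k t : ℕ} (htk : t ≤ k) {e : Fin N} (he : #(H.edge e) = k)
    (c s : Fin m → Bool) :
    (#{r | H.IsMono (splice (H.loose t c) c (splice (H.edge e) s r)) e} : ℝ) ≤
      2 / 2 ^ t * 2 ^ m := by
  set B := H.edge e ∩ H.loose t c
  by_cases hB : t ≤ #B
  · have hsub : ({r | H.IsMono (splice (H.loose t c) c (splice (H.edge e) s r)) e} :
        Finset (Fin m → Bool)) ⊆ ({r | ∀ v ∈ B, r v = true} : Finset _) ∪
          ({r | ∀ v ∈ B, r v = false} : Finset _) := by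
      intro r hr
      simp only [mem_filter, mem_univ, true_and, mem_union] at hr ⊢
      obtain ⟨b, hb⟩ := hr
      have : ∀ v ∈ B, r v = b := by
        intro v hv
        obtain ⟨h1, h2⟩ := mem_inter.1 hv
        simpa [splice, h1, h2] using hb v h1
      cases b
      · exact Or.inr this
      · exact Or.inl this
    have h3 : (#{r | H.IsMono (splice (H.loose t c) c (splice (H.edge e) s r)) e} : ℝ) ≤
        #{r : Fin m → Bool | ∀ v ∈ B, r v = true} + #{r : Fin m → Bool | ∀ v ∈ B, r v = false} := by
      exact_mod_cast (card_le_card hsub).trans (card_union_le _ _)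
    have h4 : ∀ b, (#{r : Fin m → Bool | ∀ v ∈ B, r v = b} : ℝ) =
        2 ^ Fintype.card (Fin m) / 2 ^ #B := fun b => by convert card_agree B fun _ => b
    rw [h4, h4, Fintype.card_fin] at h3
    refine h3.trans ?_
    rw [← two_mul, div_mul_eq_mul_div, ← mul_div_assoc]
    gcongr
    norm_num
  · have hgood : ¬ H.IsBad t c e := by
      intro h
      apply hB
      have : B = H.edge e := by
        apply inter_eq_left.2
        intro v hv
        simp only [loose, mem_filter, mem_univ, true_and]
        exact ⟨e, hv, h⟩
      rw [this, he]; exact htk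
    have hno : ∀ r, ¬ H.IsMono (splice (H.loose t c) c (splice (H.edge e) s r)) e := by
      rintro r ⟨b, hb⟩
      apply hgood
      refine ⟨!b, lt_of_le_of_lt (card_le_card fun v hv => ?_) (not_le.1 hB)⟩
      obtain ⟨h1, h2⟩ := mem_filter.1 hv
      refine mem_inter.2 ⟨h1, ?_⟩
      by_contra h3
      have := hb v h1
      simp [splice, h3, h2] at this
    simp only [hno, filter_false, card_empty, Nat.cast_zero]
    positivity

end NumberedHypergraph

namespace NumberedHypergraph

open Finset
open scoped Classical

variable {m N : ℕ}

/-! ### A dying branching process -/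

/-- Consider a set of tasks. In each step one task is removed, and with probability at most `p` it
is replaced by at most `D` new ones. The expectation of `y ^ (number of tasks)` shrinks by
this factor in each step. -/
noncomputable def decay (p y : ℝ) (D : ℕ) : ℝ := (p * y ^ D + 1) / y

theorem decay_nonneg {p y : ℝ} (hp : 0 ≤ p) (hy : 1 ≤ y) (D : ℕ) : 0 ≤ decay p y D := by
  unfold decay
  have : 0 ≤ y := by linarith
  positivity

/-- The factor at `y = 1 + 1 / D` is less than `1`, because `(1 + 1 / D) ^ D ≤ e`. -/
theorem exists_decay_lt_one {p : ℝ} {D : ℕ} (hp : 0 ≤ p)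
    (h : Real.exp 1 * p * D < 1) : ∃ y, 1 ≤ y ∧ decay p y D < 1 := by
  rcases Nat.eq_zero_or_pos D with rfl | hD
  · refine ⟨p + 2, by linarith, ?_⟩
    unfold decay
    rw [pow_zero, div_lt_one (by linarith)]
    linarith
  · have hD' : (0 : ℝ) < D := by exact_mod_cast hD
    refine ⟨1 + 1 / D, by linarith [one_div_pos.2 hD'], ?_⟩
    have h1 : (1 + 1 / (D : ℝ)) ^ D ≤ Real.exp 1 := by
      calc (1 + 1 / (D : ℝ)) ^ D ≤ Real.exp (1 / D) ^ D := by
            gcongr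
            linarith [Real.add_one_le_exp (1 / (D : ℝ))]
        _ = Real.exp 1 := by
            rw [← Real.exp_nat_mul, mul_one_div_cancel hD'.ne']
    unfold decay
    rw [div_lt_one (by positivity)]
    have h2 : p * (1 + 1 / (D : ℝ)) ^ D < 1 / D := by
      rw [lt_div_iff₀ hD']
      calc p * (1 + 1 / (D : ℝ)) ^ D * D ≤ p * Real.exp 1 * D := by gcongr
        _ = Real.exp 1 * p * D := by ring
        _ < 1 := h
    linarith

/-- A process that decays survives a sufficiently large multiple of `l` steps with probability at
most `8 ^ (-l)`, also if it starts with a multiple of `l` tasks. -/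
theorem exists_pow_mul_decay_le {p y : ℝ} {D : ℕ} (hp : 0 ≤ p) (hy : 1 ≤ y)
    (h : decay p y D < 1) (a : ℕ) :
    ∃ b : ℕ, ∀ l : ℕ, y ^ (a * l) * decay p y D ^ (b * l) ≤ (1 / 8) ^ l := by
  have h0 := decay_nonneg hp hy D
  obtain ⟨b, hb⟩ := exists_pow_lt_of_lt_one (show 0 < 1 / 8 / y ^ a by positivity) h
  refine ⟨b, fun l => ?_⟩
  rw [pow_mul, pow_mul, ← mul_pow]
  gcongr
  rw [lt_div_iff₀ (by positivity)] at hb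
  linarith

/-! ### Repairing a component -/

section Repair

variable (H : NumberedHypergraph m N) (t : ℕ) (c : Fin m → Bool)

/-- The colouring that agrees with `s` on the loose vertices and with `c` on the others. -/
noncomputable def recolor (s : Fin m → Bool) : Fin m → Bool := splice (H.loose t c) c s

/-- One step of the repair of a set `C` of hyperedges. The state consists of the set of the
hyperedges that have yet to be checked and of the new colours of the loose vertices. The first
hyperedge to be checked is crossed off if it has two colours; otherwise its vertices get the fresh
random colours `r`, and it and those that meet it have to be checked. -/
noncomputable def repairStep (C : Finset (Fin N)) (r : Fin m → Bool)
    (S : Finset (Fin N) × (Fin m → Bool)) : Finset (Fin N) × (Fin m → Bool) :=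
  if h : S.1.Nonempty then
    let e := S.1.min' h
    if H.IsMono (H.recolor t c S.2) e then
      (S.1 ∪ C.filter (H.Meets e), splice (H.edge e) S.2 r)
    else (S.1.erase e, S.2)
  else S

/-- The state after `n` steps of the repair with fresh colours `ρ 0, ρ 1, …`. -/
noncomputable def repair (C : Finset (Fin N)) (ρ : ℕ → Fin m → Bool) :
    ℕ → Finset (Fin N) × (Fin m → Bool) → Finset (Fin N) × (Fin m → Bool)
  | 0, S => S
  | n + 1, S => repair C (fun i => ρ (i + 1)) n (H.repairStep t c C (ρ 0) S)

/-- The recursion at the other end: the last of `n + 1` steps uses the colours `ρ n`. -/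
theorem repair_succ (C : Finset (Fin N)) (ρ : ℕ → Fin m → Bool) (n : ℕ)
    (S : Finset (Fin N) × (Fin m → Bool)) :
    H.repair t c C ρ (n + 1) S = H.repairStep t c C (ρ n) (H.repair t c C ρ n S) := by
  induction n generalizing ρ S with
  | zero => simp [repair]
  | succ n ih =>
      rw [repair, ih, ← repair]

theorem repairStep_empty (C : Finset (Fin N)) (r s : Fin m → Bool) :
    H.repairStep t c C r (∅, s) = (∅, s) := by simp [repairStep]

theorem repair_empty (C : Finset (Fin N)) (ρ : ℕ → Fin m → Bool) (n : ℕ) (s : Fin m → Bool) :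
    H.repair t c C ρ n (∅, s) = (∅, s) := by
  induction n generalizing ρ with
  | zero => simp [repair]
  | succ n ih => rw [repair, repairStep_empty, ih]

/-- A finite sequence of colourings, continued by constant ones. -/
def extend {n : ℕ} (ρ : Fin n → Fin m → Bool) : ℕ → Fin m → Bool :=
  fun i => if h : i < n then ρ ⟨i, h⟩ else fun _ => false

theorem extend_cons_zero {n : ℕ} (r : Fin m → Bool) (ρ : Fin n → Fin m → Bool) :
    extend (Fin.cons r ρ : Fin (n + 1) → Fin m → Bool) 0 = r := by simp [extend]

theorem extend_cons_succ {n : ℕ} (r : Fin m → Bool) (ρ : Fin n → Fin m → Bool) :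
    (fun i => extend (Fin.cons r ρ : Fin (n + 1) → Fin m → Bool) (i + 1)) = extend ρ := by
  funext i
  by_cases h : i < n
  · have : (⟨i + 1, by omega⟩ : Fin (n + 1)) = Fin.succ ⟨i, h⟩ := rfl
    simp only [extend]
    rw [dif_pos (by omega), dif_pos h, this, Fin.cons_succ]
  · simp [extend, h]

theorem sum_cons {n : ℕ} (F : (Fin (n + 1) → Fin m → Bool) → ℝ) :
    ∑ ρ, F ρ = ∑ r : Fin m → Bool, ∑ ρ : Fin n → Fin m → Bool, F (Fin.cons r ρ) := by
  rw [← Fintype.sum_prod_type']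
  exact (Fintype.sum_equiv (Fin.consEquiv fun _ => Fin m → Bool) _ _ fun _ => rfl).symm

variable {H t c}

/-- The repair is unlikely to take long. If a hyperedge is found to be monochromatic, its
vertices get fresh colours, so that the colours remain uniformly random whatever the outcomes of
the previous checks were. -/
theorem sum_repair_le {d : ℕ} {p y : ℝ} (hd : H.MeetsAtMost d) (hy : 1 ≤ y)
    (hp : ∀ e s, (#{r | H.IsMono (H.recolor t c (splice (H.edge e) s r)) e} : ℝ) ≤ p * 2 ^ m)
    (hp₀ : 0 ≤ p) (C : Finset (Fin N)) (n : ℕ) (P : Finset (Fin N)) :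
    ∑ ρ : Fin n → Fin m → Bool, ∑ s : Fin m → Bool,
      (if (H.repair t c C (extend ρ) n (P, s)).1.Nonempty then (1 : ℝ) else 0) ≤
        y ^ #P * decay p y (d + 1) ^ n * (2 ^ m) ^ (n + 1) := by
  have hy0 : 0 < y := by linarith
  have hdec := decay_nonneg hp₀ hy (d + 1)
  induction n generalizing P with
  | zero =>
      simp only [univ_unique, sum_singleton, repair, pow_zero, mul_one, zero_add, pow_one]
      calc ∑ s : Fin m → Bool, (if P.Nonempty then (1 : ℝ) else 0) ≤
            ∑ s : Fin m → Bool, (1 : ℝ) := by gcongr; split_ifs <;> norm_num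
        _ = 2 ^ m := by simp
        _ ≤ y ^ #P * 2 ^ m := le_mul_of_one_le_left (by positivity) (one_le_pow₀ hy)
  | succ n ih =>
      rcases P.eq_empty_or_nonempty with rfl | hP
      · simp only [repair_empty, Finset.not_nonempty_empty, if_false, sum_const_zero]
        positivity
      set e := P.min' hP with he
      have heP : e ∈ P := P.min'_mem hP
      set P' := P ∪ C.filter (H.Meets e) with hP'
      set ind : Finset (Fin N) → (Fin n → Fin m → Bool) → (Fin m → Bool) → ℝ := fun P ρ s =>
        if (H.repair t c C (extend ρ) n (P, s)).1.Nonempty then (1 : ℝ) else 0 with hind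
      have hind0 : ∀ P ρ s, 0 ≤ ind P ρ s := by
        intro P ρ s; simp only [hind]; split_ifs <;> norm_num
      have key : ∀ r ρ s, (if (H.repair t c C (extend (Fin.cons r ρ : Fin (n + 1) → Fin m → Bool))
          (n + 1) (P, s)).1.Nonempty then (1 : ℝ) else 0) ≤ ind (P.erase e) ρ s +
            (if H.IsMono (H.recolor t c s) e then 1 else 0) *
              ind P' ρ (splice (H.edge e) s r) := by
        intro r ρ s
        rw [repair, extend_cons_succ, extend_cons_zero, repairStep, dif_pos hP]
        simp only [← he]
        by_cases hm : H.IsMono (H.recolor t c s) e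
        · rw [if_pos hm, if_pos hm, one_mul]
          have := hind0 (P.erase e) ρ s
          simp only [hind, hP'] at this ⊢
          linarith
        · rw [if_neg hm, if_neg hm, zero_mul, add_zero]
      rw [sum_cons]
      have h1 : ∑ ρ, ∑ s, ind (P.erase e) ρ s ≤ _ := ih (P.erase e)
      have h2 : ∑ ρ, ∑ s, ind P' ρ s ≤ _ := ih P'
      have hcard : #P' ≤ #P + d := by
        have : P' ⊆ P ∪ ({f | H.Meets e f} : Finset (Fin N)).erase e := by
          intro f hf
          rw [hP', mem_union, mem_filter] at hf
          rw [mem_union, mem_erase, mem_filter]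
          by_cases hfe : f = e
          · exact Or.inl (hfe ▸ heP)
          · exact hf.imp id fun h => ⟨hfe, mem_univ _, h.2⟩
        refine (card_le_card this).trans ((card_union_le _ _).trans ?_)
        rw [card_erase_of_mem (by simp [Meets.refl])]
        have := hd.card_le e
        omega
      have hstep : ∀ ρ : Fin n → Fin m → Bool, ∑ r, ∑ s,
          (if H.IsMono (H.recolor t c s) e then (1 : ℝ) else 0) *
            ind P' ρ (splice (H.edge e) s r) ≤ p * 2 ^ m * ∑ s, ind P' ρ s := by
        intro ρ
        rw [sum_comm, sum_splice (H.edge e) (fun s => if H.IsMono (H.recolor t c s) e then 1 else 0)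
          (ind P' ρ), mul_sum]
        refine sum_le_sum fun s _ => ?_
        rw [← sum_mul, sum_boole]
        exact mul_le_mul_of_nonneg_right (hp e s) (hind0 _ _ _)
      have hPe : y ^ #P = y ^ #(P.erase e) * y := by
        rw [← pow_succ, card_erase_add_one heP]
      calc _ ≤ ∑ r : Fin m → Bool, ∑ ρ : Fin n → Fin m → Bool, ∑ s, (ind (P.erase e) ρ s +
            (if H.IsMono (H.recolor t c s) e then 1 else 0) *
              ind P' ρ (splice (H.edge e) s r)) := by
            gcongr; exact key _ _ _
        _ = 2 ^ m * ∑ ρ, ∑ s, ind (P.erase e) ρ s + ∑ ρ : Fin n → Fin m → Bool, ∑ r, ∑ s,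
              (if H.IsMono (H.recolor t c s) e then (1 : ℝ) else 0) *
                ind P' ρ (splice (H.edge e) s r) := by
            simp only [sum_add_distrib]
            congr 1
            · simp
            · rw [sum_comm]
        _ ≤ 2 ^ m * ∑ ρ, ∑ s, ind (P.erase e) ρ s + p * 2 ^ m * ∑ ρ, ∑ s, ind P' ρ s := by
            rw [mul_sum (a := p * 2 ^ m)]
            gcongr with ρ
            exact hstep ρ
        _ ≤ 2 ^ m * (y ^ #(P.erase e) * decay p y (d + 1) ^ n * (2 ^ m) ^ (n + 1)) +
              p * 2 ^ m * (y ^ (#P + d) * decay p y (d + 1) ^ n * (2 ^ m) ^ (n + 1)) := by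
            gcongr
            refine h2.trans ?_
            gcongr
        _ = _ := by
            rw [pow_add y (#P) d, hPe, pow_succ (decay p y (d + 1)) n]
            nth_rewrite 4 [decay]
            field_simp
            ring

/-- Everything monochromatic is on the list of the hyperedges to be checked. -/
theorem repair_invariant {C : Finset (Fin N)} (ρ : ℕ → Fin m → Bool) (s : Fin m → Bool) (n : ℕ) :
    (H.repair t c C ρ n (C, s)).1 ⊆ C ∧
      ∀ e ∈ C, H.IsMono (H.recolor t c (H.repair t c C ρ n (C, s)).2) e →
        e ∈ (H.repair t c C ρ n (C, s)).1 := by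
  induction n with
  | zero => rw [repair]; exact ⟨subset_rfl, fun e he _ => he⟩
  | succ n ih =>
      rw [repair_succ]
      obtain ⟨ih₁, ih₂⟩ := ih
      set S := H.repair t c C ρ n (C, s)
      unfold repairStep
      split_ifs with h1
      · dsimp only
        split_ifs with h2
        · refine ⟨union_subset ih₁ (filter_subset _ _), fun e he hm => ?_⟩
          rw [mem_union, mem_filter]
          by_cases hme : H.Meets (S.1.min' h1) e
          · exact Or.inr ⟨he, hme⟩
          · refine Or.inl (ih₂ e he ?_)
            obtain ⟨b, hb⟩ := hm
            refine ⟨b, fun v hv => ?_⟩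
            rw [← hb v hv]
            have : v ∉ H.edge (S.1.min' h1) := fun hv' => hme (H.meets_of_mem hv' hv)
            simp [recolor, splice, this]
        · refine ⟨(erase_subset _ _).trans ih₁, fun e he hm => mem_erase.2 ⟨?_, ih₂ e he hm⟩⟩
          rintro rfl
          exact h2 hm
      · exact ⟨ih₁, ih₂⟩

end Repair

/-! ### Components of affected hyperedges -/

section Component

variable (H : NumberedHypergraph m N) (t : ℕ) (c : Fin m → Bool)

/-- The hyperedges that can be reached from `e` through affected hyperedges. -/
noncomputable def component (e : Fin N) : Finset (Fin N) :=
  {f | Relation.ReflTransGen (fun a b => H.Meets a b ∧ b ∈ H.affected t c) e f}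

/-- The component of affected hyperedges to which a vertex belongs; it is empty if the vertex lies
in no affected hyperedge. -/
noncomputable def componentAt (x : Fin m) : Finset (Fin N) :=
  {f | ∃ e ∈ H.affected t c, x ∈ H.edge e ∧ f ∈ H.component t c e}

variable {H t c}

theorem mem_component_self (e : Fin N) : e ∈ H.component t c e := by
  simp only [component, mem_filter, mem_univ, true_and]
  exact .refl

theorem mem_component_of_meets {e f g : Fin N} (hf : f ∈ H.component t c e) (h : H.Meets f g)
    (hg : g ∈ H.affected t c) : g ∈ H.component t c e := by
  simp only [component, mem_filter, mem_univ, true_and] at *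
  exact hf.tail ⟨h, hg⟩

theorem componentAt_eq {e : Fin N} {x : Fin m} (he : e ∈ H.affected t c) (hx : x ∈ H.edge e) :
    H.componentAt t c x = H.component t c e := by
  ext f
  simp only [componentAt, mem_filter, mem_univ, true_and]
  constructor
  · rintro ⟨e', he', hx', hf⟩
    simp only [component, mem_filter, mem_univ, true_and] at *
    exact .head ⟨H.meets_of_mem hx hx', he'⟩ hf
  · exact fun hf => ⟨e, he, hx, hf⟩

theorem component_subset_affected {e : Fin N} (he : e ∈ H.affected t c) :
    H.component t c e ⊆ H.affected t c := by
  intro f hf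
  simp only [component, mem_filter, mem_univ, true_and] at hf
  cases hf with
  | refl => exact he
  | tail _ h => exact h.2

variable (H t c) in
/-- The colouring found by the algorithm: `c` is the first random colouring, `s` gives the first new
colours of the loose vertices, and each component is repaired for `n` steps. -/
noncomputable def finalColor (s : Fin m → Bool) (ρ : ℕ → Fin m → Bool) (n : ℕ) (x : Fin m) : Bool :=
  H.recolor t c (H.repair t c (H.componentAt t c x) ρ n (H.componentAt t c x, s)).2 x

/-- A hyperedge that is not affected is not bad and has no loose vertex, so it keeps both colours of
`c`. All vertices of an affected hyperedge get their colours from the repair of its component. -/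
theorem not_isMono_finalColor (ht : 0 < t) {s : Fin m → Bool} {ρ : ℕ → Fin m → Bool} {n : ℕ}
    (h : ∀ e ∈ H.affected t c,
      (H.repair t c (H.component t c e) ρ n (H.component t c e, s)).1 = ∅) (e : Fin N) :
    ¬ H.IsMono (H.finalColor t c s ρ n) e := by
  rintro ⟨b, hb⟩
  by_cases he : e ∈ H.affected t c
  · have := (repair_invariant (H := H) (t := t) (c := c) (C := H.component t c e) ρ s n).2 e
      (mem_component_self e) ⟨b, fun v hv => by
        rw [← hb v hv, finalColor, componentAt_eq he hv]⟩
    rw [h e he] at this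
    simp at this
  · have hc : ∀ v ∈ H.edge e, c v = b := by
      intro v hv
      have : v ∉ H.loose t c := fun hl => he (by
        simp only [affected, mem_filter, mem_univ, true_and]; exact ⟨v, hv, hl⟩)
      simpa [finalColor, recolor, splice, this] using hb v hv
    refine he (mem_affected H |>.2 ⟨e, Meets.refl H e, !b, ?_⟩)
    rw [card_eq_zero.2 (filter_eq_empty_iff.2 fun v hv => by simp [hc v hv])]
    exact ht

end Component

/-! ### Components are small -/

section Shatter

variable (H : NumberedHypergraph m N)

/-- The hyperedges at distance exactly `i` from `e`, and those at distance at most `i`. -/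
noncomputable def sphereBall (e : Fin N) : ℕ → Finset (Fin N) × Finset (Fin N)
  | 0 => ({e}, {e})
  | i + 1 =>
      let S : Finset (Fin N) := {f | f ∉ (sphereBall e i).2 ∧ ∃ a ∈ (sphereBall e i).1, H.Meets a f}
      (S, (sphereBall e i).2 ∪ S)

theorem sphere_subset_ball (e : Fin N) (i : ℕ) :
    (H.sphereBall e i).1 ⊆ (H.sphereBall e i).2 := by
  cases i with
  | zero => exact subset_rfl
  | succ i => exact subset_union_right

theorem mem_ball_succ {e f g : Fin N} {i : ℕ} (hf : f ∈ (H.sphereBall e i).2) (h : H.Meets f g) :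
    g ∈ (H.sphereBall e (i + 1)).2 := by
  induction i generalizing f g with
  | zero =>
      simp only [sphereBall, mem_singleton, mem_union, mem_filter, mem_univ, true_and] at *
      subst hf
      by_cases hg : g = f
      · exact Or.inl hg
      · exact Or.inr ⟨hg, f, rfl, h⟩
  | succ i ih =>
      by_cases hg : g ∈ (H.sphereBall e (i + 1)).2
      · rw [sphereBall]; exact mem_union_left _ hg
      · rw [sphereBall] at hf
        rcases mem_union.1 hf with hf | hf
        · exact absurd (ih hf h) hg
        · rw [sphereBall]
          refine mem_union_right _ (mem_filter.2 ⟨mem_univ _, hg, f, hf, h⟩)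

variable {H}

theorem card_sphere_one_le {d : ℕ} (hd : H.MeetsAtMost d) (e : Fin N) :
    #(H.sphereBall e 1).1 ≤ d := by
  have : (H.sphereBall e 1).1 ⊆ ({f | H.Meets e f} : Finset (Fin N)).erase e := by
    intro f hf
    simp only [sphereBall, mem_filter, mem_singleton, exists_eq_left] at hf
    simp [hf.2.1, hf.2.2]
  have h1 := card_le_card this
  rw [card_erase_of_mem (by simp [Meets.refl])] at h1
  have := hd.card_le e
  omega

/-- Of the at most `d` neighbours of a hyperedge at distance `i + 1`, one is at distance `i`. -/
theorem card_sphere_succ_le {d : ℕ} (hd : H.MeetsAtMost d) (e : Fin N) (i : ℕ) :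
    #(H.sphereBall e (i + 2)).1 ≤ #(H.sphereBall e (i + 1)).1 * (d - 1) := by
  have hsub : (H.sphereBall e (i + 2)).1 ⊆ (H.sphereBall e (i + 1)).1.biUnion fun a =>
      ({f | H.Meets a f ∧ f ∉ (H.sphereBall e (i + 1)).2} : Finset (Fin N)) := by
    intro f hf
    rw [sphereBall] at hf
    simp only [mem_filter, mem_univ, true_and] at hf
    obtain ⟨h1, a, ha, h2⟩ := hf
    exact mem_biUnion.2 ⟨a, ha, by simp [h1, h2]⟩
  refine (card_le_card hsub).trans (card_biUnion_le_card_mul _ _ _ fun a ha => ?_)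
  -- `a` itself and a neighbour `b` that is closer to `e` do not count
  have ha' := ha
  rw [sphereBall] at ha'
  simp only [mem_filter, mem_univ, true_and] at ha'
  obtain ⟨h1, b, hb, hba⟩ := ha'
  have hbB : b ∈ (H.sphereBall e i).2 := sphere_subset_ball H e i hb
  have hab : b ≠ a := fun h => h1 (h ▸ hbB)
  have hsub' : ({f | H.Meets a f ∧ f ∉ (H.sphereBall e (i + 1)).2} : Finset (Fin N)) ⊆
      (({f | H.Meets a f} : Finset (Fin N)).erase a).erase b := by
    intro f hf
    simp only [mem_filter, mem_univ, true_and] at hf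
    simp only [mem_erase, mem_filter, mem_univ, true_and]
    refine ⟨?_, ?_, hf.1⟩
    · rintro rfl
      exact hf.2 (by rw [sphereBall]; exact mem_union_left _ hbB)
    · rintro rfl
      exact hf.2 (sphere_subset_ball H e (i + 1) ha)
  have h2 := card_le_card hsub'
  rw [card_erase_of_mem (by simp [hab, hba.symm]), card_erase_of_mem (by simp [Meets.refl])] at h2
  have := hd.card_le a
  omega

variable (H) in
/-- The hyperedges that do not meet `e` but are at distance at most `4` from it. -/
noncomputable def nearby (e : Fin N) : Finset (Fin N) :=
  {f | ¬ H.Meets e f ∧ ∃ a b g, H.Meets e a ∧ H.Meets a b ∧ H.Meets b g ∧ H.Meets g f}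

/-- The number of hyperedges at distance `2`, `3` or `4`. -/
theorem card_nearby_le {d : ℕ} (hd : H.MeetsAtMost d) (e : Fin N) :
    #(H.nearby e) ≤ d * (d - 1) + d * (d - 1) ^ 2 + d * (d - 1) ^ 3 := by
  have hsub : H.nearby e ⊆ (H.sphereBall e 2).1 ∪ (H.sphereBall e 3).1 ∪ (H.sphereBall e 4).1 := by
    intro f hf
    simp only [nearby, mem_filter, mem_univ, true_and] at hf
    obtain ⟨h1, a, b, g, ha, hb, hg, hf⟩ := hf
    have h0 : e ∈ (H.sphereBall e 0).2 := by simp [sphereBall]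
    have h4 := H.mem_ball_succ (H.mem_ball_succ (H.mem_ball_succ (H.mem_ball_succ h0 ha) hb) hg) hf
    have hball : ∀ i, (H.sphereBall e (i + 1)).2 =
      (H.sphereBall e i).2 ∪ (H.sphereBall e (i + 1)).1 := fun i => rfl
    have h5 : f ∉ (H.sphereBall e 1).2 := by
      intro h
      apply h1
      rw [hball, mem_union] at h
      rcases h with h | h
      · simp only [sphereBall, mem_singleton] at h
        rw [h]; exact Meets.refl H e
      · simp only [sphereBall, mem_filter, mem_singleton, exists_eq_left] at h
        exact h.2.2
    rw [hball 3, mem_union, hball 2, mem_union, hball 1, mem_union] at h4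
    simp only [mem_union]
    tauto
  have h1 := card_sphere_one_le hd e
  have h2 := card_sphere_succ_le hd e 0
  have h3 := card_sphere_succ_le hd e 1
  have h4 := card_sphere_succ_le hd e 2
  have h2' : #(H.sphereBall e 2).1 ≤ d * (d - 1) := h2.trans (Nat.mul_le_mul_right _ h1)
  have h3' : #(H.sphereBall e 3).1 ≤ d * (d - 1) ^ 2 :=
    (h3.trans (Nat.mul_le_mul_right _ h2')).trans_eq (by ring)
  have h4' : #(H.sphereBall e 4).1 ≤ d * (d - 1) ^ 3 :=
    (h4.trans (Nat.mul_le_mul_right _ h3')).trans_eq (by ring)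
  refine (card_le_card hsub).trans ((card_union_le _ _).trans ?_)
  have := card_union_le (H.sphereBall e 2).1 (H.sphereBall e 3).1
  omega

variable (H) in
/-- One step of the search for pairwise disjoint bad hyperedges. The state consists of the set of
candidates and of the set of those already found. -/
noncomputable def searchStep (t : ℕ) (c : Fin m → Bool) (S : Finset (Fin N) × Finset (Fin N)) :
    Finset (Fin N) × Finset (Fin N) :=
  if h : S.1.Nonempty then
    let e := S.1.min' h
    if (∀ f ∈ S.2, ¬ H.Meets e f) ∧ H.IsBad t c e then
      (S.1.erase e ∪ H.nearby e, insert e S.2)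
    else (S.1.erase e, S.2)
  else S

theorem search_empty (t : ℕ) (c : Fin m → Bool) (n : ℕ) (T : Finset (Fin N)) :
    (H.searchStep t c)^[n] (∅, T) = (∅, T) := by
  induction n with
  | zero => rfl
  | succ n ih => rw [Function.iterate_succ_apply, searchStep, dif_neg (by simp), ih]

/-- The search is unlikely to take long, since the hyperedges that it finds are bad
independently of each other. -/
theorem card_search_le {k t D : ℕ} {y : ℝ} (hk : H.IsUniform k)
    (hD : ∀ e, #(H.nearby e) ≤ D) (hy : 1 ≤ y) (n : ℕ) (P T : Finset (Fin N))
    (hT : (T : Set (Fin N)).PairwiseDisjoint H.edge) :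
    (#{c | ((H.searchStep t c)^[n] (P, T)).1.Nonempty ∧ ∀ e ∈ T, H.IsBad t c e} : ℝ) ≤
      badProb k t ^ #T * y ^ #P * decay (badProb k t) y D ^ n * 2 ^ m := by
  have hy0 : 0 < y := by linarith
  have hq : 0 ≤ badProb k t := by unfold badProb; positivity
  have hdec := decay_nonneg hq hy D
  induction n generalizing P T with
  | zero =>
      calc _ ≤ (#{c | ∀ e ∈ T, H.IsBad t c e} : ℝ) := by
            gcongr with c; exact fun h => h.2
        _ ≤ badProb k t ^ #T * 2 ^ m := card_forall_isBad_le hk T hT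
        _ ≤ _ := by
            rw [pow_zero, mul_one]
            gcongr
            exact le_mul_of_one_le_right (by positivity) (one_le_pow₀ hy)
  | succ n ih =>
      rcases P.eq_empty_or_nonempty with rfl | hP
      · simp only [search_empty, Finset.not_nonempty_empty, false_and, filter_false, card_empty,
          Nat.cast_zero]
        positivity
      set e := P.min' hP with he
      have heP : e ∈ P := P.min'_mem hP
      have hPe : y ^ #P = y ^ #(P.erase e) * y := by
        rw [← pow_succ, card_erase_add_one heP]
      have hstep : ∀ c, H.searchStep t c (P, T) =
          if (∀ f ∈ T, ¬ H.Meets e f) ∧ H.IsBad t c e then (P.erase e ∪ H.nearby e, insert e T)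
          else (P.erase e, T) := by
        intro c
        rw [searchStep, dif_pos hP]
      have h1 := ih (P.erase e) T hT
      -- either `e` is no longer a candidate, or it is bad, which costs a factor `badProb k t`, and
      -- gives rise to `D` candidates at most
      have hbound : badProb k t ^ #T * y ^ #(P.erase e) * decay (badProb k t) y D ^ n * 2 ^ m +
          badProb k t ^ (#T + 1) * y ^ (#(P.erase e) + D) * decay (badProb k t) y D ^ n * 2 ^ m =
          badProb k t ^ #T * y ^ #P * decay (badProb k t) y D ^ (n + 1) * 2 ^ m := by
        rw [hPe, pow_succ (decay (badProb k t) y D) n, pow_add y, pow_succ (badProb k t)]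
        nth_rewrite 4 [decay]
        field_simp
        ring
      rw [← hbound]
      by_cases hdis : ∀ f ∈ T, ¬ H.Meets e f
      · have heT : e ∉ T := fun h => hdis e h (Meets.refl H e)
        have hT' : ((insert e T : Finset (Fin N)) : Set (Fin N)).PairwiseDisjoint H.edge := by
          rw [coe_insert]
          refine hT.insert fun f hf _ => ?_
          rw [disjoint_iff_inter_eq_empty]
          exact not_nonempty_iff_eq_empty.1 (hdis f hf)
        have h2 := ih (P.erase e ∪ H.nearby e) (insert e T) hT'
        rw [card_insert_of_notMem heT] at h2
        have hc : #(P.erase e ∪ H.nearby e) ≤ #(P.erase e) + D :=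
          (card_union_le _ _).trans (Nat.add_le_add_left (hD e) _)
        have hsub : ({c | ((H.searchStep t c)^[n + 1] (P, T)).1.Nonempty ∧
            ∀ e ∈ T, H.IsBad t c e} : Finset (Fin m → Bool)) ⊆
            ({c | ((H.searchStep t c)^[n] (P.erase e, T)).1.Nonempty ∧
              ∀ e ∈ T, H.IsBad t c e} : Finset (Fin m → Bool)) ∪
            ({c | ((H.searchStep t c)^[n] (P.erase e ∪ H.nearby e, insert e T)).1.Nonempty ∧
              ∀ e' ∈ insert e T, H.IsBad t c e'} : Finset (Fin m → Bool)) := by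
          intro c hc
          rw [mem_filter, Function.iterate_succ_apply, hstep] at hc
          rw [mem_union, mem_filter, mem_filter]
          by_cases hb : H.IsBad t c e
          · rw [if_pos ⟨hdis, hb⟩] at hc
            exact Or.inr ⟨mem_univ _, hc.2.1, (forall_mem_insert _ _ _).2 ⟨hb, hc.2.2⟩⟩
          · rw [if_neg (fun h => hb h.2)] at hc
            exact Or.inl hc
        have h3 := (card_le_card hsub).trans (card_union_le _ _)
        refine (Nat.cast_le.2 h3).trans ?_
        push_cast
        refine add_le_add h1 (h2.trans ?_)
        gcongr
      · simp only [Function.iterate_succ_apply, hstep, hdis, false_and, if_false]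
        refine h1.trans (le_add_of_nonneg_right (by positivity))

/-- If the search ends, every bad candidate meets one of the hyperedges found. -/
theorem search_covers {t : ℕ} {c : Fin m → Bool} (n : ℕ) (P T : Finset (Fin N))
    (h : ((H.searchStep t c)^[n] (P, T)).1 = ∅) :
    ∃ T', T ⊆ T' ∧ #T' ≤ #T + n ∧ (∀ f ∈ P, H.IsBad t c f → ∃ g ∈ T', H.Meets f g) ∧
      ∀ e ∈ T', e ∉ T → ∀ f ∈ H.nearby e, H.IsBad t c f → ∃ g ∈ T', H.Meets f g := by
  induction n generalizing P T with
  | zero =>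
      obtain rfl : P = ∅ := h
      exact ⟨T, subset_rfl, by simp, by simp, fun e he he' => absurd he he'⟩
  | succ n ih =>
      rcases P.eq_empty_or_nonempty with rfl | hP
      · exact ⟨T, subset_rfl, by simp, by simp, fun e he he' => absurd he he'⟩
      rw [Function.iterate_succ_apply, searchStep, dif_pos hP] at h
      dsimp only at h
      set e := P.min' hP
      split_ifs at h with hb
      · obtain ⟨T', h1, h2, h3, h4⟩ := ih _ _ h
        have heT : e ∉ T := fun h => hb.1 e h (Meets.refl H e)
        rw [card_insert_of_notMem heT] at h2
        have heT' : e ∈ T' := h1 (mem_insert_self _ _)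
        refine ⟨T', (subset_insert _ _).trans h1, by omega, fun f hf hbf => ?_,
          fun f hf hfT g hg hbg => ?_⟩
        · by_cases hfe : f = e
          · exact ⟨e, heT', hfe ▸ Meets.refl H e⟩
          · exact h3 f (mem_union_left _ (mem_erase.2 ⟨hfe, hf⟩)) hbf
        · by_cases hfe : f = e
          · subst hfe
            exact h3 g (mem_union_right _ hg) hbg
          · exact h4 f hf (by simp [hfe, hfT]) g hg hbg
      · obtain ⟨T', h1, h2, h3, h4⟩ := ih _ _ h
        refine ⟨T', h1, by omega, fun f hf hbf => ?_, h4⟩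
        by_cases hfe : f = e
        · subst hfe
          push Not at hb
          by_contra hno
          exact hb (fun g hg hm => hno ⟨g, h1 hg, hm⟩) hbf
        · exact h3 f (mem_erase.2 ⟨hfe, hf⟩) hbf

/-- If the search from the neighbourhood of `e` ends after `n` steps, then the component of `e` lies
within distance `2` of at most `n` hyperedges. -/
theorem card_component_le {d t : ℕ} (hd : H.MeetsAtMost d) {c : Fin m → Bool} {n : ℕ} {e : Fin N}
    (he : e ∈ H.affected t c)
    (h : ((H.searchStep t c)^[n] (({f | H.Meets e f} : Finset (Fin N)), ∅)).1 = ∅) :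
    #(H.component t c e) ≤ (d + 1) ^ 2 * n := by
  obtain ⟨T, -, hT, hP, hN⟩ := search_covers n _ _ h
  simp only [mem_filter, mem_univ, true_and, notMem_empty, not_false_eq_true, forall_const] at hP hN
  -- if `f` meets `f'` in the component and `b` is a bad hyperedge at `f'`, the walk
  -- `τ, g, f, f', b` has length `4`; hence the search from `τ` considers `b`, and finds
  -- some `τ'` that meets it
  have key : ∀ f ∈ H.component t c e, ∃ τ ∈ T, ∃ g, H.Meets τ g ∧ H.Meets g f := by
    intro f hf
    simp only [component, mem_filter, mem_univ, true_and] at hf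
    induction hf with
    | refl =>
        obtain ⟨b, hb, hbad⟩ := (H.mem_affected).1 he
        obtain ⟨τ, hτ, hm⟩ := hP b hb hbad
        exact ⟨τ, hτ, b, hm.symm, hb.symm⟩
    | tail _ hstep ih =>
        obtain ⟨τ, hτ, g, hg, hgf⟩ := ih
        obtain ⟨b, hb, hbad⟩ := (H.mem_affected).1 hstep.2
        by_cases hbτ : H.Meets τ b
        · exact ⟨τ, hτ, b, hbτ, hb.symm⟩
        · obtain ⟨τ', hτ', hm⟩ := hN τ hτ b (by
            simp only [nearby, mem_filter, mem_univ, true_and]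
            exact ⟨hbτ, _, _, _, hg, hgf, hstep.1, hb⟩) hbad
          exact ⟨τ', hτ', b, hm.symm, hb.symm⟩
  have hsub : H.component t c e ⊆ T.biUnion fun τ =>
      ({g | H.Meets τ g} : Finset (Fin N)).biUnion fun g => {f | H.Meets g f} := by
    intro f hf
    obtain ⟨τ, hτ, g, h1, h2⟩ := key f hf
    simp only [mem_biUnion, mem_filter, mem_univ, true_and]
    exact ⟨τ, hτ, g, h1, h2⟩
  calc #(H.component t c e) ≤ _ := card_le_card hsub
    _ ≤ #T * ((d + 1) * (d + 1)) := card_biUnion_le_card_mul _ _ _ fun τ _ =>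
        (card_biUnion_le_card_mul _ _ _ fun g _ => hd.card_le g).trans
          (Nat.mul_le_mul_right _ (hd.card_le τ))
    _ ≤ n * ((d + 1) * (d + 1)) := Nat.mul_le_mul_right _ (by simpa using hT)
    _ = _ := by ring

/-- A component with more than `(d + 1) ^ 2 * n` hyperedges lets the search from one of its members
survive `n` steps. The search starts with at most `d + 1` candidates. -/
theorem card_large_component_le {d k t : ℕ} {y : ℝ} (hk : H.IsUniform k) (hd : H.MeetsAtMost d)
    (hy : 1 ≤ y) (n : ℕ) (e : Fin N) :
    (#{c | e ∈ H.affected t c ∧ (d + 1) ^ 2 * n < #(H.component t c e)} : ℝ) ≤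
      y ^ (d + 1) *
        decay (badProb k t) y (d * (d - 1) + d * (d - 1) ^ 2 + d * (d - 1) ^ 3) ^ n * 2 ^ m := by
  have hq : 0 ≤ badProb k t := by unfold badProb; positivity
  have h1 := card_search_le (t := t) hk (card_nearby_le hd) hy n {f | H.Meets e f} ∅
    (by simp)
  have hdec := decay_nonneg hq hy (d * (d - 1) + d * (d - 1) ^ 2 + d * (d - 1) ^ 3)
  calc _ ≤ (#{c | ((H.searchStep t c)^[n] (({f | H.Meets e f} : Finset (Fin N)), ∅)).1.Nonempty ∧
          ∀ e ∈ (∅ : Finset (Fin N)), H.IsBad t c e} : ℝ) := by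
        refine Nat.cast_le.2 (card_le_card fun c hc => ?_)
        rw [mem_filter] at hc ⊢
        obtain ⟨-, h2, h3⟩ := hc
        refine ⟨mem_univ _, ?_, by simp⟩
        by_contra h4
        exact absurd (card_component_le hd h2 (not_nonempty_iff_eq_empty.1 h4)) (by omega)
    _ ≤ _ := h1
    _ ≤ _ := by
        rw [card_empty, pow_zero, one_mul]
        gcongr
        exact hd.card_le e

end Shatter

end NumberedHypergraph

/-! ### The choice of the threshold -/

namespace NumberedHypergraph

open Finset

theorem badProb_succ_le (k t : ℕ) : badProb (k + 1) t ≤ badProb k t := by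
  have h : ∑ i ∈ range t, (k + 1).choose i ≤ 2 * ∑ i ∈ range t, k.choose i := by
    cases t with
    | zero => simp
    | succ t =>
        rw [sum_range_succ' (fun i => (k + 1).choose i), two_mul]
        simp only [Nat.choose_succ_succ', sum_add_distrib, Nat.choose_zero_right]
        have h1 := sum_range_succ' (fun i => k.choose i) t
        have h2 := sum_range_succ (fun i => k.choose i) t
        simp only [Nat.choose_zero_right] at h1
        omega
  have h' : ((∑ i ∈ range t, (k + 1).choose i : ℕ) : ℝ) ≤ 2 * (∑ i ∈ range t, k.choose i : ℕ) := by
    exact_mod_cast h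
  unfold badProb
  rw [div_le_div_iff₀ (by positivity) (by positivity), pow_succ]
  nlinarith [show (0 : ℝ) < 2 ^ k by positivity]

theorem badProb_anti {k k' : ℕ} (h : k ≤ k') (t : ℕ) : badProb k' t ≤ badProb k t :=
  antitone_nat_of_succ_le (f := fun k => badProb k t) (fun k => badProb_succ_le k t) h

theorem badProb_mono (k : ℕ) {t t' : ℕ} (h : t ≤ t') : badProb k t ≤ badProb k t' := by
  unfold badProb
  gcongr

/-- The number of sets of size less than `t` is estimated by means of the binomial theorem for
`(1 + 1 / 4) ^ k`, in which these sets have the largest weights. -/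
theorem badProb_le (k t : ℕ) (ht : 0 < t) : badProb k t ≤ 2 * 4 ^ (t - 1) * (5 / 8) ^ k := by
  have h : ((∑ i ∈ range t, k.choose i : ℕ) : ℝ) ≤ 4 ^ (t - 1) * (5 / 4) ^ k := by
    rw [show (5 / 4 : ℝ) = 1 / 4 + 1 by norm_num, add_pow, mul_sum]
    push_cast
    have h1 : ∀ i, (0 : ℝ) ≤ 4 ^ (t - 1) * ((1 / 4) ^ i * 1 ^ (k - i) * k.choose i) :=
      fun i => by positivity
    calc ∑ i ∈ range t, (k.choose i : ℝ)
        ≤ ∑ i ∈ range t, 4 ^ (t - 1) * ((1 / 4) ^ i * 1 ^ (k - i) * (k.choose i : ℝ)) := by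
          refine sum_le_sum fun i hi => ?_
          have hi' := mem_range.1 hi
          have : (1 : ℝ) ≤ 4 ^ (t - 1) * (1 / 4) ^ i := by
            rw [one_div, inv_pow, ← div_eq_mul_inv, one_le_div (by positivity)]
            exact pow_le_pow_right₀ (by norm_num) (by omega)
          rw [one_pow, mul_one, ← mul_assoc]
          exact le_mul_of_one_le_left (by positivity) this
      _ ≤ ∑ i ∈ range (max t (k + 1)),
          4 ^ (t - 1) * ((1 / 4) ^ i * 1 ^ (k - i) * (k.choose i : ℝ)) :=
          sum_le_sum_of_subset_of_nonneg (range_subset_range.2 (le_max_left _ _)) fun i _ _ => h1 i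
      _ = _ := by
          refine (sum_subset (range_subset_range.2 (le_max_right _ _)) fun i _ hi => ?_).symm
          rw [Nat.choose_eq_zero_of_lt (by simpa using hi)]
          simp
  unfold badProb
  rw [div_le_iff₀ (by positivity), mul_assoc, ← mul_pow]
  norm_num at h ⊢
  linarith

/-- A threshold `t` for which both the search for bad hyperedges and the repair are dying branching
processes, namely the least `t` with `2 e (d + 1) < 2 ^ t`. -/
theorem exists_threshold {d k k₁ k₂ k₃ : ℕ} (hk : k₁ + k₂ + k₃ = k)
    (h₁ : 16 * (d : ℝ) * ((d : ℝ) - 1) ^ 3 * ((d : ℝ) + 1) < 2 ^ k₁)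
    (h₂ : 16 * (d : ℝ) * ((d : ℝ) - 1) ^ 3 * ((d : ℝ) + 1) < 2 ^ k₂)
    (h₃ : 2 * Real.exp 1 * ((d : ℝ) + 1) < 2 ^ k₃) :
    ∃ t, 0 < t ∧ t ≤ k ∧ Real.exp 1 * (2 / 2 ^ t) * (d + 1 : ℕ) < 1 ∧
      Real.exp 1 * badProb k t * (d * (d - 1) + d * (d - 1) ^ 2 + d * (d - 1) ^ 3 : ℕ) < 1 := by
  have he2 : 2.7 < Real.exp 1 := by linarith [Real.exp_one_gt_d9]
  have he3 : Real.exp 1 < 2.8 := by linarith [Real.exp_one_lt_d9]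
  have hd0 : (0 : ℝ) ≤ d := by positivity
  classical
  have hex : ∃ t, 2 * Real.exp 1 * ((d : ℝ) + 1) < 2 ^ t := ⟨k₃, h₃⟩
  obtain ⟨t, ht, htmin⟩ : ∃ t, 2 * Real.exp 1 * ((d : ℝ) + 1) < 2 ^ t ∧
      ∀ s < t, ¬ 2 * Real.exp 1 * ((d : ℝ) + 1) < 2 ^ s :=
    ⟨Nat.find hex, Nat.find_spec hex, fun s hs => Nat.find_min hex hs⟩
  have htk : t ≤ k₃ := not_lt.1 fun h => htmin _ h h₃
  have ht0 : 0 < t := by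
    rcases Nat.eq_zero_or_pos t with rfl | h
    · rw [pow_zero] at ht
      nlinarith
    · exact h
  have htpred : (2 : ℝ) ^ (t - 1) ≤ 2 * Real.exp 1 * ((d : ℝ) + 1) := not_lt.1 (htmin _ (by omega))
  have htt : (2 : ℝ) ^ t = 2 * 2 ^ (t - 1) := by rw [← pow_succ']; congr 1; omega
  refine ⟨t, ht0, by omega, ?_, ?_⟩
  · push_cast
    rw [mul_div_assoc', div_mul_eq_mul_div, div_lt_one (by positivity)]
    linarith
  rcases le_or_gt d 1 with hd | hd
  · -- there is nothing at distance two
    have : d * (d - 1) + d * (d - 1) ^ 2 + d * (d - 1) ^ 3 = 0 := by interval_cases d <;> rfl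
    rw [this]; simp
  rcases Nat.lt_or_ge d 3 with hd3 | hd3
  · obtain rfl : d = 2 := by omega
    -- the exponents are at least `7`, `7` and `5`, and `t ≤ 5`
    norm_num at h₁ h₂ h₃ htpred ⊢
    have hpow : ∀ {a : ℝ} {i j : ℕ}, a < 2 ^ i → (2 : ℝ) ^ j ≤ a → j < i := fun {a i j} h h' =>
      (pow_lt_pow_iff_right₀ (by norm_num : (1 : ℝ) < 2)).1 (h'.trans_lt h)
    have a1 := hpow h₁ (j := 6) (by norm_num)
    have a2 := hpow h₂ (j := 6) (by norm_num)
    have a3 := hpow h₃ (j := 4) (by linarith)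
    have a4 : t - 1 < 5 := (pow_lt_pow_iff_right₀ (by norm_num : (1 : ℝ) < 2)).1
      (htpred.trans_lt (by linarith))
    have hq : badProb k t ≤ badProb 19 5 :=
      (badProb_anti (by omega) t).trans (badProb_mono _ (by omega))
    have hq' : badProb 19 5 ≤ 1 / 50 := by
      unfold badProb
      norm_num [sum_range_succ, Nat.choose]
    nlinarith
  · have ha : (3 : ℝ) ≤ d := by exact_mod_cast hd3
    set a : ℝ := (d : ℝ)
    set Y : ℝ := a * (a - 1) ^ 3 with hY
    have hb : (2 : ℝ) ≤ a - 1 := by linarith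
    have hY24 : 24 ≤ Y := by
      have : (2 : ℝ) ^ 3 ≤ (a - 1) ^ 3 := by gcongr
      nlinarith
    have hX : 16 * a * (a - 1) ^ 3 * (a + 1) = 16 * Y * (a + 1) := by rw [hY]; ring
    rw [hX] at h₁ h₂
    have hD : ((d * (d - 1) + d * (d - 1) ^ 2 + d * (d - 1) ^ 3 : ℕ) : ℝ) ≤ 7 / 4 * Y := by
      push_cast [Nat.cast_sub (by omega : 1 ≤ d)]
      change a * (a - 1) + a * (a - 1) ^ 2 + a * (a - 1) ^ 3 ≤ _
      have h1 : 0 ≤ a * (a - 1) := by positivity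
      have h2 : 4 * (1 + (a - 1)) ≤ 3 * (a - 1) ^ 2 := by nlinarith
      rw [hY]
      nlinarith [mul_le_mul_of_nonneg_left h2 h1]
    have hq : badProb k t ≤ 1 / 2 * (5 / 2) ^ t * (5 / 8) ^ k₁ * (5 / 8) ^ k₂ := by
      refine (badProb_anti (by omega : k₁ + k₂ + t ≤ k) t).trans ((badProb_le _ _ ht0).trans_eq ?_)
      have : (4 : ℝ) ^ t = 4 * 4 ^ (t - 1) := by rw [← pow_succ']; congr 1; omega
      rw [show (5 / 2 : ℝ) = 4 * (5 / 8) by norm_num, mul_pow, this, pow_add, pow_add]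
      ring
    set F : ℝ := 2.8 * (7 / 4 * Y) * (1 / 2 * (5 / 2) ^ t * (5 / 8) ^ k₁ * (5 / 8) ^ k₂) with hF
    have hle : Real.exp 1 * badProb k t *
        (d * (d - 1) + d * (d - 1) ^ 2 + d * (d - 1) ^ 3 : ℕ) ≤ F := by
      have hq0 : 0 ≤ badProb k t := by unfold badProb; positivity
      calc _ ≤ 2.8 * (1 / 2 * (5 / 2) ^ t * (5 / 8) ^ k₁ * (5 / 8) ^ k₂) * (7 / 4 * Y) := by gcongr
        _ = F := by rw [hF]; ring
    refine hle.trans_lt ?_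
    have hF0 : 0 ≤ F := by positivity
    -- cubes make the bases comparable with powers of `2`: `(5 / 2) ^ 3 ≤ 2 ^ 4` and
    -- `(5 / 8) ^ 3 ≤ 1 / 2 ^ 2`
    have hF3 : F ^ 3 < 1 := by
      have e1 : ((5 / 2 : ℝ) ^ t) ^ 3 ≤ (2 * (2 * 2.8 * (a + 1))) ^ 4 := by
        calc ((5 / 2 : ℝ) ^ t) ^ 3 = ((5 / 2) ^ 3) ^ t := by rw [← pow_mul, ← pow_mul, mul_comm]
          _ ≤ (2 ^ 4) ^ t := by gcongr; norm_num
          _ = (2 ^ t) ^ 4 := by rw [← pow_mul, ← pow_mul, mul_comm]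
          _ ≤ (2 * (2 * 2.8 * (a + 1))) ^ 4 := by
              rw [htt]
              gcongr
              refine htpred.trans ?_
              gcongr
      have e2 : ∀ {j : ℕ}, 16 * Y * (a + 1) < 2 ^ j →
          ((5 / 8 : ℝ) ^ j) ^ 3 ≤ 1 / (16 * Y * (a + 1)) ^ 2 := by
        intro j hj
        calc ((5 / 8 : ℝ) ^ j) ^ 3 = ((5 / 8) ^ 3) ^ j := by rw [← pow_mul, ← pow_mul, mul_comm]
          _ ≤ (1 / 2 ^ 2) ^ j := by gcongr; norm_num
          _ = 1 / (2 ^ j) ^ 2 := by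
              rw [div_pow, one_pow, ← pow_mul, ← pow_mul, mul_comm]
          _ ≤ _ := by gcongr
      calc F ^ 3 = (2.8 * (7 / 4 * Y) * (1 / 2)) ^ 3 * ((5 / 2) ^ t) ^ 3 * ((5 / 8) ^ k₁) ^ 3 *
            ((5 / 8) ^ k₂) ^ 3 := by rw [hF]; ring
        _ ≤ (2.8 * (7 / 4 * Y) * (1 / 2)) ^ 3 * (2 * (2 * 2.8 * (a + 1))) ^ 4 *
            (1 / (16 * Y * (a + 1)) ^ 2) * (1 / (16 * Y * (a + 1)) ^ 2) := by
            gcongr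
            · exact e2 h₁
            · exact e2 h₂
        _ = (2.8 * (7 / 4) * (1 / 2)) ^ 3 * (2 * (2 * 2.8)) ^ 4 / 16 ^ 4 / Y := by
            field_simp
        _ < 1 := by
            rw [div_lt_one (by linarith)]
            norm_num
            linarith
    exact lt_of_pow_lt_pow_left₀ 3 zero_le_one (by simpa using hF3)

end NumberedHypergraph

/-! ### The expressions of the program -/

namespace WordRAM

open NumberedHypergraph

open scoped Classical

/-- The number `1` for a true and `0` for a false proposition. -/
noncomputable def indicator (p : Prop) : ℕ := if p then 1 else 0

namespace Expr

/-- The number of vertices. -/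
def numVertices : Expr := inp (lit 0)

/-- The number of hyperedges. -/
def numEdges : Expr := inp (lit 1)

/-- Whether a number is positive. -/
def isPos (e : Expr) : Expr := op .lt (lit 0) e

/-- The address of node `i` of the linked list whose first address is the input word at `h`; it is
`0` if there are no more than `i` nodes. -/
def node (h : Expr) : ℕ → Expr
  | 0 => inp h
  | i + 1 => op .mul (inp (op .add (node h i) (lit 1))) (isPos (node h i))

/-- The address of node `j` of the list of the hyperedges that contain the vertex `v`. -/
def rowNode (v : Expr) (j : ℕ) : Expr := node (op .add (lit 2) v) j

/-- The address of node `i` of the list of the vertices of the hyperedge `e`. -/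
def colNode (e : Expr) (i : ℕ) : Expr := node (op .add (op .add (lit 2) numVertices) e) i

/-- Vertex number `i` of the hyperedge `e`. -/
def vertexOf (e : Expr) (i : ℕ) : Expr := inp (colNode e i)

/-- Hyperedge number `j` through the vertex `v`. -/
def edgeAt (v : Expr) (j : ℕ) : Expr := inp (rowNode v j)

/-- The random bit of the vertex `v` at time `j`. -/
def bit (v j : Expr) : Expr :=
  op .land (rnd (op .add v (op .mul numVertices j))) (lit 1)

/-- The sum of the values of `f i` for `i < n`. -/
def sumTo (f : ℕ → Expr) : ℕ → Expr
  | 0 => lit 0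
  | n + 1 => op .add (sumTo f n) (f n)

/-- Whether the hyperedge `e` is bad for the colouring at time `0`. -/
def isBad (k t : ℕ) (e : Expr) : Expr :=
  isPos (op .add (op .lt (sumTo (fun i => bit (vertexOf e i) (lit 0)) k) (lit t))
    (op .lt (lit k) (op .add (sumTo (fun i => bit (vertexOf e i) (lit 0)) k) (lit t))))

/-- Whether the vertex `v` is loose. -/
def isLoose (d k t : ℕ) (v : Expr) : Expr :=
  isPos (sumTo (fun j => op .mul (isPos (rowNode v j)) (isBad k t (edgeAt v j))) (d + 1))

/-- Whether the hyperedge `e` is affected. -/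
def isAffected (d k t : ℕ) (e : Expr) : Expr :=
  isPos (sumTo (fun i => isLoose d k t (vertexOf e i)) k)

/-- The present colour of the vertex `v`; the new colours of loose vertices are in array `3`. -/
def color (d k t : ℕ) (v : Expr) : Expr :=
  op .add (op .mul (isLoose d k t v) (get 3 v))
    (op .mul (op .eq (isLoose d k t v) (lit 0)) (bit v (lit 0)))

/-- Whether the hyperedge `e` is now monochromatic. -/
def isMono (d k t : ℕ) (e : Expr) : Expr :=
  isPos (op .add (op .eq (sumTo (fun i => color d k t (vertexOf e i)) k) (lit 0))
    (op .eq (sumTo (fun i => color d k t (vertexOf e i)) k) (lit k)))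

end Expr

/-- The expression `e` has the value `n`. -/
def Val {w : ℕ} (K : ℕ) (E : Env w) (σ : Store w) (e : Expr) (n : ℕ) : Prop :=
  e.eval K E σ = BitVec.ofNat w n

section Val

variable {w K : ℕ} {E : Env w} {σ : Store w} {a b : Expr} {x y : ℕ}

theorem Val.lit (n : ℕ) : Val K E σ (.lit n) n := rfl

theorem Val.add (ha : Val K E σ a x) (hb : Val K E σ b y) :
    Val K E σ (.op .add a b) (x + y) := by
  unfold Val at *
  rw [Expr.eval, ha, hb, BitVec.ofNat_add]; rfl

theorem Val.mul (ha : Val K E σ a x) (hb : Val K E σ b y) :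
    Val K E σ (.op .mul a b) (x * y) := by
  unfold Val at *
  rw [Expr.eval, ha, hb, BitVec.ofNat_mul]; rfl

theorem Val.zero_mul (ha : Val K E σ a 0) : Val K E σ (.op .mul a b) 0 := by
  unfold Val at *
  rw [Expr.eval, ha]
  simp [BinOp.eval]

theorem Val.lt (ha : Val K E σ a x) (hb : Val K E σ b y) (hx : x < 2 ^ w) (hy : y < 2 ^ w) :
    Val K E σ (.op .lt a b) (indicator (x < y)) := by
  unfold Val at *
  rw [Expr.eval, ha, hb, BinOp.eval, BitVec.toNat_ofNat, BitVec.toNat_ofNat, Nat.mod_eq_of_lt hx,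
    Nat.mod_eq_of_lt hy, indicator]
  split_ifs <;> rfl

theorem Val.eq (ha : Val K E σ a x) (hb : Val K E σ b y) (hx : x < 2 ^ w) (hy : y < 2 ^ w) :
    Val K E σ (.op .eq a b) (indicator (x = y)) := by
  unfold Val at *
  have : (BitVec.ofNat w x = BitVec.ofNat w y) ↔ x = y := by
    constructor
    · intro h
      have := congrArg BitVec.toNat h
      rwa [BitVec.toNat_ofNat, BitVec.toNat_ofNat, Nat.mod_eq_of_lt hx, Nat.mod_eq_of_lt hy] at this
    · rintro rfl; rfl
  rw [Expr.eval, ha, hb, BinOp.eval, indicator]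
  simp only [this]
  split_ifs <;> rfl

theorem Val.isPos (ha : Val K E σ a x) (hx : x < 2 ^ w) :
    Val K E σ a.isPos (indicator (0 < x)) := Val.lt (Val.lit 0) ha (by positivity) hx

theorem Val.inp (ha : Val K E σ a x) (hx : x < 2 ^ w) :
    Val K E σ (.inp a) (E.input.getD x 0) := by
  unfold Val at *
  rw [Expr.eval, ha, BitVec.toNat_ofNat, Nat.mod_eq_of_lt hx]

theorem Val.sumTo {f : ℕ → Expr} {F : ℕ → ℕ} {n : ℕ} (h : ∀ i < n, Val K E σ (f i) (F i)) :
    Val K E σ (Expr.sumTo f n) (∑ i ∈ Finset.range n, F i) := by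
  induction n with
  | zero => exact Val.lit 0
  | succ n ih =>
      rw [Finset.sum_range_succ]
      exact (ih fun i hi => h i (by omega)).add (h n (by omega))

theorem Val.congr (ha : Val K E σ a x) (h : x = y) : Val K E σ a y := h ▸ ha

theorem indicator_le_one (p : Prop) : indicator p ≤ 1 := by
  unfold indicator; split_ifs <;> omega

theorem indicator_pos {p : Prop} : 0 < indicator p ↔ p := by
  unfold indicator; split_ifs <;> simp_all

end Val

/-- The addresses of the nodes of the linked list that starts at address `p`. -/
def nodeAddress (a : List ℕ) (p : ℕ) : ℕ → ℕ
  | 0 => p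
  | i + 1 => if nodeAddress a p i = 0 then 0 else a.getD (nodeAddress a p i + 1) 0

theorem nodeAddress_succ' (a : List ℕ) {p : ℕ} (hp : p ≠ 0) (i : ℕ) :
    nodeAddress a p (i + 1) = nodeAddress a (a.getD (p + 1) 0) i := by
  induction i with
  | zero => simp [nodeAddress, hp]
  | succ i ih => rw [nodeAddress, ih, nodeAddress]

theorem nodeAddress_zero (a : List ℕ) (i : ℕ) : nodeAddress a 0 i = 0 := by
  induction i with
  | zero => rfl
  | succ i ih => rw [nodeAddress, if_pos ih]

/-- The nodes of a linked list hold its members, and the address `0` follows the last one, so that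
it is harmless to read beyond the end. -/
theorem nodeAddress_of_isLinkedList {a : List ℕ} {p : ℕ} {l : List ℕ} (h : IsLinkedList a p l) :
    (∀ i v, l[i]? = some v → nodeAddress a p i ≠ 0 ∧ a.getD (nodeAddress a p i) 0 = v) ∧
      ∀ i, l.length ≤ i → nodeAddress a p i = 0 := by
  induction l generalizing p with
  | nil =>
      obtain rfl : p = 0 := h
      exact ⟨by simp, fun i _ => nodeAddress_zero a i⟩
  | cons v l ih =>
      obtain ⟨hp, -, hv, hl⟩ := h
      obtain ⟨h1, h2⟩ := ih hl
      refine ⟨fun i u hi => ?_, fun i hi => ?_⟩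
      · cases i with
        | zero => simp only [List.getElem?_cons_zero, Option.some.injEq] at hi; exact ⟨hp, hi ▸ hv⟩
        | succ i => rw [nodeAddress_succ' a hp]; exact h1 i u (by simpa using hi)
      · cases i with
        | zero => simp at hi
        | succ i => rw [nodeAddress_succ' a hp]; exact h2 i (by simpa using hi)

/-- The random bits that the program uses. -/
def tapeBit {w : ℕ} (R : RandomTape w) (i : ℕ) : Bool := (R (BitVec.ofNat w i)).getLsbD 0

/-- The environment presents the hypergraph `x`, the arrays of the program are in its local memory
and long enough to be indexed by vertices, and all numbers that occur are words; the random bits are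
used up to time `J`. -/
structure Presents {d k : ℕ} (x : Instance d k) (t J : ℕ) {w : ℕ} (K : ℕ) (E : Env w) : Prop where
  input : E.input = x.array
  fits : E.Fits K
  le_length : k ≤ K
  big : 4 * (x.N * K) + x.array.length + x.m + x.N + d + k + t + J + x.m * (J + 1) + 4 < 2 ^ w

section

variable {d k t J w K : ℕ} {x : Instance d k} {E : Env w}

variable (x) in
/-- The colouring of the vertices by the random bits at time `j`. -/
def tapeColor (E : Env w) (j : ℕ) (v : Fin x.m) : Bool := tapeBit E.tape (v + x.m * j)

variable (h : Presents x t J K E) {σ : Store w}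

include h

theorem Presents.getD_lt (i : ℕ) : E.input.getD i 0 ≤ x.array.length := by
  rw [h.input, List.getD_eq_getElem?_getD]
  rcases lt_or_ge i x.array.length with hi | hi
  · rw [List.getElem?_eq_getElem hi]
    exact x.isArray.word_le _ (List.getElem_mem hi)
  · rw [List.getElem?_eq_none hi]; simp

theorem Presents.one_lt : 1 < 2 ^ w := by have := h.big; omega

theorem Presents.numVertices : Val K E σ .numVertices x.m := by
  refine ((Val.lit 0).inp (by positivity)).congr ?_
  rw [h.input, x.isArray.vertices]

theorem Presents.numEdges : Val K E σ .numEdges x.N := by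
  refine ((Val.lit 1).inp h.one_lt).congr ?_
  rw [h.input, x.isArray.hyperedges]

theorem Presents.node {a : Expr} {n : ℕ} (ha : Val K E σ a n) (hn : n < 2 ^ w) (i : ℕ) :
    Val K E σ (a.node i) (nodeAddress x.array (x.array.getD n 0) i) ∧
      nodeAddress x.array (x.array.getD n 0) i ≤ x.array.length := by
  have hb := h.big
  have hlt := h.getD_lt
  rw [h.input] at hlt
  induction i with
  | zero =>
      refine ⟨(ha.inp hn).congr (by rw [h.input]; rfl), hlt n⟩
  | succ i ih =>
      rw [nodeAddress]
      have h1 := (ih.1.add (Val.lit 1)).inp (by omega)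
      rw [h.input] at h1
      refine ⟨(h1.mul (ih.1.isPos (by omega))).congr ?_, ?_⟩
      · unfold indicator
        split_ifs <;> simp_all
      · split_ifs
        · exact Nat.zero_le _
        · exact hlt _

omit h in
variable (x) in
/-- The vertices of a hyperedge in the order of its linked list. -/
theorem exists_column (e : Fin x.N) : ∃ l : List (Fin x.m), l.Nodup ∧
    (∀ v, v ∈ l ↔ v ∈ x.graph.edge e) ∧ l.length = k ∧
    ∀ (i : ℕ) (v : Fin x.m), l[i]? = some v →
      nodeAddress x.array (x.array.getD (2 + x.m + e) 0) i ≠ 0 ∧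
      x.array.getD (nodeAddress x.array (x.array.getD (2 + x.m + e) 0) i) 0 = v := by
  obtain ⟨l, h1, h2, h3⟩ := x.isArray.column e
  refine ⟨l, h1, h2, ?_, fun i v hi => (nodeAddress_of_isLinkedList h3).1 i v (by simp [hi])⟩
  refine (List.toFinset_card_of_nodup h1).symm.trans
    ((congrArg Finset.card ?_).trans (x.uniform e))
  ext v
  simp [h2]

omit h in
variable (x) in
/-- The hyperedges that contain a vertex in the order of its linked list. -/
theorem exists_row (v : Fin x.m) : ∃ l : List (Fin x.N),
    (∀ e, e ∈ l ↔ v ∈ x.graph.edge e) ∧ l.length ≤ d + 1 ∧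
    (∀ (j : ℕ) (e : Fin x.N), l[j]? = some e → nodeAddress x.array (x.array.getD (2 + v) 0) j ≠ 0 ∧
      x.array.getD (nodeAddress x.array (x.array.getD (2 + v) 0) j) 0 = e) ∧
    ∀ j, l.length ≤ j → nodeAddress x.array (x.array.getD (2 + v) 0) j = 0 := by
  obtain ⟨l, h1, h2, h3⟩ := x.isArray.row v
  have h4 := nodeAddress_of_isLinkedList h3
  refine ⟨l, h2, ?_, fun j e hj => h4.1 j e (by simp [hj]), fun j hj => h4.2 j (by simpa using hj)⟩
  rw [← List.toFinset_card_of_nodup h1]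
  cases l with
  | nil => simp
  | cons e l =>
      refine (Finset.card_le_card ?_).trans (x.meets.card_le e)
      intro f hf
      rw [Finset.mem_filter]
      exact ⟨Finset.mem_univ _,
        x.graph.meets_of_mem ((h2 e).1 (by simp)) ((h2 f).1 (by simpa using hf))⟩

theorem Presents.vertexOf {a : Expr} {e : Fin x.N} (ha : Val K E σ a e) {l : List (Fin x.m)}
    (hl : ∀ (i : ℕ) (v : Fin x.m), l[i]? = some v →
      nodeAddress x.array (x.array.getD (2 + x.m + e) 0) i ≠ 0 ∧
      x.array.getD (nodeAddress x.array (x.array.getD (2 + x.m + e) 0) i) 0 = v)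
    {i : ℕ} {v : Fin x.m} (hi : l[i]? = some v) : Val K E σ (a.vertexOf i) v := by
  have hb := h.big
  have he := e.2
  have h1 := h.node (((Val.lit 2).add h.numVertices).add ha) (by omega) i
  refine (h1.1.inp (by omega)).congr ?_
  rw [h.input]
  exact (hl i v hi).2

theorem Presents.rowNode {a : Expr} {v : Fin x.m} (ha : Val K E σ a v) (j : ℕ) :
    Val K E σ (a.rowNode j).isPos
      (indicator (0 < nodeAddress x.array (x.array.getD (2 + v) 0) j)) ∧
    Val K E σ (a.edgeAt j) (x.array.getD (nodeAddress x.array (x.array.getD (2 + v) 0) j) 0) := by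
  have hb := h.big
  have hv := v.2
  have h1 := h.node ((Val.lit 2).add ha) (by omega) j
  refine ⟨h1.1.isPos (by omega), (h1.1.inp (by omega)).congr (by rw [h.input])⟩

omit h in
theorem sum_range_getElem? {α : Type*} (G : α → ℕ) {l : List α} {n : ℕ} (hn : l.length = n) :
    ∑ i ∈ Finset.range n, ((l[i]?).map G).getD 0 = (l.map G).sum := by
  induction l generalizing n with
  | nil => simp
  | cons a l ih =>
      subst hn
      rw [List.length_cons, Finset.sum_range_succ']
      simpa [add_comm] using ih rfl

/-- A sum over the vertices of a hyperedge. -/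
theorem Presents.sum_vertices {a : Expr} {e : Fin x.N} (ha : Val K E σ a e) {g : Expr → Expr}
    {G : Fin x.m → ℕ} (hg : ∀ b, ∀ v ∈ x.graph.edge e, Val K E σ b v → Val K E σ (g b) (G v)) :
    Val K E σ (Expr.sumTo (fun i => g (a.vertexOf i)) k) (∑ v ∈ x.graph.edge e, G v) := by
  obtain ⟨l, h1, h2, h3, h4⟩ := exists_column x e
  have hsum : ∑ v ∈ x.graph.edge e, G v = ∑ i ∈ Finset.range k, ((l[i]?).map G).getD 0 := by
    have : x.graph.edge e = l.toFinset := by ext v; simp [h2]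
    rw [this, List.sum_toFinset _ h1, sum_range_getElem? G h3]
  rw [hsum]
  refine Val.sumTo fun i hi => ?_
  rw [← h3] at hi
  have hv : l[i]? = some l[i] := List.getElem?_eq_getElem hi
  rw [hv]
  exact hg _ _ ((h2 _).1 (List.getElem_mem hi)) (h.vertexOf ha h4 hv)

omit h in
theorem Val.bit {a b : Expr} {v : Fin x.m} {j : ℕ} (hm : Val K E σ .numVertices x.m)
    (ha : Val K E σ a v) (hb : Val K E σ b j) :
    Val K E σ (a.bit b) (tapeColor x E j v).toNat := by
  have h1 := ha.add (hm.mul hb)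
  unfold Val at *
  rw [Expr.bit, Expr.eval, Expr.eval, Expr.eval, h1, BinOp.eval, tapeColor, tapeBit]
  generalize E.tape _ = r
  refine BitVec.eq_of_toNat_eq ?_
  rw [BitVec.getLsbD, Nat.testBit_zero]
  rcases Nat.eq_zero_or_pos w with rfl | hw
  · simp [BitVec.eq_nil r]
  · have h2 : 1 % 2 ^ w = 1 := Nat.mod_eq_of_lt (Nat.one_lt_two_pow hw.ne')
    rcases Nat.mod_two_eq_zero_or_one r.toNat with h3 | h3 <;>
      simp [h2, h3, Nat.and_one_is_mod]

theorem Presents.bit {a b : Expr} {v : Fin x.m} {j : ℕ} (ha : Val K E σ a v)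
    (hb : Val K E σ b j) : Val K E σ (a.bit b) (tapeColor x E j v).toNat :=
  Val.bit h.numVertices ha hb

omit h in
theorem sum_toNat_eq_card {α : Type*} [DecidableEq α] (A : Finset α) (c : α → Bool) :
    ∑ v ∈ A, (c v).toNat = (A.filter fun v => c v = true).card := by
  rw [Finset.card_filter]
  refine Finset.sum_congr rfl fun v _ => ?_
  cases c v <;> rfl

omit h in
theorem card_true_add_card_false {α : Type*} [DecidableEq α] (A : Finset α) (c : α → Bool) :
    (A.filter fun v => c v = true).card + (A.filter fun v => c v = false).card = A.card := by
  have := Finset.card_filter_add_card_filter_not (s := A) (fun v => c v = true)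
  simpa using this

theorem Presents.isBad {a : Expr} {e : Fin x.N} (ha : Val K E σ a e) :
    Val K E σ (a.isBad k t) (indicator (x.graph.IsBad t (tapeColor x E 0) e)) := by
  have hb := h.big
  have hS := h.sum_vertices ha (g := fun b => b.bit (.lit 0))
    (G := fun v => (tapeColor x E 0 v).toNat) fun b v _ hv => h.bit hv (Val.lit 0)
  rw [sum_toNat_eq_card] at hS
  have h1 := card_true_add_card_false (x.graph.edge e) (tapeColor x E 0)
  rw [x.uniform e] at h1
  have h2 := (hS.lt (Val.lit t) (by omega) (by omega)).add
    ((Val.lit k).lt (hS.add (Val.lit t)) (by omega) (by omega))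
  have h4 : ∀ p q : Prop, indicator p + indicator q < 2 ^ w := fun p q => by
    have := indicator_le_one p
    have := indicator_le_one q
    omega
  refine (h2.isPos (h4 _ _)).congr ?_
  congr 1
  rw [eq_iff_iff, Nat.add_pos_iff_pos_or_pos, indicator_pos, indicator_pos,
    NumberedHypergraph.IsBad, Bool.exists_bool, or_comm]
  refine or_congr ?_ Iff.rfl
  omega

theorem Presents.isLoose {a : Expr} {v : Fin x.m} (ha : Val K E σ a v) :
    Val K E σ (a.isLoose d k t) (indicator (v ∈ x.graph.loose t (tapeColor x E 0))) := by
  have hb := h.big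
  obtain ⟨l, h2, h3, h4, h5⟩ := exists_row x v
  set F : ℕ → ℕ := fun j => indicator (∃ e, l[j]? = some e ∧ x.graph.IsBad t (tapeColor x E 0) e)
    with hF
  have hval : ∀ j < d + 1,
      Val K E σ (.op .mul (a.rowNode j).isPos ((a.edgeAt j).isBad k t)) (F j) := by
    intro j hj
    obtain ⟨h6, h7⟩ := h.rowNode ha j
    rcases lt_or_ge j l.length with hjl | hjl
    · have he : l[j]? = some l[j] := List.getElem?_eq_getElem hjl
      obtain ⟨h8, h9⟩ := h4 j _ he
      rw [h9] at h7
      refine (h6.mul (h.isBad h7)).congr ?_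
      have h10 : indicator (0 < nodeAddress x.array (x.array.getD (2 + v) 0) j) = 1 :=
        if_pos (Nat.pos_of_ne_zero h8)
      rw [h10, one_mul]
      simp only [hF, he, Option.some.injEq, exists_eq_left']
    · rw [h5 j hjl, show indicator (0 < 0) = 0 from if_neg (lt_irrefl 0)] at h6
      refine (Val.zero_mul h6).congr ?_
      simp [hF, indicator, List.getElem?_eq_none hjl]
  have hsum := Val.sumTo hval
  have hle : ∑ j ∈ Finset.range (d + 1), F j ≤ d + 1 := by
    refine (Finset.sum_le_card_nsmul _ _ 1 fun j _ => indicator_le_one _).trans ?_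
    simp
  refine (hsum.isPos (by omega)).congr ?_
  congr 1
  rw [eq_iff_iff, pos_iff_ne_zero, Ne, Finset.sum_eq_zero_iff, NumberedHypergraph.loose,
    Finset.mem_filter]
  push Not
  simp only [Finset.mem_univ, true_and, Finset.mem_range, hF, ← pos_iff_ne_zero, indicator_pos]
  constructor
  · rintro ⟨j, -, e, he, hbad⟩
    exact ⟨e, (h2 e).1 (List.mem_of_getElem? he), hbad⟩
  · rintro ⟨e, he, hbad⟩
    obtain ⟨j, hj⟩ := List.mem_iff_getElem?.1 ((h2 e).2 he)
    have := (List.getElem?_eq_some_iff.1 hj).1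
    exact ⟨j, by omega, e, hj, hbad⟩

theorem Presents.isAffected {a : Expr} {e : Fin x.N} (ha : Val K E σ a e) :
    Val K E σ (a.isAffected d k t) (indicator (e ∈ x.graph.affected t (tapeColor x E 0))) := by
  have hb := h.big
  have hS := h.sum_vertices ha (g := fun b => b.isLoose d k t)
    (G := fun v => indicator (v ∈ x.graph.loose t (tapeColor x E 0))) fun b v _ hv => h.isLoose hv
  have hle : ∑ v ∈ x.graph.edge e, indicator (v ∈ x.graph.loose t (tapeColor x E 0)) ≤ k := by
    refine (Finset.sum_le_card_nsmul _ _ 1 fun j _ => indicator_le_one _).trans ?_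
    simp [x.uniform e]
  refine (hS.isPos (by omega)).congr ?_
  congr 1
  rw [eq_iff_iff, pos_iff_ne_zero, Ne, Finset.sum_eq_zero_iff, NumberedHypergraph.affected,
    Finset.mem_filter]
  push Not
  simp only [Finset.mem_univ, true_and, ← pos_iff_ne_zero, indicator_pos]

theorem Presents.color {a : Expr} {v : Fin x.m} (ha : Val K E σ a v) {s : Fin x.m → Bool}
    (hs : v ∈ x.graph.loose t (tapeColor x E 0) → Val K E σ (.get 3 a) (s v).toNat) :
    Val K E σ (a.color d k t) (x.graph.recolor t (tapeColor x E 0) s v).toNat := by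
  have h1 := h.isLoose ha
  have h2 := h.one_lt
  have h3 := h1.eq (Val.lit 0) ((indicator_le_one _).trans_lt h2) (by omega)
  by_cases hv : v ∈ x.graph.loose t (tapeColor x E 0)
  · have h4 : indicator (indicator (v ∈ x.graph.loose t (tapeColor x E 0)) = 0) = 0 := by
      simp [indicator, hv]
    rw [h4] at h3
    refine ((h1.mul (hs hv)).add (Val.zero_mul h3)).congr ?_
    simp [indicator, hv, recolor, splice]
  · have h4 : indicator (v ∈ x.graph.loose t (tapeColor x E 0)) = 0 := by simp [indicator, hv]
    rw [h4] at h1 h3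
    refine ((Val.zero_mul h1).add (h3.mul (h.bit ha (Val.lit 0)))).congr ?_
    simp [indicator, hv, recolor, splice]

theorem Presents.isMono {a : Expr} {e : Fin x.N} (ha : Val K E σ a e) {s : Fin x.m → Bool}
    (hs : ∀ b, ∀ v ∈ x.graph.edge e, Val K E σ b v → Val K E σ (.get 3 b) (s v).toNat) :
    Val K E σ (a.isMono d k t)
      (indicator (x.graph.IsMono (x.graph.recolor t (tapeColor x E 0) s) e)) := by
  have hb := h.big
  have hS := h.sum_vertices ha (g := fun b => b.color d k t)
    (G := fun v => (x.graph.recolor t (tapeColor x E 0) s v).toNat)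
    fun b v hv hbv => h.color hbv fun _ => hs b v hv hbv
  rw [sum_toNat_eq_card] at hS
  have h1 := card_true_add_card_false (x.graph.edge e) (x.graph.recolor t (tapeColor x E 0) s)
  have hk := x.uniform e
  have h2 := (hS.eq (Val.lit 0) (by omega) (by omega)).add (hS.eq (Val.lit k) (by omega) (by omega))
  have h4 : ∀ p q : Prop, indicator p + indicator q < 2 ^ w := fun p q => by
    have := indicator_le_one p
    have := indicator_le_one q
    omega
  refine (h2.isPos (h4 _ _)).congr ?_
  congr 1
  rw [eq_iff_iff, Nat.add_pos_iff_pos_or_pos, indicator_pos, indicator_pos,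
    NumberedHypergraph.IsMono, Bool.exists_bool]
  refine or_congr ?_ ?_
  · simp [Finset.filter_eq_empty_iff]
  · rw [← Finset.card_filter_eq_iff (s := x.graph.edge e)
      (p := fun v => x.graph.recolor t (tapeColor x E 0) s v = true)]
    exact ⟨fun h => h.trans hk.symm, fun h => h.trans hk⟩

end

end WordRAM

/-! ### The program -/

namespace WordRAM

open NumberedHypergraph

open scoped Classical

namespace Stmt

/-- The statements `f 0, …, f (n - 1)`, one after the other. -/
def seqN : ℕ → (ℕ → Stmt) → Stmt
  | 0, _ => skip
  | n + 1, f => seq (seqN n f) (f n)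

section

variable (d k t : ℕ)

/-- Execute `body` with each affected hyperedge through the vertex in variable `4`, in variable
`5`. -/
def forRow (body : Stmt) : Stmt :=
  seqN (d + 1) fun j =>
    ite (.isPos (.rowNode (.var 4) j))
      (seq (assign 5 (.edgeAt (.var 4) j)) (ite (.isAffected d k t (.var 5)) body skip)) skip

/-- Execute `body` with each affected hyperedge that meets the hyperedge in variable `3`, in
variable `5`. -/
def forMeeting (body : Stmt) : Stmt :=
  seqN k fun i => seq (assign 4 (.vertexOf (.var 3) i)) (forRow d k t body)

/-- For each vertex `v` of the hyperedge in variable `i`, write its random bit at time `j` into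
entry `v` of array `3`. -/
def refresh (i : ℕ) (j : Expr) : Stmt :=
  seqN k fun l => put 3 (.vertexOf (.var i) l) (.bit (.vertexOf (.var i) l) j)

/-- Append the hyperedge in variable `5` to the queue in array `0`, of length variable `1`, unless
it is there. Array `1` has the positions in the queue; its entries are garbage for hyperedges that
are not in the queue, and so they are checked against array `0`. -/
def enqueue : Stmt :=
  ite (.op .mul (.op .lt (.get 1 (.var 5)) (.var 1))
      (.op .eq (.get 0 (.get 1 (.var 5))) (.var 5)))
    skip
    (seq (put 0 (.var 1) (.var 5)) (seq (put 1 (.var 5) (.var 1)) (seq (put 2 (.var 5) (.lit 1))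
      (seq (refresh k 5 (.lit 1)) (assign 1 (.op .add (.var 1) (.lit 1)))))))

/-- Enqueue the affected hyperedges that meet the next hyperedge of the queue. -/
def exploreStep : Stmt :=
  ite (.op .lt (.var 2) (.var 1))
    (seq (assign 3 (.get 0 (.var 2)))
      (seq (forMeeting d k t (enqueue k)) (assign 2 (.op .add (.var 2) (.lit 1)))))
    skip

/-- Put the component of the vertex in variable `0` into the queue, if it has at most
`n * Nat.size N` hyperedges. -/
def explore (n : ℕ) : Stmt :=
  seq (assign 1 (.lit 0)) (seq (assign 2 (.lit 0)) (seq (assign 4 (.var 0))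
    (seq (forRow d k t (enqueue k)) (loop (seqN n fun _ => exploreStep d k t)))))

/-- Compare the least pending hyperedge so far, in variable `7`, with the next one of the queue.
Array `2` has a `1` for the pending hyperedges of the queue and a `0` for the others. -/
def findStep : Stmt :=
  ite (.op .lt (.var 2) (.var 1))
    (seq
      (ite (.op .mul (.get 2 (.get 0 (.var 2))) (.op .lt (.get 0 (.var 2)) (.var 7)))
        (assign 7 (.get 0 (.var 2))) skip)
      (assign 2 (.op .add (.var 2) (.lit 1))))
    skip

/-- Put the least pending hyperedge into variable `7`, or `N` if there is none. -/
def find (n : ℕ) : Stmt :=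
  seq (assign 7 .numEdges) (seq (assign 2 (.lit 0)) (loop (seqN n fun _ => findStep)))

/-- A step of the repair, with the random bits of the time in variable `6`. -/
def fixStep (n : ℕ) : Stmt :=
  seq (find n) (seq
    (ite (.op .lt (.var 7) .numEdges)
      (ite (.isMono d k t (.var 7))
        (seq (refresh k 7 (.var 6))
          (seq (assign 3 (.var 7)) (forMeeting d k t (put 2 (.var 5) (.lit 1)))))
        (put 2 (.var 7) (.lit 0)))
      skip)
    (assign 6 (.op .add (.var 6) (.lit 1))))

/-- Compute the colour of the vertex in variable `0`: find its component, repair it for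
`n' * Nat.size N` steps, and look up the colour. -/
def colorQuery (n n' : ℕ) : Stmt :=
  seq (explore d k t n) (seq (assign 6 (.lit 2)) (seq
    (loop (seqN n' fun _ => fixStep d k t n)) (assign 0 (.color d k t (.var 0)))))

end

/-- The statement does not assign to variable `i`. -/
def Keeps (i : ℕ) : Stmt → Prop
  | skip => True
  | assign j _ => i ≠ j
  | put _ _ _ => True
  | seq s₁ s₂ => s₁.Keeps i ∧ s₂.Keeps i
  | ite _ s₁ s₂ => s₁.Keeps i ∧ s₂.Keeps i
  | loop s => s.Keeps i

section

variable {w K : ℕ} {E : Env w}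

theorem Keeps.var_eq {i : ℕ} {s : Stmt} (hs : s.Keeps i) (σ : Store w) :
    (s.exec K E σ).var i = σ.var i := by
  induction s generalizing σ with
  | skip => rfl
  | assign j e => exact Function.update_of_ne hs _ _
  | put => rfl
  | seq s₁ s₂ ih₁ ih₂ => exact (ih₂ hs.2 _).trans (ih₁ hs.1 _)
  | ite e s₁ s₂ ih₁ ih₂ =>
      rw [exec]
      split_ifs
      · exact ih₂ hs.2 _
      · exact ih₁ hs.1 _
  | loop s ih =>
      rw [exec]
      induction E.iterations generalizing σ with
      | zero => rfl
      | succ n ihn => exact (ihn _).trans (ih hs _)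

theorem keeps_seqN {i n : ℕ} {f : ℕ → Stmt} (h : ∀ j, (f j).Keeps i) : (seqN n f).Keeps i := by
  induction n with
  | zero => trivial
  | succ n ih => exact ⟨ih, h n⟩

theorem keeps_forMeeting {d k t i : ℕ} {s : Stmt} (hs : s.Keeps i) (h4 : i ≠ 4) (h5 : i ≠ 5) :
    (forMeeting d k t s).Keeps i :=
  keeps_seqN fun _ => ⟨h4, keeps_seqN fun _ => ⟨⟨h5, hs, trivial⟩, trivial⟩⟩

theorem keeps_enqueue {k i : ℕ} (hi : i ≠ 1) : (enqueue k).Keeps i :=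
  ⟨trivial, trivial, trivial, trivial, keeps_seqN fun _ => trivial, hi⟩

theorem exec_seqN_const (s : Stmt) (n : ℕ) (σ : Store w) :
    (seqN n fun _ => s).exec K E σ = (s.exec K E)^[n] σ := by
  induction n with
  | zero => rfl
  | succ n ih => rw [seqN, exec, ih, Function.iterate_succ_apply']

theorem exec_loop_seqN (s : Stmt) (n : ℕ) (σ : Store w) :
    (loop (seqN n fun _ => s)).exec K E σ = (s.exec K E)^[n * E.iterations] σ := by
  rw [exec, Function.iterate_mul]
  congr 1
  funext τ
  exact exec_seqN_const s n τ

theorem exec_ite_indicator {e : Expr} {σ : Store w} {p : Prop} (h : Val K E σ e (indicator p))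
    (hw : 1 < 2 ^ w) (s₁ s₂ : Stmt) :
    (ite e s₁ s₂).exec K E σ = if p then s₁.exec K E σ else s₂.exec K E σ := by
  rw [exec, h, indicator]
  by_cases hp : p
  · have : BitVec.ofNat w 1 ≠ 0#w := fun h => by
      have := congrArg BitVec.toNat h
      simp [Nat.mod_eq_of_lt hw] at this
    simp [hp, this]
  · simp [hp]

end

end Stmt

/-! ### Arrays in local memory -/

section

variable {w : ℕ}

/-- Entry `i` of array `t` is `n`. -/
def Entry (K : ℕ) (E : Env w) (M : Memory w) (t : Fin 4) (i n : ℕ) : Prop :=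
  M (cell K E t (BitVec.ofNat w i)) = BitVec.ofNat w n

/-- The memory with entry `i` of array `t` set to `n`. -/
def setEntry (K : ℕ) (E : Env w) (M : Memory w) (t : Fin 4) (i n : ℕ) : Memory w :=
  Function.update M (cell K E t (BitVec.ofNat w i)) (BitVec.ofNat w n)

variable {K : ℕ} {E : Env w} {M : Memory w} {σ : Store w} {s t : Fin 4} {i j n n' : ℕ}

theorem Val.get {a : Expr} (ha : Val K E σ a i) (h : Entry K E σ.mem t i n) :
    Val K E σ (.get t a) n := by
  unfold Val Entry at *
  rw [Expr.eval, ha, h]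

theorem exec_put {a e : Expr} (ha : Val K E σ a i) (he : Val K E σ e n) :
    (Stmt.put t a e).exec K E σ = ⟨σ.var, setEntry K E σ.mem t i n⟩ := by
  unfold Val at *
  rw [Stmt.exec, ha, he]
  rfl

theorem entry_setEntry_self : Entry K E (setEntry K E M t i n) t i n := by
  simp [Entry, setEntry]

theorem Entry.setEntry (h : Entry K E M s j n') (hF : E.Fits K)
    (hi : i < E.input.getD 1 0 * K) (hj : j < E.input.getD 1 0 * K) (hne : s ≠ t ∨ j ≠ i) :
    Entry K E (setEntry K E M t i n) s j n' := by
  have hlt := hF.lt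
  rw [Entry, WordRAM.setEntry, Function.update_of_ne]
  · exact h
  · intro heq
    have := congrArg BitVec.toNat heq
    rw [cell_toNat hF, cell_toNat hF, BitVec.toNat_ofNat, BitVec.toNat_ofNat,
      Nat.mod_eq_of_lt (a := i) (by omega), Nat.mod_eq_of_lt (a := j) (by omega),
      Nat.mod_eq_of_lt hi, Nat.mod_eq_of_lt hj] at this
    have hs := s.2
    have ht := t.2
    rcases hne with hne | hne
    · exact hne (Fin.ext (by omega))
    · omega

end

section

variable {d k t J w K : ℕ} {x : Instance d k} {E : Env w} (h : Presents x t J K E)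

include h

theorem Presents.getD_one : E.input.getD 1 0 = x.N := by rw [h.input, x.isArray.hyperedges]

theorem Presents.edge_lt (e : Fin x.N) : (e : ℕ) < E.input.getD 1 0 * K := by
  rw [h.getD_one]
  exact e.2.trans_le (Nat.le_mul_of_pos_right _ h.fits.pos_length)

theorem Presents.vertex_lt (v : Fin x.m) : (v : ℕ) < E.input.getD 1 0 * K := by
  rw [h.getD_one, mul_comm]
  exact v.2.trans_le (x.m_le.trans (Nat.mul_le_mul_right _ h.le_length))

theorem Presents.edge_lt_two_pow (e : Fin x.N) : (e : ℕ) < 2 ^ w := by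
  have := h.big
  omega

/-! ### Iteration over neighbours -/

/-- A rule for the iteration over the affected hyperedges at a vertex: `I X σ` is an invariant, in
which `X` is the set of hyperedges that have been dealt with. -/
theorem Presents.forRow_correct {body : Stmt} {I : Set (Fin x.N) → Store w → Prop}
    (h4 : body.Keeps 4)
    (hI : ∀ X σ b, I X σ → I X ⟨Function.update σ.var 5 b, σ.mem⟩)
    (hbody : ∀ X σ, ∀ f ∈ x.graph.affected t (tapeColor x E 0), I X σ → Val K E σ (.var 5) f →
      I (insert f X) (body.exec K E σ))
    {X : Set (Fin x.N)} {σ : Store w} (hσ : I X σ) {v : Fin x.m} (hv : Val K E σ (.var 4) v) :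
    I (X ∪ {f | f ∈ x.graph.affected t (tapeColor x E 0) ∧ v ∈ x.graph.edge f})
        ((Stmt.forRow d k t body).exec K E σ) := by
  obtain ⟨l, h1, h2, h3, h5⟩ := exists_row x v
  have key : ∀ n, Val K E ((Stmt.seqN n fun j =>
      .ite (.isPos (.rowNode (.var 4) j)) (.seq (.assign 5 (.edgeAt (.var 4) j))
        (.ite (.isAffected d k t (.var 5)) body .skip)) .skip).exec K E σ) (.var 4) v ∧
      I (X ∪ {f | f ∈ x.graph.affected t (tapeColor x E 0) ∧ ∃ j < n, l[j]? = some f})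
      ((Stmt.seqN n fun j => .ite (.isPos (.rowNode (.var 4) j))
        (.seq (.assign 5 (.edgeAt (.var 4) j))
        (.ite (.isAffected d k t (.var 5)) body .skip)) .skip).exec K E σ) := by
    intro n
    induction n with
    | zero => exact ⟨hv, by simpa [Stmt.seqN, Stmt.exec] using hσ⟩
    | succ n ih =>
        obtain ⟨ih1, ih2⟩ := ih
        rw [Stmt.seqN, Stmt.exec]
        refine ⟨(Stmt.Keeps.var_eq (i := 4) (s := .ite (.isPos (.rowNode (.var 4) n))
          (.seq (.assign 5 (.edgeAt (.var 4) n)) (.ite (.isAffected d k t (.var 5)) body .skip))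
          .skip) ⟨⟨(by decide : 4 ≠ 5), h4, trivial⟩, trivial⟩ _).trans ih1, ?_⟩
        generalize Stmt.exec K E (Stmt.seqN n _) σ = τ at ih1 ih2
        obtain ⟨r1, r2⟩ := h.rowNode ih1 n
        rw [Stmt.exec_ite_indicator r1 h.one_lt]
        rcases lt_or_ge n l.length with hn | hn
        · have he : l[n]? = some l[n] := List.getElem?_eq_getElem hn
          obtain ⟨h6, h7⟩ := h3 n _ he
          rw [if_pos (Nat.pos_of_ne_zero h6), Stmt.exec]
          rw [h7] at r2
          have h8 : (Stmt.assign 5 (.edgeAt (.var 4) n)).exec K E τ =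
            ⟨Function.update τ.var 5 (BitVec.ofNat w l[n]), τ.mem⟩ := by
            rw [Stmt.exec, r2]
          rw [h8]
          have h9 : Val K E ⟨Function.update τ.var 5 (BitVec.ofNat w l[n]), τ.mem⟩ (.var 5)
              l[n] := by
            simp [Val, Expr.eval]
          rw [Stmt.exec_ite_indicator (h.isAffected h9) h.one_lt]
          have h10 := hI _ _ (BitVec.ofNat w l[n]) ih2
          split_ifs with ha
          · convert hbody _ _ _ ha h10 h9 using 1
            ext f
            simp only [Set.mem_union, Set.mem_ofPred_eq, Set.mem_insert_iff,
              Nat.lt_succ_iff_lt_or_eq]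
            constructor
            · rintro (hf | ⟨hf, j, hj | rfl, hjf⟩)
              · exact Or.inr (Or.inl hf)
              · exact Or.inr (Or.inr ⟨hf, j, hj, hjf⟩)
              · rw [he] at hjf
                exact Or.inl (Option.some.inj hjf).symm
            · rintro (rfl | hf | ⟨hf, j, hj, hjf⟩)
              · exact Or.inr ⟨ha, n, Or.inr rfl, he⟩
              · exact Or.inl hf
              · exact Or.inr ⟨hf, j, Or.inl hj, hjf⟩
          · rw [Stmt.exec]
            convert h10 using 3
            ext f
            simp only [Nat.lt_succ_iff_lt_or_eq]
            refine and_congr_right fun hf => ⟨?_, fun ⟨j, hj, hjf⟩ => ⟨j, Or.inl hj, hjf⟩⟩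
            rintro ⟨j, hj | rfl, hjf⟩
            · exact ⟨j, hj, hjf⟩
            · rw [he] at hjf
              exact absurd (Option.some.inj hjf ▸ hf) ha
        · rw [if_neg (by rw [h5 n hn]; exact lt_irrefl 0), Stmt.exec]
          convert ih2 using 3
          ext f
          simp only [Nat.lt_succ_iff_lt_or_eq]
          refine and_congr_right fun hf => ⟨?_, fun ⟨j, hj, hjf⟩ => ⟨j, Or.inl hj, hjf⟩⟩
          rintro ⟨j, hj | rfl, hjf⟩
          · exact ⟨j, hj, hjf⟩
          · rw [List.getElem?_eq_none hn] at hjf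
            cases hjf
  rw [Stmt.forRow]
  convert (key (d + 1)).2 using 3
  ext f
  refine and_congr_right fun hf => ?_
  rw [← h1, List.mem_iff_getElem?]
  constructor
  · rintro ⟨j, hj⟩
    have := (List.getElem?_eq_some_iff.1 hj).1
    exact ⟨j, by omega, hj⟩
  · rintro ⟨j, -, hj⟩
    exact ⟨j, hj⟩

/-- A statement that is unrolled over the vertices of a hyperedge. -/
theorem Presents.forVertices_correct {f : ℕ → Stmt} {I : Set (Fin x.m) → Store w → Prop}
    {a : Expr} {e : Fin x.N} (ha : ∀ X σ, I X σ → Val K E σ a e)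
    (hf : ∀ X σ i, ∀ v ∈ x.graph.edge e, I X σ → Val K E σ (a.vertexOf i) v →
      I (insert v X) ((f i).exec K E σ))
    {σ : Store w} (hσ : I ∅ σ) : I (x.graph.edge e) ((Stmt.seqN k f).exec K E σ) := by
  obtain ⟨l, h1, h2, h3, h4⟩ := exists_column x e
  have key : ∀ n ≤ k, I {v | ∃ j < n, l[j]? = some v} ((Stmt.seqN n f).exec K E σ) := by
    intro n
    induction n with
    | zero => intro _; simpa [Stmt.seqN, Stmt.exec] using hσ
    | succ n ih =>
        intro hn
        replace ih := ih (by omega)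
        rw [Stmt.seqN, Stmt.exec]
        have he : l[n]? = some l[n] := List.getElem?_eq_getElem (by omega)
        convert hf _ _ n _ ((h2 l[n]).1 (List.getElem_mem _)) ih
          (h.vertexOf (ha _ _ ih) h4 he) using 1
        ext v
        simp only [Set.mem_ofPred_eq, Set.mem_insert_iff, Nat.lt_succ_iff_lt_or_eq]
        constructor
        · rintro ⟨j, hj | rfl, hjv⟩
          · exact Or.inr ⟨j, hj, hjv⟩
          · rw [he] at hjv
            exact Or.inl (Option.some.inj hjv).symm
        · rintro (rfl | ⟨j, hj, hjv⟩)
          · exact ⟨n, Or.inr rfl, he⟩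
          · exact ⟨j, Or.inl hj, hjv⟩
  convert key k le_rfl using 1
  ext v
  rw [Finset.mem_coe, ← h2, List.mem_iff_getElem?]
  constructor
  · rintro ⟨j, hj⟩
    have := (List.getElem?_eq_some_iff.1 hj).1
    exact ⟨j, by omega, hj⟩
  · rintro ⟨j, -, hj⟩
    exact ⟨j, hj⟩

/-- A rule for the iteration over the affected hyperedges that meet a hyperedge: `I X σ` is an
invariant, in which `X` is the set of hyperedges that have been dealt with. -/
theorem Presents.forMeeting_correct {body : Stmt} {I : Set (Fin x.N) → Store w → Prop}
    (h3 : body.Keeps 3) (h4 : body.Keeps 4)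
    (hI : ∀ X σ b, I X σ → I X ⟨Function.update σ.var 5 b, σ.mem⟩)
    (hI' : ∀ X σ b, I X σ → I X ⟨Function.update σ.var 4 b, σ.mem⟩)
    (hbody : ∀ X σ, ∀ f ∈ x.graph.affected t (tapeColor x E 0), I X σ → Val K E σ (.var 5) f →
      I (insert f X) (body.exec K E σ))
    {X : Set (Fin x.N)} {σ : Store w} (hσ : I X σ) {e : Fin x.N} (he : Val K E σ (.var 3) e) :
    I (X ∪ {f | f ∈ x.graph.affected t (tapeColor x E 0) ∧ x.graph.Meets e f})
        ((Stmt.forMeeting d k t body).exec K E σ) := by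
  have := (h.forVertices_correct (a := .var 3) (e := e) (σ := σ)
    (f := fun i => .seq (.assign 4 (.vertexOf (.var 3) i)) (.forRow d k t body))
    (I := fun Y τ => Val K E τ (.var 3) e ∧
      I (X ∪ {f | f ∈ x.graph.affected t (tapeColor x E 0) ∧ ∃ v ∈ Y, v ∈ x.graph.edge f}) τ)
    (fun Y τ hτ => hτ.1) ?_ ⟨he, by simpa using hσ⟩).2
  · rw [Stmt.forMeeting]
    convert this using 5
    rw [NumberedHypergraph.Meets, Finset.Nonempty]
    simp
  · rintro Y τ i v - ⟨hτ, hIτ⟩ hval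
    rw [Stmt.exec]
    have h8 : (Stmt.assign 4 (.vertexOf (.var 3) i)).exec K E τ =
        ⟨Function.update τ.var 4 (BitVec.ofNat w v), τ.mem⟩ := by
      rw [Stmt.exec, hval]
    rw [h8]
    refine ⟨?_, ?_⟩
    · refine (Stmt.Keeps.var_eq (i := 3) (s := .forRow d k t body) (Stmt.keeps_seqN fun _ =>
        show Stmt.Keeps 3 (.ite _ (.seq (.assign 5 _) (.ite _ body .skip)) .skip) from
          ⟨⟨(by decide : 3 ≠ 5), h3, trivial⟩, trivial⟩) _).trans ?_
      simpa [Val, Expr.eval] using hτ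
    · convert h.forRow_correct h4 hI hbody (hI' _ _ (BitVec.ofNat w v) hIτ) (v := v)
        (by simp [Val, Expr.eval]) using 1
      rw [Set.union_assoc]
      congr 1
      ext f
      simp only [Set.mem_ofPred_eq, Set.mem_insert_iff, Set.mem_union, exists_eq_or_imp]
      rw [← and_or_left, or_comm]

/-- The effect of `refresh` on array `3`. -/
theorem Presents.refresh_correct {i j : ℕ} {jx : Expr} {σ : Store w} {e : Fin x.N}
    (he : Val K E σ (.var i) e) (hj : ∀ M, Val K E ⟨σ.var, M⟩ jx j) :
    ((Stmt.refresh k i jx).exec K E σ).var = σ.var ∧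
    (∀ v ∈ x.graph.edge e, Entry K E ((Stmt.refresh k i jx).exec K E σ).mem 3 v
      (tapeColor x E j v).toNat) ∧
    (∀ v : Fin x.m, v ∉ x.graph.edge e → ∀ n, Entry K E σ.mem 3 v n →
      Entry K E ((Stmt.refresh k i jx).exec K E σ).mem 3 v n) ∧
    ∀ s ≠ 3, ∀ l < E.input.getD 1 0 * K, ∀ n, Entry K E σ.mem s l n →
      Entry K E ((Stmt.refresh k i jx).exec K E σ).mem s l n := by
  have := h.forVertices_correct (a := .var i) (e := e) (σ := σ)
    (f := fun l => .put 3 (.vertexOf (.var i) l) (.bit (.vertexOf (.var i) l) jx))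
    (I := fun Y τ => τ.var = σ.var ∧
      (∀ v ∈ Y, Entry K E τ.mem 3 v (tapeColor x E j v).toNat) ∧
      (∀ v : Fin x.m, v ∉ Y → ∀ n, Entry K E σ.mem 3 v n → Entry K E τ.mem 3 v n) ∧
      ∀ s ≠ 3, ∀ l < E.input.getD 1 0 * K, ∀ n, Entry K E σ.mem s l n → Entry K E τ.mem s l n)
    (fun Y τ hτ => by rw [Val, Expr.eval, hτ.1]; exact he) ?_
    ⟨rfl, by simp, fun _ _ _ h => h, fun _ _ _ _ _ h => h⟩
  · exact this
  · rintro Y τ l v - ⟨g1, g2, g3, g4⟩ hval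
    have hj' : Val K E τ jx j := by
      have := hj τ.mem
      rwa [← g1] at this
    rw [exec_put hval (h.bit hval hj')]
    refine ⟨g1, ?_, ?_, ?_⟩
    · rintro u (rfl | hu)
      · exact entry_setEntry_self
      · by_cases huv : u = v
        · subst huv; exact entry_setEntry_self
        · exact (g2 u hu).setEntry h.fits (h.vertex_lt v) (h.vertex_lt u)
            (Or.inr fun h => huv (Fin.ext h))
    · intro u hu n hn
      rw [Set.mem_insert_iff, not_or] at hu
      exact (g3 u hu.2 n hn).setEntry h.fits (h.vertex_lt v) (h.vertex_lt u)
            (Or.inr fun h => hu.1 (Fin.ext h))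
    · intro s hs l hl n hn
      exact (g4 s hs l hl n hn).setEntry h.fits (h.vertex_lt v) hl (Or.inl hs)

end

end WordRAM

/-! ### Correctness of the program -/

namespace WordRAM

open NumberedHypergraph

open scoped Classical

section

variable {d k w : ℕ} {x : Instance d k}

/-- The queue in array `0` is `l`. For the hyperedges of the queue, array `2` tells whether they are
in `P`, and array `3` has the colours `s` of their vertices. -/
structure QueueState (K : ℕ) (E : Env w) (l : List (Fin x.N)) (P : Set (Fin x.N))
    (s : Fin x.m → Bool) (σ : Store w) : Prop where
  nodup : l.Nodup
  length : Val K E σ (.var 1) l.length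
  queue : ∀ (i : ℕ) e, l[i]? = some e → Entry K E σ.mem 0 i e
  pending : ∀ e ∈ l, Entry K E σ.mem 2 e (indicator (e ∈ P))
  colors : ∀ e ∈ l, ∀ v ∈ x.graph.edge e, Entry K E σ.mem 3 v (s v).toNat

/-- Moreover all hyperedges of the queue are pending, with the colours at time `1`, and array `1`
has their positions in the queue. -/
structure Explored (K : ℕ) (E : Env w) (l : List (Fin x.N)) (σ : Store w) : Prop extends
    QueueState K E l Set.univ (tapeColor x E 1) σ where
  position : ∀ (i : ℕ) e, l[i]? = some e → Entry K E σ.mem 1 e i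

variable {t J K : ℕ} {E : Env w} {l : List (Fin x.N)} {P : Set (Fin x.N)} {s : Fin x.m → Bool}
  {σ : Store w}

theorem QueueState.length_le (hσ : QueueState K E l P s σ) : l.length ≤ x.N := by
  simpa using hσ.nodup.length_le_card

theorem QueueState.of_eq (hσ : QueueState K E l P s σ) {τ : Store w} (hm : τ.mem = σ.mem)
    (hv : τ.var 1 = σ.var 1) : QueueState K E l P s τ where
  nodup := hσ.nodup
  length := by rw [Val, Expr.eval, hv]; exact hσ.length
  queue := by rw [hm]; exact hσ.queue
  pending := by rw [hm]; exact hσ.pending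
  colors := by rw [hm]; exact hσ.colors

theorem QueueState.update (hσ : QueueState K E l P s σ) {i : ℕ} (hi : 1 ≠ i) (b : BitVec w) :
    QueueState K E l P s ⟨Function.update σ.var i b, σ.mem⟩ :=
  hσ.of_eq rfl (Function.update_of_ne hi _ _)

theorem QueueState.congr (hσ : QueueState K E l P s σ) {Q : Set (Fin x.N)}
    (h : ∀ e ∈ l, e ∈ P ↔ e ∈ Q) : QueueState K E l Q s σ where
  __ := hσ
  pending e he := by
    have := hσ.pending e he
    rwa [propext (h e he)] at this

theorem Explored.update (hσ : Explored K E l σ) {i : ℕ} (hi : 1 ≠ i) (b : BitVec w) :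
    Explored K E l ⟨Function.update σ.var i b, σ.mem⟩ :=
  ⟨hσ.toQueueState.update hi b, hσ.position⟩

theorem exec_assign {i n : ℕ} {e : Expr} (h : Val K E σ e n) :
    (Stmt.assign i e).exec K E σ = ⟨Function.update σ.var i (BitVec.ofNat w n), σ.mem⟩ := by
  rw [Stmt.exec, h]

theorem val_update_self {i n : ℕ} {g : ℕ → BitVec w} {M : Memory w} :
    Val K E ⟨Function.update g i (BitVec.ofNat w n), M⟩ (.var i) n := by
  simp [Val, Expr.eval]

theorem val_update_of_ne {i j n : ℕ} {g : ℕ → BitVec w} {b : BitVec w} {M : Memory w}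
    (h : g j = BitVec.ofNat w n) (hne : j ≠ i) :
    Val K E ⟨Function.update g i b, M⟩ (.var j) n :=
  (Function.update_of_ne hne _ _).trans h

theorem Stmt.Keeps.val {i n : ℕ} {s : Stmt} (hs : s.Keeps i) (h : Val K E σ (.var i) n) :
    Val K E (s.exec K E σ) (.var i) n := (hs.var_eq σ).trans h

variable (h : Presents x t J K E)

include h

theorem Presents.enqueue_correct (hσ : Explored K E l σ) {f : Fin x.N}
    (hf : Val K E σ (.var 5) f) :
    Explored K E (if f ∈ l then l else l ++ [f]) ((Stmt.enqueue k).exec K E σ) := by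
  have hb := h.big
  have hlen := hσ.length_le
  have hcond : Val K E σ (.op .mul (.op .lt (.get 1 (.var 5)) (.var 1))
      (.op .eq (.get 0 (.get 1 (.var 5))) (.var 5))) (indicator (f ∈ l)) := by
    by_cases hfl : f ∈ l
    · obtain ⟨i, hi⟩ := List.mem_iff_getElem?.1 hfl
      have hil := (List.getElem?_eq_some_iff.1 hi).1
      have h1 : Val K E σ (.get 1 (.var 5)) i := hf.get (hσ.position i f hi)
      have h2 : Val K E σ (.get 0 (.get 1 (.var 5))) f := h1.get (hσ.queue i f hi)
      refine ((h1.lt hσ.length (by omega) (by omega)).mul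
        (h2.eq hf (h.edge_lt_two_pow f) (h.edge_lt_two_pow f))).congr ?_
      simp [indicator, hil, hfl]
    · set g := (σ.mem (cell K E 1 (BitVec.ofNat w f))).toNat with hg
      have h1 : Val K E σ (.get 1 (.var 5)) g := hf.get (by simp [Entry, hg])
      have hgw : g < 2 ^ w := BitVec.isLt _
      have h3 := h1.lt hσ.length hgw (by omega)
      have h4 : indicator (f ∈ l) = 0 := if_neg hfl
      rw [h4]
      by_cases hgl : g < l.length
      · have hi : l[g]? = some l[g] := List.getElem?_eq_getElem hgl
        have h2 : Val K E σ (.get 0 (.get 1 (.var 5))) l[g] := h1.get (hσ.queue g _ hi)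
        refine (h3.mul (h2.eq hf (h.edge_lt_two_pow _) (h.edge_lt_two_pow f))).congr ?_
        have : (l[g] : ℕ) ≠ f := fun he => hfl (Fin.ext he ▸ List.getElem_mem hgl)
        simp [indicator, this]
      · have : indicator (g < l.length) = 0 := if_neg hgl
        rw [this] at h3
        exact Val.zero_mul h3
  rw [Stmt.enqueue, Stmt.exec_ite_indicator hcond h.one_lt]
  split_ifs with hfl
  · exact hσ
  have hnd : (l ++ [f]).Nodup := by
    rw [List.nodup_append]
    refine ⟨hσ.nodup, by simp, fun a ha b hb => ?_⟩
    rintro rfl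
    exact hfl (by simpa using List.mem_singleton.1 hb ▸ ha)
  have hlt : l.length < x.N := by
    have := hnd.length_le_card
    simpa using this
  have hlen' : l.length < E.input.getD 1 0 * K := h.edge_lt ⟨l.length, hlt⟩
  rw [Stmt.exec, exec_put hσ.length hf, Stmt.exec, exec_put (by exact hf) (by exact hσ.length),
    Stmt.exec, exec_put (by exact hf) (Val.lit 1), Stmt.exec]
  set M := setEntry K E (setEntry K E (setEntry K E σ.mem 0 l.length f) 1 f l.length) 2 f 1 with hM
  obtain ⟨g1, g2, g3, g4⟩ := h.refresh_correct (i := 5) (j := 1) (jx := .lit 1)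
    (σ := ⟨σ.var, M⟩) (e := f) hf fun _ => Val.lit 1
  set τ := (Stmt.refresh k 5 (.lit 1)).exec K E ⟨σ.var, M⟩
  rw [exec_assign (n := l.length + 1) (by
    refine Val.add ?_ (Val.lit 1)
    rw [Val, Expr.eval, g1]
    exact hσ.length)]
  have hidx : ∀ (i : ℕ) e, l[i]? = some e → i < E.input.getD 1 0 * K ∧ i ≠ l.length ∧ (e : ℕ) ≠ f :=
    fun i e hi => by
      have := (List.getElem?_eq_some_iff.1 hi).1
      exact ⟨by omega, by omega, fun he => hfl (Fin.ext he ▸ List.mem_of_getElem? hi)⟩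
  have hsplit : ∀ (i : ℕ) e, (l ++ [f])[i]? = some e → l[i]? = some e ∨ i = l.length ∧ e = f := by
    intro i e hi
    rcases lt_trichotomy i l.length with hil | hil | hil
    · rw [List.getElem?_append_left hil] at hi
      exact Or.inl hi
    · subst hil
      simp at hi
      exact Or.inr ⟨rfl, hi.symm⟩
    · rw [List.getElem?_eq_none (by simp; omega)] at hi
      cases hi
  refine ⟨⟨hnd, ?_, ?_, ?_, ?_⟩, ?_⟩
  · rw [List.length_append]
    exact val_update_self
  · intro i e hi
    rcases hsplit i e hi with hi | ⟨rfl, rfl⟩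
    · obtain ⟨i1, i2, i3⟩ := hidx i e hi
      refine g4 0 (by decide) _ i1 _ ?_
      exact (((hσ.queue i e hi).setEntry h.fits hlen' i1 (Or.inr i2)).setEntry h.fits (h.edge_lt f)
        i1 (Or.inl (by decide))).setEntry h.fits (h.edge_lt f) i1 (Or.inl (by decide))
    · refine g4 0 (by decide) _ hlen' _ ?_
      exact (entry_setEntry_self.setEntry h.fits (h.edge_lt e) hlen' (Or.inl (by decide))).setEntry
        h.fits (h.edge_lt e) hlen' (Or.inl (by decide))
  · intro e he
    have h1 : indicator (e ∈ Set.univ) = 1 := if_pos trivial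
    rw [h1]
    refine g4 2 (by decide) _ (h.edge_lt e) _ ?_
    by_cases hef : e = f
    · subst hef; exact entry_setEntry_self
    · have hel : e ∈ l := by simpa [hef] using he
      have := hσ.pending e hel
      rw [h1] at this
      exact ((this.setEntry h.fits hlen' (h.edge_lt e) (Or.inl (by decide))).setEntry h.fits
        (h.edge_lt f) (h.edge_lt e) (Or.inl (by decide))).setEntry h.fits (h.edge_lt f)
        (h.edge_lt e) (Or.inr fun h => hef (Fin.ext h))
  · intro e he v hv
    by_cases hvf : v ∈ x.graph.edge f
    · exact g2 v hvf
    · have hel : e ∈ l := by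
        rcases List.mem_append.1 he with he | he
        · exact he
        · exact absurd (List.mem_singleton.1 he ▸ hv) hvf
      refine g3 v hvf _ ?_
      exact (((hσ.colors e hel v hv).setEntry h.fits hlen' (h.vertex_lt v)
        (Or.inl (by decide))).setEntry h.fits (h.edge_lt f) (h.vertex_lt v)
        (Or.inl (by decide))).setEntry h.fits (h.edge_lt f) (h.vertex_lt v) (Or.inl (by decide))
  · intro i e hi
    refine g4 1 (by decide) _ (h.edge_lt e) _ ?_
    rcases hsplit i e hi with hi | ⟨rfl, rfl⟩
    · obtain ⟨i1, i2, i3⟩ := hidx i e hi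
      exact (((hσ.position i e hi).setEntry h.fits hlen' (h.edge_lt e)
        (Or.inl (by decide))).setEntry h.fits (h.edge_lt f) (h.edge_lt e) (Or.inr i3)).setEntry
        h.fits (h.edge_lt f) (h.edge_lt e) (Or.inl (by decide))
    · exact entry_setEntry_self.setEntry h.fits (h.edge_lt e) (h.edge_lt e) (Or.inl (by decide))

/-- The queue is extended by the hyperedges in a set. -/
def Extended (K : ℕ) (E : Env w) (l : List (Fin x.N)) (X : Set (Fin x.N)) (σ : Store w) : Prop :=
  ∃ l', l <+: l' ∧ (∀ g, g ∈ l' ↔ g ∈ l ∨ g ∈ X) ∧ Explored K E l' σ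

omit h in
theorem Extended.update {X : Set (Fin x.N)} (hσ : Extended K E l X σ) {i : ℕ} (hi : 1 ≠ i)
    (b : BitVec w) : Extended K E l X ⟨Function.update σ.var i b, σ.mem⟩ :=
  let ⟨l', h1, h2, h3⟩ := hσ
  ⟨l', h1, h2, h3.update hi b⟩

theorem Presents.extended_enqueue {X : Set (Fin x.N)} (hσ : Extended K E l X σ) {f : Fin x.N}
    (hf : Val K E σ (.var 5) f) : Extended K E l (insert f X) ((Stmt.enqueue k).exec K E σ) := by
  obtain ⟨l', h1, h2, h3⟩ := hσ
  refine ⟨_, ?_, ?_, h.enqueue_correct h3 hf⟩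
  · split_ifs
    · exact h1
    · exact h1.trans (List.prefix_append _ _)
  · intro g
    split_ifs with hfl
    · rw [h2, Set.mem_insert_iff]
      rw [h2] at hfl
      constructor
      · tauto
      · rintro (hg | rfl | hg)
        · exact Or.inl hg
        · exact hfl
        · exact Or.inr hg
    · rw [List.mem_append, h2, List.mem_singleton, Set.mem_insert_iff]
      tauto

omit h in
theorem Explored.extended (hσ : Explored K E l σ) : Extended K E l ∅ σ :=
  ⟨l, List.prefix_rfl, by simp, hσ⟩

/-- The exploration collects the component of the vertex if that is small enough. -/
theorem Presents.explore_correct {n : ℕ} {v : Fin x.m} (hv : Val K E σ (.var 0) v)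
    (hn : (x.graph.componentAt t (tapeColor x E 0) v).card ≤ n * E.iterations) :
    ∃ l : List (Fin x.N), l.toFinset = x.graph.componentAt t (tapeColor x E 0) v ∧
      Explored K E l ((Stmt.explore d k t n).exec K E σ) := by
  have hb := h.big
  set c := tapeColor x E 0 with hc
  set C := x.graph.componentAt t c v with hC
  rw [Stmt.explore, Stmt.exec, exec_assign (Val.lit 0), Stmt.exec, exec_assign (Val.lit 0),
    Stmt.exec, exec_assign (n := v) (by simpa [Val, Expr.eval] using hv), Stmt.exec,
    Stmt.exec_loop_seqN]
  set τ : Store w := ⟨Function.update (Function.update (Function.update σ.var 1 (BitVec.ofNat w 0))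
    2 (BitVec.ofNat w 0)) 4 (BitVec.ofNat w v), σ.mem⟩ with hτ
  have hτ0 : Explored K E ([] : List (Fin x.N)) τ := by
    refine ⟨⟨List.nodup_nil, ?_, by simp, by simp, by simp⟩, by simp⟩
    simp [Val, Expr.eval, hτ]
  have hroot := h.forRow_correct (I := Extended K E []) (body := Stmt.enqueue k)
    (Stmt.keeps_enqueue (by decide)) (fun X σ b hX => hX.update (by decide) b)
    (fun X σ f _ hX hf => h.extended_enqueue hX hf) hτ0.extended (v := v)
    (by simp [Val, Expr.eval, hτ])
  have hroot2 : Val K E ((Stmt.forRow d k t (Stmt.enqueue k)).exec K E τ) (.var 2) 0 := by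
    refine Stmt.Keeps.val (Stmt.keeps_seqN fun j =>
      show Stmt.Keeps 2 (.ite _ (.seq (.assign 5 _) (.ite _ (.enqueue k) .skip)) .skip) from
      ⟨⟨(by decide : 2 ≠ 5), Stmt.keeps_enqueue (by decide), trivial⟩, trivial⟩) ?_
    simp [Val, Expr.eval, hτ]
  set τ' := (Stmt.forRow d k t (Stmt.enqueue k)).exec K E τ
  have hCmem : ∀ f, f ∈ C ↔ ∃ e ∈ x.graph.affected t c, v ∈ x.graph.edge e ∧
      f ∈ x.graph.component t c e := by simp [hC, componentAt]
  have key : ∀ r, ∃ (l : List (Fin x.N)) (i : ℕ),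
      Explored K E l (((Stmt.exploreStep d k t).exec K E)^[r] τ') ∧
      Val K E (((Stmt.exploreStep d k t).exec K E)^[r] τ') (.var 2) i ∧ i ≤ l.length ∧
      (∀ e ∈ l, e ∈ C) ∧ (∀ e ∈ x.graph.affected t c, v ∈ x.graph.edge e → e ∈ l) ∧
      (∀ j < i, ∀ e, l[j]? = some e → ∀ f ∈ x.graph.affected t c, x.graph.Meets e f → f ∈ l) ∧
      (r ≤ i ∨ i = l.length) := by
    intro r
    induction r with
    | zero =>
        obtain ⟨l, -, h2, h3⟩ := hroot
        refine ⟨l, 0, h3, hroot2, Nat.zero_le _, fun e he => ?_, fun e he hve => ?_, by simp,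
          Or.inl le_rfl⟩
        · have := (h2 e).1 he
          simp only [List.not_mem_nil, Set.empty_union, false_or] at this
          exact (hCmem e).2 ⟨e, this.1, this.2, mem_component_self e⟩
        · refine (h2 e).2 (Or.inr (Or.inr ⟨he, hve⟩))
    | succ r ih =>
        obtain ⟨l, i, h1, h2, h3, h4, h5, h6, h7⟩ := ih
        rw [Function.iterate_succ_apply']
        set ρ := ((Stmt.exploreStep d k t).exec K E)^[r] τ'
        have hlen := h1.length_le
        rw [Stmt.exploreStep, Stmt.exec_ite_indicator (h2.lt h1.length (by omega) (by omega))
          h.one_lt]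
        split_ifs with hil
        · have hi : l[i]? = some l[i] := List.getElem?_eq_getElem hil
          set e := l[i]
          rw [Stmt.exec, exec_assign (n := e) (h2.get (h1.queue i e hi)), Stmt.exec]
          have hm := h.forMeeting_correct (I := Extended K E l) (body := Stmt.enqueue k)
            (Stmt.keeps_enqueue (by decide)) (Stmt.keeps_enqueue (by decide))
            (fun X σ b hX => hX.update (by decide) b) (fun X σ b hX => hX.update (by decide) b)
            (fun X σ f _ hX hf => h.extended_enqueue hX hf)
            (h1.update (i := 3) (by decide) (BitVec.ofNat w e)).extended (e := e) val_update_self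
          have hm2 := (Stmt.keeps_forMeeting (d := d) (k := k) (t := t) (i := 2)
            (Stmt.keeps_enqueue (k := k) (by decide)) (by decide) (by decide)).val
            (val_update_of_ne (K := K) (E := E) h2 (i := 3) (by decide)
              (b := BitVec.ofNat w e) (M := ρ.mem))
          rw [exec_assign (hm2.add (Val.lit 1))]
          obtain ⟨l', ⟨l₂, rfl⟩, g2, g3⟩ := hm
          have hle : (l ++ l₂).length = l.length + l₂.length := List.length_append
          refine ⟨l ++ l₂, i + 1, g3.update (by decide) _, val_update_self, by omega,
            fun f hf => ?_, fun f hf hvf => List.mem_append_left _ (h5 f hf hvf), ?_, by omega⟩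
          · rcases (g2 f).1 hf with hf | hf
            · exact h4 f hf
            · simp only [Set.empty_union] at hf
              obtain ⟨a, ha, hva, hea⟩ := (hCmem e).1 (h4 e (List.getElem_mem hil))
              exact (hCmem f).2 ⟨a, ha, hva, mem_component_of_meets hea hf.2 hf.1⟩
          · intro j hj a haj f hf haf
            rw [List.getElem?_append_left (by omega)] at haj
            rcases Nat.lt_succ_iff_lt_or_eq.1 hj with hj | rfl
            · exact List.mem_append_left _ (h6 j hj a haj f hf haf)
            · rw [hi] at haj
              obtain rfl := Option.some.inj haj
              exact (g2 f).2 (Or.inr (Or.inr ⟨hf, haf⟩))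
        · exact ⟨l, i, h1, h2, h3, h4, h5, h6, Or.inr (by omega)⟩
  obtain ⟨l, i, h1, h2, h3, h4, h5, h6, h7⟩ := key (n * E.iterations)
  refine ⟨l, ?_, h1⟩
  have hsub : l.toFinset ⊆ C := fun e he => h4 e (List.mem_toFinset.1 he)
  have hcard := Finset.card_le_card hsub
  rw [List.toFinset_card_of_nodup h1.nodup] at hcard
  have hi : i = l.length := by omega
  refine Finset.Subset.antisymm hsub fun f hf => ?_
  rw [List.mem_toFinset]
  obtain ⟨e, he, hve, hef⟩ := (hCmem f).1 hf
  simp only [component, Finset.mem_filter, Finset.mem_univ, true_and] at hef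
  induction hef with
  | refl => exact h5 e he hve
  | @tail a b hab hb' ih =>
      have ha : a ∈ l := ih ((hCmem a).2 ⟨e, he, hve, by simpa [component] using hab⟩)
      obtain ⟨j, hj⟩ := List.mem_iff_getElem?.1 ha
      have := (List.getElem?_eq_some_iff.1 hj).1
      exact h6 j (by omega) a hj b hb'.2 hb'.1

end

end WordRAM

namespace WordRAM

open NumberedHypergraph

open scoped Classical

section

variable {d k t J K w : ℕ} {x : Instance d k} {E : Env w} {l : List (Fin x.N)}
  {s : Fin x.m → Bool} {σ : Store w} (h : Presents x t J K E)

include h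

/-- The scan of the queue finds the least pending hyperedge. -/
theorem Presents.find_correct {P : Set (Fin x.N)} {n : ℕ} (hσ : QueueState K E l P s σ)
    (hn : l.length ≤ n * E.iterations) :
    ((Stmt.find n).exec K E σ).mem = σ.mem ∧
    ((∃ e ∈ l, e ∈ P ∧ Val K E ((Stmt.find n).exec K E σ) (.var 7) e ∧
        ∀ f ∈ l, f ∈ P → e ≤ f) ∨
      (∀ f ∈ l, f ∉ P) ∧ Val K E ((Stmt.find n).exec K E σ) (.var 7) x.N) := by
  have hb := h.big
  have hlen := hσ.length_le
  rw [Stmt.find, Stmt.exec, exec_assign h.numEdges, Stmt.exec, exec_assign (Val.lit 0),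
    Stmt.exec_loop_seqN]
  set τ : Store w := ⟨Function.update (Function.update σ.var 7 (BitVec.ofNat w x.N))
    2 (BitVec.ofNat w 0), σ.mem⟩ with hτ
  have key : ∀ r, ∃ b i : ℕ, ((Stmt.findStep.exec K E)^[r] τ).mem = σ.mem ∧
      ((Stmt.findStep.exec K E)^[r] τ).var 1 = σ.var 1 ∧
      Val K E ((Stmt.findStep.exec K E)^[r] τ) (.var 2) i ∧ i ≤ l.length ∧
      (r ≤ i ∨ i = l.length) ∧ Val K E ((Stmt.findStep.exec K E)^[r] τ) (.var 7) b ∧ b ≤ x.N ∧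
      (∀ j < i, ∀ f, l[j]? = some f → f ∈ P → b ≤ f) ∧
      (b = x.N ∨ ∃ e ∈ l, e ∈ P ∧ b = e) := by
    intro r
    induction r with
    | zero =>
        exact ⟨x.N, 0, rfl, by simp [hτ], by simp [hτ, Val, Expr.eval], Nat.zero_le _,
          Or.inl le_rfl, by simp [hτ, Val, Expr.eval], le_rfl, by simp, Or.inl rfl⟩
    | succ r ih =>
        obtain ⟨b, i, h1, h2, h3, h4, h5, h6, h7, h8, h9⟩ := ih
        rw [Function.iterate_succ_apply']
        set ρ := (Stmt.findStep.exec K E)^[r] τ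
        have hρ : QueueState K E l P s ρ := hσ.of_eq h1 h2
        rw [Stmt.findStep, Stmt.exec_ite_indicator (h3.lt hρ.length (by omega) (by omega)) h.one_lt]
        split_ifs with hil
        · have hi : l[i]? = some l[i] := List.getElem?_eq_getElem hil
          have hmem : l[i] ∈ l := List.getElem_mem hil
          set e := l[i]
          have he : Val K E ρ (.get 0 (.var 2)) e := h3.get (hρ.queue i e hi)
          have hcond : Val K E ρ (.op .mul (.get 2 (.get 0 (.var 2)))
              (.op .lt (.get 0 (.var 2)) (.var 7))) (indicator (e ∈ P ∧ (e : ℕ) < b)) := by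
            refine ((he.get (hρ.pending e hmem)).mul
              (he.lt h6 (h.edge_lt_two_pow e) (by omega))).congr ?_
            by_cases h1 : e ∈ P <;> simp [indicator, h1]
          rw [Stmt.exec, Stmt.exec_ite_indicator hcond h.one_lt]
          split_ifs with hc
          · rw [exec_assign he, exec_assign (n := i + 1) (by
              refine Val.add ?_ (Val.lit 1)
              exact val_update_of_ne h3 (by decide))]
            refine ⟨e, i + 1, h1, ?_, val_update_self, hil, by omega, by simp [Val, Expr.eval],
              e.2.le, ?_, Or.inr ⟨e, hmem, hc.1, rfl⟩⟩
            · simpa using h2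
            · intro j hj f hjf hf
              rcases Nat.lt_succ_iff_lt_or_eq.1 hj with hj | rfl
              · exact hc.2.le.trans (h8 j hj f hjf hf)
              · rw [hi] at hjf
                rw [Option.some.inj hjf]
          · rw [Stmt.exec, exec_assign (h3.add (Val.lit 1))]
            refine ⟨b, i + 1, h1, ?_, val_update_self, hil, by omega,
              val_update_of_ne h6 (by decide), h7, ?_, h9⟩
            · simpa using h2
            · intro j hj f hjf hf
              rcases Nat.lt_succ_iff_lt_or_eq.1 hj with hj | rfl
              · exact h8 j hj f hjf hf
              · rw [hi] at hjf
                obtain rfl := Option.some.inj hjf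
                by_contra hlt
                exact hc ⟨hf, by omega⟩
        · exact ⟨b, i, h1, h2, h3, h4, Or.inr (by omega), h6, h7, h8, h9⟩
  obtain ⟨b, i, h1, -, -, h4, h5, h6, h7, h8, h9⟩ := key (n * E.iterations)
  have hi : i = l.length := by omega
  have hle : ∀ f ∈ l, f ∈ P → b ≤ f := fun f hf hfP => by
    obtain ⟨j, hj⟩ := List.mem_iff_getElem?.1 hf
    have := (List.getElem?_eq_some_iff.1 hj).1
    exact h8 j (by omega) f hj hfP
  refine ⟨h1, ?_⟩
  rcases h9 with rfl | ⟨e, he, heP, rfl⟩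
  · refine Or.inr ⟨fun f hf hfP => ?_, h6⟩
    have := hle f hf hfP
    omega
  · exact Or.inl ⟨e, he, heP, h6, fun f hf hfP => hle f hf hfP⟩

omit h in
theorem keeps_find {i n : ℕ} (h2 : i ≠ 2) (h7 : i ≠ 7) : (Stmt.find n).Keeps i :=
  ⟨h7, h2, show Stmt.Keeps i (.seqN n fun _ => .findStep) from Stmt.keeps_seqN fun _ =>
    ⟨⟨⟨h7, trivial⟩, h2⟩, trivial⟩⟩

/-- The program performs one step of the repair, and increments the time in variable `6`. -/
theorem Presents.fixStep_correct {n j : ℕ} {P : Finset (Fin x.N)}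
    (hP : P ⊆ l.toFinset) (hl : l.toFinset ⊆ x.graph.affected t (tapeColor x E 0))
    (hσ : QueueState K E l P s σ) (hj : Val K E σ (.var 6) j)
    (hn : l.length ≤ n * E.iterations) :
    Val K E ((Stmt.fixStep d k t n).exec K E σ) (.var 6) (j + 1) ∧
    QueueState K E l
      (x.graph.repairStep t (tapeColor x E 0) l.toFinset (tapeColor x E j) (P, s)).1
      (x.graph.repairStep t (tapeColor x E 0) l.toFinset (tapeColor x E j) (P, s)).2
      ((Stmt.fixStep d k t n).exec K E σ) := by
  have hb := h.big
  obtain ⟨f1, f2⟩ := h.find_correct (n := n) hσ hn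
  have f3 : ∀ i, i ≠ 2 → i ≠ 7 → ((Stmt.find n).exec K E σ).var i = σ.var i :=
    fun i h2 h7 => (keeps_find h2 h7).var_eq σ
  rw [Stmt.fixStep, Stmt.exec, Stmt.exec]
  set τ := (Stmt.find n).exec K E σ
  have hτ : QueueState K E l P s τ := hσ.of_eq f1 (f3 1 (by decide) (by decide))
  have hτ6 : Val K E τ (.var 6) j := (f3 6 (by decide) (by decide)).trans hj
  -- it remains to treat the conditional statement
  suffices hs : ∀ ρ : Store w, ρ = (Stmt.ite (.op .lt (.var 7) .numEdges)
      (.ite (.isMono d k t (.var 7)) (.seq (.refresh k 7 (.var 6)) (.seq (.assign 3 (.var 7))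
        (.forMeeting d k t (.put 2 (.var 5) (.lit 1))))) (.put 2 (.var 7) (.lit 0)))
        .skip).exec K E τ →
      Val K E ρ (.var 6) j ∧ QueueState K E l
        (x.graph.repairStep t (tapeColor x E 0) l.toFinset (tapeColor x E j) (P, s)).1
        (x.graph.repairStep t (tapeColor x E 0) l.toFinset (tapeColor x E j) (P, s)).2 ρ by
    obtain ⟨s1, s2⟩ := hs _ rfl
    rw [exec_assign (s1.add (Val.lit 1))]
    exact ⟨val_update_self, s2.update (by decide) _⟩
  rintro ρ rfl
  rcases f2 with ⟨e, hel, heP, he7, hmin⟩ | ⟨hPl, h7⟩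
  · have heP' : e ∈ P := heP
    have hne : P.Nonempty := ⟨e, heP'⟩
    have hmin' : P.min' hne = e := le_antisymm (Finset.min'_le _ _ heP')
      (Finset.le_min' _ _ _ fun f hf => hmin f (List.mem_toFinset.1 (hP hf)) hf)
    have hstep : x.graph.repairStep t (tapeColor x E 0) l.toFinset (tapeColor x E j) (P, s) =
        if x.graph.IsMono (x.graph.recolor t (tapeColor x E 0) s) e then
          (P ∪ l.toFinset.filter (x.graph.Meets e), splice (x.graph.edge e) s (tapeColor x E j))
        else (P.erase e, s) := by
      rw [repairStep, dif_pos hne]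
      simp only [hmin']
    rw [Stmt.exec_ite_indicator (he7.lt h.numEdges (h.edge_lt_two_pow e) (by omega)) h.one_lt,
      if_pos e.2, Stmt.exec_ite_indicator (h.isMono (s := s) he7
        fun b v hv hbv => hbv.get (hτ.colors e hel v hv)) h.one_lt,
      hstep]
    split_ifs with hmono
    · rw [Stmt.exec, Stmt.exec]
      obtain ⟨g1, g2, g3, g4⟩ := h.refresh_correct (i := 7) (j := j) (jx := .var 6) (σ := τ)
        (e := e) he7 fun _ => hτ6
      set ρ := (Stmt.refresh k 7 (.var 6)).exec K E τ
      have hρ : QueueState K E l P (splice (x.graph.edge e) s (tapeColor x E j)) ρ := by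
        refine ⟨hτ.nodup, ?_, fun i f hi => ?_, fun f hf => ?_, fun f hf v hv => ?_⟩
        · rw [Val, Expr.eval, g1]; exact hτ.length
        · have hil := (List.getElem?_eq_some_iff.1 hi).1
          exact g4 0 (by decide) i (h.edge_lt ⟨i, hil.trans_le hτ.length_le⟩) _ (hτ.queue i f hi)
        · exact g4 2 (by decide) _ (h.edge_lt f) _ (hτ.pending f hf)
        · by_cases hve : v ∈ x.graph.edge e
          · rw [splice, if_pos hve]; exact g2 v hve
          · rw [splice, if_neg hve]; exact g3 v hve _ (hτ.colors f hf v hv)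
      have hρ7 : Val K E ρ (.var 7) e := by rw [Val, Expr.eval, g1]; exact he7
      have hρ6 : Val K E ρ (.var 6) j := by rw [Val, Expr.eval, g1]; exact hτ6
      rw [exec_assign hρ7]
      have hm := h.forMeeting_correct (body := .put 2 (.var 5) (.lit 1))
        (I := fun X ρ => QueueState K E l (P ∪ X) (splice (x.graph.edge e) s (tapeColor x E j)) ρ)
        trivial trivial (fun X σ b hX => hX.update (by decide) b)
        (fun X σ b hX => hX.update (by decide) b)
        (fun X σ f _ hX hf => ?_) (X := ∅) (e := e)
        (σ := ⟨Function.update ρ.var 3 (BitVec.ofNat w e), ρ.mem⟩)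
        (by simpa using hρ.update (i := 3) (by decide) (BitVec.ofNat w e)) val_update_self
      · refine ⟨(Stmt.keeps_forMeeting (i := 6) (by trivial) (by decide) (by decide)).val
          (val_update_of_ne hρ6 (by decide)), hm.congr fun f hf => ?_⟩
        have hfl := List.mem_toFinset.2 hf
        simp [hf, hl hfl]
      · rw [exec_put hf (Val.lit 1)]
        refine ⟨hX.nodup, hX.length, fun i g hi => ?_, fun g hg => ?_, fun g hg v hv => ?_⟩
        · have hil := (List.getElem?_eq_some_iff.1 hi).1
          exact (hX.queue i g hi).setEntry h.fits (h.edge_lt f)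
            (h.edge_lt ⟨i, hil.trans_le hX.length_le⟩) (Or.inl (by decide))
        · by_cases hgf : g = f
          · subst hgf
            have h1 : indicator (g ∈ (P : Set (Fin x.N)) ∪ insert g X) = 1 := if_pos (by simp)
            rw [h1]
            exact entry_setEntry_self
          · have := (hX.pending g hg).setEntry h.fits (n := 1) (h.edge_lt f) (h.edge_lt g)
              (t := 2) (Or.inr fun h => hgf (Fin.ext h))
            simpa [hgf] using this
        · exact (hX.colors g hg v hv).setEntry h.fits (h.edge_lt f) (h.vertex_lt v)
            (Or.inl (by decide))
    · rw [exec_put he7 (Val.lit 0)]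
      refine ⟨hτ6, hτ.nodup, hτ.length, fun i g hi => ?_, fun g hg => ?_, fun g hg v hv => ?_⟩
      · have hil := (List.getElem?_eq_some_iff.1 hi).1
        exact (hτ.queue i g hi).setEntry h.fits (h.edge_lt e)
          (h.edge_lt ⟨i, hil.trans_le hτ.length_le⟩) (Or.inl (by decide))
      · by_cases hge : g = e
        · subst hge
          have h1 : indicator (g ∈ ((P.erase g : Finset (Fin x.N)) : Set (Fin x.N))) = 0 :=
            if_neg (by simp)
          rw [h1]
          exact entry_setEntry_self
        · have := (hτ.pending g hg).setEntry h.fits (n := 0) (h.edge_lt e) (h.edge_lt g)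
            (t := 2) (Or.inr fun h => hge (Fin.ext h))
          simpa [hge] using this
      · exact (hτ.colors g hg v hv).setEntry (t := 2) h.fits (h.edge_lt e) (h.vertex_lt v)
          (Or.inl (by decide))
  · have hempty : P = ∅ := Finset.eq_empty_of_forall_notMem fun f hf =>
      hPl f (List.mem_toFinset.1 (hP hf)) hf
    subst hempty
    rw [Stmt.exec_ite_indicator (h7.lt h.numEdges (by omega) (by omega)) h.one_lt,
      if_neg (lt_irrefl _), Stmt.exec, repairStep_empty]
    exact ⟨hτ6, hτ⟩

omit h in
theorem repairStep_subset {c r : Fin x.m → Bool} {C P : Finset (Fin x.N)} (hP : P ⊆ C) :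
    (x.graph.repairStep t c C r (P, s)).1 ⊆ C := by
  rw [repairStep]
  split_ifs
  · dsimp only
    split_ifs
    · exact Finset.union_subset hP (Finset.filter_subset _ _)
    · exact (Finset.erase_subset _ _).trans hP
  · exact hP

/-- If the component of a vertex is small enough to be explored, then the program computes the
colour of the vertex from the random bits, whatever is in the local memory. -/
theorem Presents.colorQuery_correct {n n' : ℕ} {v : Fin x.m} (hv : Val K E σ (.var 0) v)
    (hn : (x.graph.componentAt t (tapeColor x E 0) v).card ≤ n * E.iterations) :
    Val K E ((Stmt.colorQuery d k t n n').exec K E σ) (.var 0)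
      (x.graph.finalColor t (tapeColor x E 0) (tapeColor x E 1) (fun i => tapeColor x E (i + 2))
        (n' * E.iterations) v).toNat := by
  obtain ⟨l, hl, hτ⟩ := h.explore_correct hv hn
  have hv' : Val K E ((Stmt.explore d k t n).exec K E σ) (.var 0) v := by
    refine Stmt.Keeps.val (i := 0) ⟨(by decide : 0 ≠ 1), (by decide : 0 ≠ 2), (by decide : 0 ≠ 4),
      Stmt.keeps_seqN fun j => show Stmt.Keeps 0 (.ite _ (.seq (.assign 5 _)
        (.ite _ (.enqueue k) .skip)) .skip) from
        ⟨⟨(by decide : 0 ≠ 5), Stmt.keeps_enqueue (by decide), trivial⟩, trivial⟩,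
      show Stmt.Keeps 0 (.seqN n fun _ => .exploreStep d k t) from Stmt.keeps_seqN fun _ =>
        ⟨⟨(by decide : 0 ≠ 3), Stmt.keeps_forMeeting (Stmt.keeps_enqueue (by decide)) (by decide)
          (by decide), (by decide : 0 ≠ 2)⟩, trivial⟩⟩ hv
  rw [Stmt.colorQuery, Stmt.exec, Stmt.exec, exec_assign (Val.lit 2), Stmt.exec,
    Stmt.exec_loop_seqN]
  set τ := (Stmt.explore d k t n).exec K E σ
  set τ' : Store w := ⟨Function.update τ.var 6 (BitVec.ofNat w 2), τ.mem⟩ with hτ'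
  have hcard : l.length ≤ n * E.iterations := by
    rwa [← List.toFinset_card_of_nodup hτ.nodup, hl]
  have haff : l.toFinset ⊆ x.graph.affected t (tapeColor x E 0) := by
    rw [hl]
    intro f hf
    simp only [componentAt, Finset.mem_filter, Finset.mem_univ, true_and] at hf
    obtain ⟨e, he, -, hef⟩ := hf
    exact component_subset_affected he hef
  have key : ∀ r, Val K E (((Stmt.fixStep d k t n).exec K E)^[r] τ') (.var 0) v ∧
      Val K E (((Stmt.fixStep d k t n).exec K E)^[r] τ') (.var 6) (r + 2) ∧
      (x.graph.repair t (tapeColor x E 0) l.toFinset (fun i => tapeColor x E (i + 2)) r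
        (l.toFinset, tapeColor x E 1)).1 ⊆ l.toFinset ∧
      QueueState K E l (x.graph.repair t (tapeColor x E 0) l.toFinset
        (fun i => tapeColor x E (i + 2)) r (l.toFinset, tapeColor x E 1)).1
        (x.graph.repair t (tapeColor x E 0) l.toFinset
          (fun i => tapeColor x E (i + 2)) r (l.toFinset, tapeColor x E 1)).2
        (((Stmt.fixStep d k t n).exec K E)^[r] τ') := by
    intro r
    induction r with
    | zero =>
        refine ⟨val_update_of_ne hv' (by decide), val_update_self, subset_rfl, ?_⟩
        refine (hτ.update (i := 6) (by decide) (BitVec.ofNat w 2)).toQueueState.congr fun e he => ?_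
        simp [repair, he]
    | succ r ih =>
        obtain ⟨h1, h2, h3, h4⟩ := ih
        rw [Function.iterate_succ_apply', repair_succ]
        obtain ⟨h5, h6⟩ := h.fixStep_correct h3 haff h4 h2 hcard
        refine ⟨?_, h5.congr (by omega), repairStep_subset h3, h6⟩
        refine Stmt.Keeps.val (i := 0) (s := .fixStep d k t n)
          ⟨keeps_find (by decide) (by decide), ⟨⟨⟨Stmt.keeps_seqN fun _ => trivial,
            (by decide : 0 ≠ 3), Stmt.keeps_forMeeting (by trivial) (by decide)
          (by decide)⟩, trivial⟩, trivial⟩, (by decide : 0 ≠ 6)⟩ h1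
  obtain ⟨h1, -, -, h4⟩ := key (n' * E.iterations)
  rw [exec_assign (h.color h1 (s := (x.graph.repair t (tapeColor x E 0) l.toFinset
    (fun i => tapeColor x E (i + 2)) (n' * E.iterations) (l.toFinset, tapeColor x E 1)).2)
    fun hloose => ?_)]
  · rw [finalColor, ← hl]
    exact val_update_self
  · simp only [loose, Finset.mem_filter, Finset.mem_univ, true_and] at hloose
    obtain ⟨e, hve, hbad⟩ := hloose
    have hea : e ∈ x.graph.affected t (tapeColor x E 0) :=
      (mem_affected _).2 ⟨e, Meets.refl _ e, hbad⟩
    have hel : e ∈ l := by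
      rw [← List.mem_toFinset, hl, componentAt_eq hea hve]
      exact mem_component_self e
    exact h1.get (h4.colors e hel v hve)

end

end WordRAM

/-! ### The probability of success -/

namespace NumberedHypergraph

open Finset
open scoped Classical

variable {m N : ℕ}

theorem repair_congr {H : NumberedHypergraph m N} {t : ℕ} {c : Fin m → Bool} {C : Finset (Fin N)}
    {ρ ρ' : ℕ → Fin m → Bool} {n : ℕ} (h : ∀ i < n, ρ i = ρ' i)
    (S : Finset (Fin N) × (Fin m → Bool)) : H.repair t c C ρ n S = H.repair t c C ρ' n S := by
  induction n with
  | zero => rfl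
  | succ n ih => rw [repair_succ, repair_succ, ih fun i hi => h i (by omega), h n (by omega)]

/-- The random colourings `u` lead to a two-colouring in bounded time: the components of affected
hyperedges have size at most `a`, and each of them is repaired after `n` steps. -/
def Succeeds (H : NumberedHypergraph m N) (t a n : ℕ) (u : ℕ → Fin m → Bool) : Prop :=
  ∀ e ∈ H.affected t (u 0), #(H.component t (u 0) e) ≤ a ∧
    (H.repair t (u 0) (H.component t (u 0) e) (fun i => u (i + 2)) n
      (H.component t (u 0) e, u 1)).1 = ∅

theorem sum_extend {n : ℕ} (F : (Fin m → Bool) → (Fin m → Bool) → (ℕ → Fin m → Bool) → ℝ) :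
    ∑ ω : Fin (n + 2) → Fin m → Bool, F (extend ω 0) (extend ω 1) (fun i => extend ω (i + 2)) =
      ∑ c : Fin m → Bool, ∑ s : Fin m → Bool, ∑ ρ : Fin n → Fin m → Bool, F c s (extend ρ) := by
  rw [sum_cons]
  refine sum_congr rfl fun c _ => ?_
  rw [sum_cons]
  refine sum_congr rfl fun s _ => sum_congr rfl fun ρ _ => ?_
  have h1 := extend_cons_succ c (Fin.cons s ρ : Fin (n + 1) → Fin m → Bool)
  have h2 := extend_cons_succ s ρ
  have h3 := congrFun h1 0
  have h4 : (fun i => extend (Fin.cons c (Fin.cons s ρ : Fin (n + 1) → Fin m → Bool) :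
      Fin (n + 2) → Fin m → Bool) (i + 2)) = extend ρ := by
    rw [← h2, ← h1]
  rw [extend_cons_zero, h4]
  rw [extend_cons_zero, zero_add] at h3
  rw [h3]

variable {H : NumberedHypergraph m N} {d k t : ℕ}

theorem sum_large_component_le {n a : ℕ} {ε : ℝ} (e : Fin N)
    (h : (#{c | e ∈ H.affected t c ∧ a < #(H.component t c e)} : ℝ) ≤ ε * 2 ^ m) :
    ∑ ω : Fin (n + 2) → Fin m → Bool,
      (if e ∈ H.affected t (extend ω 0) ∧ a < #(H.component t (extend ω 0) e) then (1 : ℝ) else 0) ≤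
      ε * (2 ^ m) ^ (n + 2) := by
  rw [sum_extend (F := fun c _ _ => if e ∈ H.affected t c ∧ a < #(H.component t c e) then 1 else 0)]
  simp only [sum_const, card_univ, Fintype.card_fun, Fintype.card_fin, Fintype.card_bool,
    nsmul_eq_mul]
  rw [← mul_sum, ← mul_sum, sum_boole]
  push_cast
  calc (2 ^ m) * ((2 ^ m) ^ n * (#{c | e ∈ H.affected t c ∧ a < #(H.component t c e)} : ℝ)) ≤
      (2 ^ m) * ((2 ^ m) ^ n * (ε * 2 ^ m)) := by gcongr
    _ = _ := by ring

theorem sum_long_repair_le {n a : ℕ} {p y ε : ℝ} (hd : H.MeetsAtMost d) (hy : 1 ≤ y)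
    (hp : ∀ c e s, (#{r | H.IsMono (H.recolor t c (splice (H.edge e) s r)) e} : ℝ) ≤ p * 2 ^ m)
    (hp₀ : 0 ≤ p) (hε : y ^ a * decay p y (d + 1) ^ n ≤ ε) (e : Fin N) :
    ∑ ω : Fin (n + 2) → Fin m → Bool,
      (if #(H.component t (extend ω 0) e) ≤ a ∧
        (H.repair t (extend ω 0) (H.component t (extend ω 0) e) (fun i => extend ω (i + 2)) n
          (H.component t (extend ω 0) e, extend ω 1)).1.Nonempty then (1 : ℝ) else 0) ≤
      ε * (2 ^ m) ^ (n + 2) := by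
  have hdec := decay_nonneg hp₀ hy (d + 1)
  have hε0 : 0 ≤ ε := le_trans (by positivity) hε
  rw [sum_extend (F := fun c s ρ => if #(H.component t c e) ≤ a ∧
    (H.repair t c (H.component t c e) ρ n (H.component t c e, s)).1.Nonempty then 1 else 0)]
  have key : ∀ c : Fin m → Bool, ∑ s : Fin m → Bool, ∑ ρ : Fin n → Fin m → Bool,
      (if #(H.component t c e) ≤ a ∧ (H.repair t c (H.component t c e) (extend ρ) n
        (H.component t c e, s)).1.Nonempty then (1 : ℝ) else 0) ≤ ε * (2 ^ m) ^ (n + 1) := by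
    intro c
    by_cases hc : #(H.component t c e) ≤ a
    · simp only [hc, true_and]
      rw [sum_comm]
      refine (sum_repair_le hd hy (hp c) hp₀ _ n _).trans ?_
      gcongr
      refine le_trans ?_ hε
      gcongr
    · simp only [hc, false_and, if_false, sum_const_zero]
      positivity
  refine (sum_le_sum fun c _ => key c).trans (le_of_eq ?_)
  simp only [sum_const, card_univ, Fintype.card_fun, Fintype.card_fin, Fintype.card_bool,
    nsmul_eq_mul]
  push_cast
  ring

/-- If the search and the repair are dying branching processes, then logarithmically many steps
suffice with high probability. -/
theorem exists_card_not_succeeds_le (htk : t ≤ k)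
    (hrepair : Real.exp 1 * (2 / 2 ^ t) * (d + 1 : ℕ) < 1)
    (hsearch : Real.exp 1 * badProb k t *
      (d * (d - 1) + d * (d - 1) ^ 2 + d * (d - 1) ^ 3 : ℕ) < 1) :
    ∃ a b : ℕ, ∀ {m N : ℕ} (H : NumberedHypergraph m N), H.IsUniform k → H.MeetsAtMost d →
      ∀ l, 0 < l → N < 2 ^ l →
        (#{ω : Fin (b * l + 2) → Fin m → Bool |
          ¬ H.Succeeds t (a * l) (b * l) (extend ω)} : ℝ) * N ≤ (2 ^ m) ^ (b * l + 2) := by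
  have hq : 0 ≤ badProb k t := by unfold badProb; positivity
  have hp : (0 : ℝ) ≤ 2 / 2 ^ t := by positivity
  obtain ⟨y₁, hy₁, h₁⟩ := exists_decay_lt_one hq hsearch
  obtain ⟨y₂, hy₂, h₂⟩ := exists_decay_lt_one hp hrepair
  obtain ⟨b₁, hb₁⟩ := exists_pow_mul_decay_le hq hy₁ h₁ (d + 1)
  obtain ⟨b₂, hb₂⟩ := exists_pow_mul_decay_le hp hy₂ h₂ ((d + 1) ^ 2 * b₁)
  refine ⟨(d + 1) ^ 2 * b₁, b₂, fun {m N} H hk hd l hl hN => ?_⟩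
  set n := b₂ * l
  set a := (d + 1) ^ 2 * b₁ * l with ha
  set ε : ℝ := (1 / 8) ^ l with hε
  have hlarge : ∀ e, (#{c | e ∈ H.affected t c ∧ a < #(H.component t c e)} : ℝ) ≤ ε * 2 ^ m := by
    intro e
    have := card_large_component_le (t := t) hk hd hy₁ (b₁ * l) e
    rw [← mul_assoc, ← ha] at this
    refine this.trans ?_
    gcongr
    refine le_trans ?_ (hb₁ l)
    have hdec := decay_nonneg hq hy₁ (d * (d - 1) + d * (d - 1) ^ 2 + d * (d - 1) ^ 3)
    gcongr
    · exact Nat.le_mul_of_pos_right _ hl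
  have hsub : (#{ω : Fin (n + 2) → Fin m → Bool | ¬ H.Succeeds t a n (extend ω)} : ℝ) ≤
      ∑ e : Fin N, ∑ ω : Fin (n + 2) → Fin m → Bool,
        ((if e ∈ H.affected t (extend ω 0) ∧ a < #(H.component t (extend ω 0) e) then (1 : ℝ)
          else 0) +
        (if #(H.component t (extend ω 0) e) ≤ a ∧
        (H.repair t (extend ω 0) (H.component t (extend ω 0) e) (fun i => extend ω (i + 2)) n
          (H.component t (extend ω 0) e, extend ω 1)).1.Nonempty then (1 : ℝ) else 0)) := by
    rw [sum_comm, Finset.card_filter]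
    push_cast
    refine sum_le_sum fun ω _ => ?_
    have h0 : ∀ (p : Prop) [Decidable p], (0 : ℝ) ≤ if p then 1 else 0 := fun p _ => by
      split_ifs <;> norm_num
    by_cases hω : ¬ H.Succeeds t a n (extend ω)
    · rw [if_pos hω]
      unfold Succeeds at hω
      push Not at hω
      obtain ⟨e, he, h⟩ := hω
      refine le_trans ?_ (single_le_sum (fun e _ => add_nonneg (h0 _) (h0 _)) (mem_univ e))
      rcases le_or_gt #(H.component t (extend ω 0) e) a with h1 | h1
      · rw [if_pos (c := _ ≤ a ∧ _) ⟨h1, h h1⟩]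
        exact le_add_of_nonneg_left (h0 _)
      · rw [if_pos (c := _ ∧ a < _) ⟨he, h1⟩]
        exact le_add_of_nonneg_right (h0 _)
    · rw [if_neg hω]
      exact sum_nonneg fun e _ => add_nonneg (h0 _) (h0 _)
  have hsum : (#{ω : Fin (n + 2) → Fin m → Bool | ¬ H.Succeeds t a n (extend ω)} : ℝ) ≤
      N * (2 * (ε * (2 ^ m) ^ (n + 2))) := by
    refine hsub.trans ((sum_le_sum (g := fun _ => 2 * (ε * (2 ^ m) ^ (n + 2)))
      fun e _ => ?_).trans (le_of_eq ?_))
    · rw [sum_add_distrib, two_mul]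
      exact add_le_add (sum_large_component_le e (hlarge e)) (sum_long_repair_le hd hy₂
        (fun c e s => card_isMono_le htk (hk e) c s) hp (hb₂ l) e)
    · simp
  -- there are `N` hyperedges with two ways to fail each, and `1 / N` is to be beaten: this is why
  -- the processes have to survive with probability at most `8 ^ (-l)`
  have hεN : ε * (2 * N ^ 2) ≤ 1 := by
    rw [hε, one_div, inv_pow, inv_mul_le_iff₀ (by positivity), mul_one]
    have h1 : (N : ℝ) ≤ 2 ^ l := by exact_mod_cast hN.le
    have h2 : (2 : ℝ) ≤ 2 ^ l := by simpa using pow_le_pow_right₀ (by norm_num : (1 : ℝ) ≤ 2) hl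
    calc 2 * (N : ℝ) ^ 2 ≤ 2 ^ l * (2 ^ l) ^ 2 := by gcongr
      _ = 8 ^ l := by rw [← pow_succ', ← pow_mul, mul_comm, pow_mul]; norm_num
  calc _ ≤ N * (2 * (ε * (2 ^ m) ^ (n + 2))) * N := by gcongr
    _ = ε * (2 * N ^ 2) * (2 ^ m) ^ (n + 2) := by ring
    _ ≤ 1 * (2 ^ m) ^ (n + 2) := by gcongr
    _ = _ := one_mul _

end NumberedHypergraph

/-! ### Random tapes -/

namespace WordRAM

open scoped Classical

/-- The random bits at the addresses `v + m * j`, as a sequence of `n` colourings. -/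
def tapeColors (m n : ℕ) {w : ℕ} (R : RandomTape w) : Fin n → Fin m → Bool :=
  fun j v => tapeBit R (v + m * j)

/-- Distinct cells of a uniformly random tape give independent uniformly random bits: all values
of `tapeColors` are taken equally often, because a set of cells can be flipped. -/
theorem card_tapeColors {m n w : ℕ} (hw : 0 < w) (h : m * n ≤ 2 ^ w)
    (Q : (Fin n → Fin m → Bool) → Prop) :
    Nat.card {R : RandomTape w // Q (tapeColors m n R)} * (2 ^ m) ^ n =
      Nat.card {ω // Q ω} * Nat.card (RandomTape w) := by
  have hinj : ∀ (j j' : Fin n) (v v' : Fin m),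
      BitVec.ofNat w (v + m * j) = BitVec.ofNat w (v' + m * j') → j = j' ∧ v = v' := by
    intro j j' v v' heq
    have hlt : ∀ (j : Fin n) (v : Fin m), v + m * j < 2 ^ w := fun j v => by
      have := Nat.mul_le_mul_left m (Nat.succ_le_of_lt j.2)
      have := v.2
      rw [Nat.mul_succ] at *
      omega
    have h1 := congrArg BitVec.toNat heq
    rw [BitVec.toNat_ofNat, BitVec.toNat_ofNat, Nat.mod_eq_of_lt (hlt j v),
      Nat.mod_eq_of_lt (hlt j' v')] at h1
    have hm : 0 < m := v.pos
    have h2 := congrArg (· % m) h1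
    have h3 := congrArg (· / m) h1
    simp only [Nat.add_mul_mod_self_left, Nat.mod_eq_of_lt v.2, Nat.mod_eq_of_lt v'.2] at h2
    simp only [Nat.add_mul_div_left _ _ hm, Nat.div_eq_of_lt v.2, Nat.div_eq_of_lt v'.2] at h3
    exact ⟨Fin.ext (by omega), Fin.ext h2⟩
  have hone : (1#w).getLsbD 0 = true := by
    rw [BitVec.getLsbD, Nat.testBit_zero, BitVec.toNat_ofNat,
      Nat.mod_eq_of_lt (Nat.one_lt_two_pow hw.ne')]
    rfl
  -- flip the bits given by `β`
  let flip (β : Fin n → Fin m → Bool) (R : RandomTape w) : RandomTape w := fun a =>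
    R a ^^^ if ∃ (j : Fin n) (v : Fin m), a = BitVec.ofNat w (v + m * j) ∧ β j v = true then 1#w
      else 0#w
  have hflip : ∀ β R, flip β (flip β R) = R := by
    intro β R
    funext a
    simp only [flip, BitVec.xor_assoc, BitVec.xor_self, BitVec.xor_zero]
  have hcol : ∀ β R, tapeColors m n (flip β R) = fun j v => (tapeColors m n R j v ^^ β j v) := by
    intro β R
    funext j v
    have : (∃ (j' : Fin n) (v' : Fin m),
        BitVec.ofNat w (v + m * j) = BitVec.ofNat w (v' + m * j') ∧ β j' v' = true) ↔
        β j v = true := by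
      constructor
      · rintro ⟨j', v', h1, h2⟩
        obtain ⟨rfl, rfl⟩ := hinj _ _ _ _ h1
        exact h2
      · exact fun h1 => ⟨j, v, rfl, h1⟩
    simp only [tapeColors, tapeBit, flip, BitVec.getLsbD_xor, this]
    cases β j v <;> simp [hone]
  have hfibre : ∀ β, Nat.card {R : RandomTape w // tapeColors m n R = β} =
      Nat.card {R : RandomTape w // tapeColors m n R = fun _ _ => false} := by
    intro β
    refine Nat.card_congr ⟨fun R => ⟨flip β R.1, ?_⟩, fun R => ⟨flip β R.1, ?_⟩,
      fun R => Subtype.ext (hflip β R.1), fun R => Subtype.ext (hflip β R.1)⟩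
    · rw [hcol, R.2]; simp
    · rw [hcol, R.2]; simp
  have hcount : ∀ Q : (Fin n → Fin m → Bool) → Prop,
      Nat.card {R : RandomTape w // Q (tapeColors m n R)} = Nat.card {ω // Q ω} *
        Nat.card {R : RandomTape w // tapeColors m n R = fun _ _ => false} := by
    intro Q
    rw [Nat.card_congr (Equiv.sigmaFiberEquiv fun R : {R : RandomTape w // Q (tapeColors m n R)} =>
      (⟨tapeColors m n R.1, R.2⟩ : {ω // Q ω})).symm, Nat.card_sigma, Nat.card_eq_fintype_card,
      ← Finset.card_univ, ← smul_eq_mul, ← Finset.sum_const]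
    refine Finset.sum_congr rfl fun ω _ => ?_
    rw [← hfibre ω.1]
    refine Nat.card_congr ⟨fun R => ⟨R.1.1, congrArg Subtype.val R.2⟩,
      fun R => ⟨⟨R.1, R.2.symm ▸ ω.2⟩, Subtype.ext R.2⟩, fun _ => rfl, fun _ => rfl⟩
  have htotal := hcount fun _ => True
  have h1 : Nat.card {ω : Fin n → Fin m → Bool // True} = (2 ^ m) ^ n := by
    rw [Nat.card_congr (Equiv.subtypeUnivEquiv fun _ => trivial)]
    simp
  rw [h1, Nat.card_congr (Equiv.subtypeUnivEquiv fun _ => trivial)] at htotal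
  rw [hcount Q, htotal]
  ring

/-! ### Sequences of queries -/

/-- If every query is answered from every memory, then so is every sequence of queries. -/
theorem isSome_answers {w m : ℕ} {A : Program} {E : Env w} {T : ℕ}
    (h : ∀ (v : Fin m) M, ∃ c, run A E T (start v M) = some c) (q : List (Fin m)) (M : Memory w) :
    (answers A E T M (q.map Fin.val)).isSome := by
  induction q generalizing M with
  | nil => rfl
  | cons v q ih =>
      obtain ⟨c, hc⟩ := h v M
      rw [List.map_cons, answers, hc, Option.bind_some, Option.isSome_map]
      exact ih c.mem

/-- If the answers to single queries do not depend on the memory, then those to a sequence of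
queries are consistent. -/
theorem answers_eq {w m : ℕ} {A : Program} {E : Env w} {T : ℕ} {y : Fin m → ℕ}
    (h : ∀ (v : Fin m) M, ∃ c, run A E T (start v M) = some c ∧ (c.reg 0).toNat = y v)
    (q : List (Fin m)) (M : Memory w) :
    answers A E T M (q.map Fin.val) = some (q.map y) := by
  induction q generalizing M with
  | nil => rfl
  | cons v q ih =>
      obtain ⟨c, hc, hv⟩ := h v M
      rw [List.map_cons, answers, hc, Option.bind_some, ih, hv]
      rfl

theorem size_eq_log_add_one {n : ℕ} (hn : 0 < n) : Nat.size n = Nat.log 2 n + 1 :=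
  le_antisymm (Nat.size_le.2 (Nat.lt_pow_succ_log_self one_lt_two n))
    (Nat.lt_size.2 (Nat.pow_log_le_self 2 hn.ne'))

end WordRAM

/-! ### The local computation algorithm -/

section

open WordRAM NumberedHypergraph

open scoped Classical

/-- Logarithmic word length suffices for all numbers that the program handles. -/
theorem exists_word_length (d k t b : ℕ) : ∃ B : ℕ, ∀ (x : Instance d k) (w : ℕ),
    B * (Nat.log 2 x.N + 1) ≤ w →
      4 * (x.N * (k + 1)) + x.array.length + x.m + x.N + d + k + t + (b * (Nat.log 2 x.N + 1) + 1) +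
        x.m * (b * (Nat.log 2 x.N + 1) + 1 + 1) + 4 < 2 ^ w := by
  set S := 4 * (k + 1) + (5 * k + 3) + k + 1 + d + k + t + (b + 1) + k * (b + 2) + 4 with hS
  refine ⟨S + 2, fun x w hw => ?_⟩
  set l := Nat.log 2 x.N + 1 with hl
  set q := 2 ^ l with hq
  have hN : x.N ≤ q := (Nat.lt_pow_succ_log_self one_lt_two x.N).le
  have hlq : l ≤ q := Nat.lt_two_pow_self.le
  have hl1 : 1 ≤ l := by omega
  have hq1 : 1 ≤ q := Nat.one_le_two_pow
  have hqq : q ≤ q * q := Nat.le_mul_of_pos_left q hq1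
  have hm : x.m ≤ k * q := x.m_le.trans (Nat.mul_le_mul_left k hN)
  have hlen : x.array.length ≤ 2 + x.m + x.N + 4 * (x.N * k) := by
    have h1 := x.isArray.length_le
    have h2 : ∑ e, (x.graph.edge e).card = x.N * k := by
      rw [Finset.sum_congr rfl fun e _ => x.uniform e]
      simp
    rwa [h2] at h1
  have hNk : x.N * k ≤ k * q := by rw [mul_comm]; exact Nat.mul_le_mul_left k hN
  have hbl : b * l ≤ b * q := Nat.mul_le_mul_left b hlq
  have hlast : x.m * (b * l + 1 + 1) ≤ k * (b + 2) * (q * q) := by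
    calc x.m * (b * l + 1 + 1) ≤ (k * q) * ((b + 2) * q) := by
          refine Nat.mul_le_mul hm ?_
          rw [add_mul]
          omega
      _ = _ := by ring
  have hpow : S * (q * q) < 2 ^ w := by
    calc S * (q * q) < 2 ^ S * (q * q) := Nat.mul_lt_mul_of_pos_right Nat.lt_two_pow_self (by omega)
      _ ≤ (2 ^ l) ^ S * (q * q) := by
          gcongr
          exact Nat.le_self_pow (by omega) 2
      _ = 2 ^ ((S + 2) * l) := by rw [hq]; ring
      _ ≤ 2 ^ w := Nat.pow_le_pow_right (by norm_num) hw
  refine lt_of_le_of_lt ?_ hpow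
  have h4 : ∀ c : ℕ, c ≤ c * (q * q) := fun c => Nat.le_mul_of_pos_right c (by positivity)
  have h5 : ∀ c : ℕ, c * q ≤ c * (q * q) := fun c => Nat.mul_le_mul_left c hqq
  calc _ ≤ 4 * (k + 1) * (q * q) + (5 * k + 3) * (q * q) + k * (q * q) + 1 * (q * q) + d * (q * q) +
        k * (q * q) + t * (q * q) + (b + 1) * (q * q) + k * (b + 2) * (q * q) + 4 * (q * q) := by
        have e1 : 4 * (x.N * (k + 1)) ≤ 4 * (k + 1) * (q * q) := by
          refine le_trans ?_ (h5 _)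
          rw [mul_assoc, mul_comm x.N]
          gcongr
        have e2 : x.array.length ≤ (5 * k + 3) * (q * q) := by
          refine le_trans ?_ (h5 _)
          rw [add_mul, mul_assoc]
          omega
        have e3 := h5 (b + 1)
        rw [add_mul] at e3
        have e4 := h5 k
        have := h4 d
        have := h4 k
        have := h4 t
        omega
    _ = S * (q * q) := by rw [hS]; ring

/-- On random bits that succeed, the outputs of the program agree with one two-colouring. -/
theorem exists_answers_eq {d k t n n' K w C : ℕ} {x : Instance d k} {E : Env w} (ht : 0 < t)
    (h : Presents x t C K E) {T : ℕ}
    (hT : (Stmt.colorQuery d k t n n').cost K 0 *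
      E.iterations ^ (Stmt.colorQuery d k t n n').depth ≤ T)
    {u : ℕ → Fin x.m → Bool} (hu : ∀ j < n' * E.iterations + 2, u j = tapeColor x E j)
    (hs : x.graph.Succeeds t (n * E.iterations) (n' * E.iterations) u) (q : List (Fin x.m))
    (M : Memory w) :
    ∃ y, x.graph.IsTwoColoring y ∧
      answers ((Stmt.colorQuery d k t n n').program K) E T M (q.map Fin.val) = some (q.map y) := by
  unfold Succeeds at hs
  rw [hu 0 (by omega), hu 1 (by omega)] at hs
  set f := x.graph.finalColor t (tapeColor x E 0) (tapeColor x E 1)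
    (fun i => tapeColor x E (i + 2)) (n' * E.iterations)
  have hmono : ∀ e, ¬ x.graph.IsMono f e := not_isMono_finalColor ht fun e he => by
    rw [repair_congr fun i hi => (hu (i + 2) (by omega)).symm]
    exact (hs e he).2
  refine ⟨fun v => (f v).toNat, ⟨fun v => ?_, fun e => ?_⟩, answers_eq (fun v M => ?_) q M⟩
  · cases f v <;> simp
  · by_contra hcon
    push Not at hcon
    obtain ⟨u, hu⟩ := x.graph.edge_nonempty e
    refine hmono e ⟨f u, fun v hv => ?_⟩
    have := hcon v hv u hu
    revert this
    cases f v <;> cases f u <;> simp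
  · obtain ⟨c, hc, hst⟩ := (Stmt.colorQuery d k t n n').run_program h.fits hT (start v M) rfl
    refine ⟨c, hc, ?_⟩
    have hv : Val K E (start v M : Config w).store (.var 0) v := by
      simp [Val, Expr.eval, Config.store, start]
    have hval := h.colorQuery_correct (n := n) (n' := n') hv (by
      by_cases hx : ∃ e ∈ x.graph.affected t (tapeColor x E 0), v ∈ x.graph.edge e
      · obtain ⟨e, he, hve⟩ := hx
        rw [componentAt_eq he hve]
        exact (hs e he).1
      · have : x.graph.componentAt t (tapeColor x E 0) v = ∅ := by
          refine Finset.eq_empty_of_forall_notMem fun g hg => hx ?_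
          simp only [componentAt, Finset.mem_filter, Finset.mem_univ, true_and] at hg
          obtain ⟨e, he, hve, -⟩ := hg
          exact ⟨e, he, hve⟩
        rw [this]
        exact Nat.zero_le _)
    rw [← hst] at hval
    change c.reg 0 = _ at hval
    rw [hval, BitVec.toNat_ofNat, Nat.mod_eq_of_lt]
    exact (Bool.toNat_le _).trans_lt h.one_lt

/-- The program answers each query in polylogarithmic time, and errs with probability at most
`1 / N`. -/
theorem isLCA_colorQuery {d k t a b B : ℕ} (ht : 0 < t)
    (hab : ∀ {m N : ℕ} (H : NumberedHypergraph m N), H.IsUniform k → H.MeetsAtMost d →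
      ∀ l, 0 < l → N < 2 ^ l →
        ((Finset.univ.filter fun ω : Fin (b * l + 2) → Fin m → Bool =>
          ¬ H.Succeeds t (a * l) (b * l) (extend ω)).card : ℝ) * N ≤ (2 ^ m) ^ (b * l + 2))
    (hB : ∀ (x : Instance d k) (w : ℕ), B * (Nat.log 2 x.N + 1) ≤ w →
      4 * (x.N * (k + 1)) + x.array.length + x.m + x.N + d + k + t + (b * (Nat.log 2 x.N + 1) + 1) +
        x.m * (b * (Nat.log 2 x.N + 1) + 1 + 1) + 4 < 2 ^ w) :
    IsLCA ((Stmt.colorQuery d k t a b).program (k + 1)) (twoColoringProblem d k)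
      (fun N => (4 * (k + 1) + (Stmt.colorQuery d k t a b).cost (k + 1) 0) *
        (Nat.log 2 N + 1) ^ (Stmt.colorQuery d k t a b).depth)
      (fun N => (4 * (k + 1) + (Stmt.colorQuery d k t a b).cost (k + 1) 0) * N)
      (fun N => 1 / (N : ℝ)) := by
  refine ⟨B, fun (x : Instance d k) w hw (q : List (Fin x.m)) => ?_⟩
  dsimp only [twoColoringProblem] at hw ⊢
  have hbig := hB x w hw
  have hlog : x.N < 2 ^ (Nat.log 2 x.N + 1) := Nat.lt_pow_succ_log_self one_lt_two x.N
  have hl : 0 < Nat.log 2 x.N + 1 := Nat.succ_pos _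
  have hsize := size_eq_log_add_one x.N_pos
  generalize Nat.log 2 x.N + 1 = l at *
  set s := Stmt.colorQuery d k t a b with hs
  set C := 4 * (k + 1) + s.cost (k + 1) 0 with hC
  set n := b * l + 2 with hn
  have hpres : ∀ R : RandomTape w,
      Presents x t (b * l + 1) (k + 1) ⟨x.array, R, C * x.N⟩ := fun R => by
    have hN : x.array.getD 1 0 = x.N := x.isArray.hyperedges
    refine ⟨rfl, ⟨?_, k.succ_pos, ?_, ?_⟩, k.le_succ, hbig⟩
    · rw [hN]; exact x.N_pos
    · rw [hN]; omega
    · rw [hN]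
      calc 4 * (x.N * (k + 1)) = 4 * (k + 1) * x.N := by ring
        _ ≤ C * x.N := Nat.mul_le_mul_right _ (Nat.le_add_right _ _)
  have hiter : ∀ R : RandomTape w, (⟨x.array, R, C * x.N⟩ : Env w).iterations = l := fun R => by
    rw [Env.iterations, x.isArray.hyperedges, hsize]
  have hT : ∀ R : RandomTape w, s.cost (k + 1) 0 *
      (⟨x.array, R, C * x.N⟩ : Env w).iterations ^ s.depth ≤ C * l ^ s.depth := fun R => by
    rw [hiter]
    exact Nat.mul_le_mul_right _ (Nat.le_add_left _ _)
  refine ⟨fun R => isSome_answers (fun v M =>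
    (s.run_program (hpres R).fits (hT R) (start v M) rfl).imp fun c hc => hc.1) q _, ?_⟩
  have hw0 : 0 < w := by
    rcases Nat.eq_zero_or_pos w with rfl | h
    · simp at hbig
    · exact h
  have hcard := card_tapeColors (m := x.m) (n := n) hw0
    (by have : x.m * n = x.m * (b * l + 1 + 1) := rfl
        omega)
    fun ω => x.graph.Succeeds t (a * l) (b * l) (extend ω)
  have hfail := hab x.graph x.uniform x.meets l hl hlog
  have hcompl : (Nat.card {ω : Fin n → Fin x.m → Bool //
      x.graph.Succeeds t (a * l) (b * l) (extend ω)} : ℝ) +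
      (Finset.univ.filter fun ω : Fin n → Fin x.m → Bool =>
        ¬ x.graph.Succeeds t (a * l) (b * l) (extend ω)).card = (2 ^ x.m) ^ n := by
    rw [Nat.card_eq_fintype_card, Fintype.card_subtype, ← Nat.cast_add,
      Finset.card_filter_add_card_filter_not]
    simp
  have hN : (0 : ℝ) < x.N := by exact_mod_cast x.N_pos
  have htape : (0 : ℝ) < Nat.card (RandomTape w) := by exact_mod_cast Nat.card_pos
  rw [le_div_iff₀ htape]
  calc (1 - 1 / (x.N : ℝ)) * Nat.card (RandomTape w) ≤
      (Nat.card {R : RandomTape w //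
        x.graph.Succeeds t (a * l) (b * l) (extend (tapeColors x.m n R))} : ℝ) := by
        refine le_of_mul_le_mul_right ?_ (show (0 : ℝ) < (2 ^ x.m) ^ n by positivity)
        have h6 : (Nat.card {R : RandomTape w //
            x.graph.Succeeds t (a * l) (b * l) (extend (tapeColors x.m n R))} : ℝ) * (2 ^ x.m) ^ n =
            Nat.card {ω : Fin n → Fin x.m → Bool //
              x.graph.Succeeds t (a * l) (b * l) (extend ω)} * Nat.card (RandomTape w) := by
          exact_mod_cast hcard
        rw [h6, mul_right_comm]
        gcongr
        rw [← le_div_iff₀ hN] at hfail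
        rw [sub_mul, one_mul, one_div, inv_mul_eq_div]
        linarith
    _ ≤ _ := by
        refine Nat.cast_le.2 (Nat.card_le_card_of_injective
          (fun R => ⟨R.1, ?_⟩) fun R R' h => Subtype.ext (congrArg (fun S => S.1) h))
        refine exists_answers_eq (x := x) ht (hpres R.1) (hT R.1)
          (u := extend (tapeColors x.m n R.1)) (fun j hj => ?_) ?_ q _
        · rw [hiter] at hj
          rw [extend, dif_pos hj]
          rfl
        · rw [hiter]
          exact R.2

end

theorem theorem6p1 (d k k₁ k₂ k₃ : ℕ)
    (hk₁ : 0 < k₁) (hk₂ : 0 < k₂) (hk₃ : 0 < k₃) (hk : k₁ + k₂ + k₃ = k)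
    (h₁ : 16 * (d : ℝ) * ((d : ℝ) - 1) ^ 3 * ((d : ℝ) + 1) < 2 ^ k₁)
    (h₂ : 16 * (d : ℝ) * ((d : ℝ) - 1) ^ 3 * ((d : ℝ) + 1) < 2 ^ k₂)
    (h₃ : 2 * Real.exp 1 * ((d : ℝ) + 1) < 2 ^ k₃) :
    ∃ (A : WordRAM.Program) (C a : ℕ),
      IsLCA A (NumberedHypergraph.twoColoringProblem d k)
        (fun N => C * (Nat.log 2 N + 1) ^ a) (fun N => C * N) (fun N => 1 / (N : ℝ)) := by
  obtain ⟨t, ht, htk, hrepair, hsearch⟩ := NumberedHypergraph.exists_threshold hk h₁ h₂ h₃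
  obtain ⟨a, b, hab⟩ := NumberedHypergraph.exists_card_not_succeeds_le htk hrepair hsearch
  obtain ⟨B, hB⟩ := exists_word_length d k t b
  exact ⟨_, _, _, isLCA_colorQuery ht hab hB⟩
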